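/- Let $n\ge 2$, $k\ge 2$, and let $S_n$ be the star with centre $v_0$ and $n$ outer vertices $v_1,\dots,v_n$, with the path metric in which every edge $[v_0,v_i]$ has length $\kappa$, where $\kappa\ge k-1$ is fixed. For $j\ge 1$ let $U_j(S_n)$ be the space of $j$-element subsets of $S_n$ (with the quotient topology from the ordered configurations of $j$ distinct points) and, for $c\in U_j(S_n)$, let $B_j(S_n,c)=\pi_1(U_j(S_n),c)$. For a finite set $c\subset S_n$ put $A_i(c)=c\cap[v_0,v_i]$; if nonempty, this is an arm of $c$. Call $c$ a chain if $|c\cap[x,y]|=1+d(x,y)$ for all $x,y\in c$. Call $c$ regular if $A_i(c)\neq\emptyset$ for at least two indices $i$ and there is an arm $A_m(c)$ with $d(A_m(c),v_0)=d(c,v_0)$ such that $A_m(c)\cup A_i(c)$ is a chain for all $i$. Let $D_j(S_n)\subset U_j(S_n)$ be the subspace of regular configurations; it is a graph whose vertices are the $c$ with $d(c,v_0)\in\{0,1/2\}$ and whose edges are the sets $[c_0,c_1]=\{c\in D_j(S_n) : d(c,c_0)+d(c,c_1)=1/2\}$ for vertices $c_0,c_1$ at Hausdorff distance $d(c_0,c_1)=1/2$,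 each with linear coordinate $2d(c,v_0)\in[0,1]$. Fix $a\in\{1,\dots,n\}$. Then for every $c\in D_{k-1}(S_n)$ there is a unique point $x\in[v_0,v_a]$ such that $c\cup\{x\}\in D_k(S_n)$. The map $i_k:D_{k-1}(S_n)\to D_k(S_n)$, $c\mapsto c\cup\{x\}$, is a simplicial embedding: it is a topological embedding, maps vertices to vertices and each edge $[c_0,c_1]$ onto the edge $[i_k(c_0),i_k(c_1)]$, and preserves $d(\cdot,v_0)$. For every base point $c_{k-1}\in D_{k-1}(S_n)$, with $c_k=i_k(c_{k-1})$, the inclusions induce isomorphisms $\pi_1(D_j(S_n),c_j)\cong B_j(S_n,c_j)$ for $j=k-1,k$, and the homomorphism $i_{k*}:B_{k-1}(S_n,c_{k-1})\to B_k(S_n,c_k)$ that corresponds to $\pi_1(i_k)$ under these isomorphisms is injective. Moreover $B_{k-1}(S_n,c_{k-1})$ is free, and for every free basis $\beta_{k-1}$ of it there is a free basis $\beta_k$ of $B_k(S_n,c_k)$ such that $i_{k*}$ maps $\beta_{k-1}$ injectively into $\beta_k$. -/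

import Mathlib

open scoped NNReal

namespace StarBraid

/-! ### The star -/

/-- The points of the star with `n` legs of length `κ`: vectors with entries in `[0, κ]`, at most
one of which is nonzero. -/
def starSet (n : ℕ) (κ : ℝ≥0) : Set (PiLp 1 (fun _ : Fin n => ℝ)) :=
  {x | (∀ i, 0 ≤ x i ∧ x i ≤ κ) ∧ ∀ i j, i ≠ j → x i = 0 ∨ x j = 0}

/-- The star `S_n` with its path metric scaled so that every edge `[v₀, vᵢ]` has length `κ`.
The path metric is the restriction of the `ℓ¹` metric: points at distances `s`, `t` from the
centre are at distance `|s - t|` if they lie on one leg, and `s + t` if they lie on two legs. -/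
abbrev Star (n : ℕ) (κ : ℝ≥0) : Type := ↥(starSet n κ)

/-- The central vertex `v₀`. -/
def center (n : ℕ) (κ : ℝ≥0) : Star n κ :=
  ⟨0, fun _ => ⟨le_rfl, κ.2⟩, fun _ _ _ => Or.inl rfl⟩

/-- The outer vertex `vᵢ` (legs are numbered by `Fin n`). -/
def leaf {n : ℕ} (κ : ℝ≥0) (i : Fin n) : Star n κ :=
  ⟨WithLp.toLp 1 (Pi.single i (κ : ℝ)), by
    refine ⟨fun j => ?_, fun j l hjl => ?_⟩
    · by_cases h : j = i
      · subst h; simp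
      · simp [Pi.single_eq_of_ne h]
    · by_cases h : j = i
      · right
        have hl : l ≠ i := fun hl => hjl (h.trans hl.symm)
        simp [Pi.single_eq_of_ne hl]
      · left
        simp [Pi.single_eq_of_ne h]⟩

/-- The geodesic segment `[x, y]` (in a tree: all points between `x` and `y`). -/
def seg {X : Type*} [MetricSpace X] (x y : X) : Set X :=
  {z | dist x z + dist z y = dist x y}

/-! ### Unordered configuration spaces -/

/-- The unordered `k`-point configuration space: the `k`-element subsets of `X`. -/
def UConf (X : Type*) (k : ℕ) : Type _ := {c : Finset X // c.card = k}

/-- The projection `X^k - Δ(X) → U_k(X)`, `(x₁, …, x_k) ↦ {x₁, …, x_k}`. -/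
def UConf.proj (X : Type*) (k : ℕ) (x : {x : Fin k → X // Function.Injective x}) : UConf X k :=
  ⟨Finset.univ.map ⟨x.1, x.2⟩, by simp⟩

/-- The quotient topology with respect to `UConf.proj`. -/
instance (X : Type*) [TopologicalSpace X] (k : ℕ) : TopologicalSpace (UConf X k) :=
  TopologicalSpace.coinduced (UConf.proj X k) inferInstance

/-- The set of points of a configuration. -/
def UConf.pts {X : Type*} {k : ℕ} (c : UConf X k) : Set X := (c.1 : Set X)

/-! ### Regular configurations -/

/-- A finite set `c` is a chain if `|c ∩ [x, y]| = 1 + d(x, y)` for all `x, y ∈ c`. -/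
def IsUnitChain {X : Type*} [MetricSpace X] (c : Set X) : Prop :=
  c.Finite ∧ ∀ x ∈ c, ∀ y ∈ c, ((c ∩ seg x y).ncard : ℝ) = 1 + dist x y

variable {n : ℕ} {κ : ℝ≥0}

/-- `A_i(c) = c ∩ [v₀, vᵢ]`; it is an arm of `c` when it is nonempty. -/
def arm (c : Set (Star n κ)) (i : Fin n) : Set (Star n κ) :=
  c ∩ seg (center n κ) (leaf κ i)

/-- `A_m(c)` is a governing arm: it is an arm, it realizes the distance from `c` to `v₀`, and its
union with every `A_i(c)` is a chain. -/
def IsGoverning (c : Set (Star n κ)) (m : Fin n) : Prop :=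
  (arm c m).Nonempty ∧
  Metric.infDist (center n κ) (arm c m) = Metric.infDist (center n κ) c ∧
  ∀ i, IsUnitChain (arm c m ∪ arm c i)

/-- A regular configuration: there is a governing arm and there are at least two arms. -/
def IsRegular (c : Set (Star n κ)) : Prop :=
  (∃ m, IsGoverning c m) ∧ ∃ i j, i ≠ j ∧ (arm c i).Nonempty ∧ (arm c j).Nonempty

/-- The `k`-spine `D_k(S_n)`, with the subspace topology from `U_k(S_n)`. -/
abbrev Spine (n : ℕ) (κ : ℝ≥0) (k : ℕ) : Type := {c : UConf (Star n κ) k // IsRegular c.pts}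

/-- The inclusion of `D_k(S_n)` into `U_k(S_n)`. -/
def Spine.incl (n : ℕ) (κ : ℝ≥0) (k : ℕ) : C(Spine n κ k, UConf (Star n κ) k) :=
  ⟨Subtype.val, continuous_subtype_val⟩

/-- The set of points of a regular configuration. -/
def Spine.pts {k : ℕ} (c : Spine n κ k) : Set (Star n κ) := c.1.pts

/-! ### The graph structure of the spine -/

/-- The distance `d(c, v₀)` from the configuration `c` to the centre. -/
noncomputable def Spine.height {k : ℕ} (c : Spine n κ k) : ℝ :=
  Metric.infDist (center n κ) c.pts

/-- The Hausdorff distance of two regular configurations. -/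
noncomputable def Spine.hdist {k : ℕ} (c c' : Spine n κ k) : ℝ :=
  Metric.hausdorffDist c.pts c'.pts

/-- Vertices of the graph `D_k(S_n)`: `d(c, v₀)` is `0` or `1/2`. -/
def Spine.IsVertex {k : ℕ} (c : Spine n κ k) : Prop :=
  c.height = 0 ∨ c.height = 1 / 2

/-- Two vertices span an edge if their Hausdorff distance is `1/2`. -/
def Spine.Adjacent {k : ℕ} (c₀ c₁ : Spine n κ k) : Prop :=
  c₀.IsVertex ∧ c₁.IsVertex ∧ c₀.hdist c₁ = 1 / 2

/-- The edge `[c₀, c₁]`; on it `2 d(c, v₀)` is a linear coordinate with values in `[0, 1]`. -/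
def Spine.edge {k : ℕ} (c₀ c₁ : Spine n κ k) : Set (Spine n κ k) :=
  {c | c.hdist c₀ + c.hdist c₁ = 1 / 2}

/-- `f` is a simplicial embedding of spines: a topological embedding that maps vertices to vertices
and each edge onto the edge spanned by the images of its ends, and that preserves the linear
coordinate of the edges. -/
def IsSimplicialEmbedding {k l : ℕ} (f : Spine n κ k → Spine n κ l) : Prop :=
  Topology.IsEmbedding f ∧
  (∀ c, c.IsVertex → (f c).IsVertex) ∧
  (∀ c₀ c₁, Spine.Adjacent c₀ c₁ →
    Spine.Adjacent (f c₀) (f c₁) ∧ f '' Spine.edge c₀ c₁ = Spine.edge (f c₀) (f c₁)) ∧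
  ∀ c, (f c).height = c.height

/-! ### Braid groups -/

/-- The `k`-point braid group of the star, `B_k(S_n, c) = π₁(U_k(S_n), c)`. -/
abbrev BraidGroup (n : ℕ) (κ : ℝ≥0) (k : ℕ) (c : UConf (Star n κ) k) : Type :=
  FundamentalGroup (UConf (Star n κ) k) c

/-- The homomorphism `π₁(D_k(S_n), c) → B_k(S_n, c)` induced by inclusion. -/
noncomputable def Spine.toBraid {k : ℕ} (c : Spine n κ k) :
    FundamentalGroup (Spine n κ k) c →* BraidGroup n κ k c.1 :=
  FundamentalGroup.map (Spine.incl n κ k) c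

end StarBraid

/-! Write K + 1 for the number of points. The configuration space and the spine have open covers by
two families of sets with the same bipartite nerve. For `p` with sum K, `nearSet` collects the
configurations with a unique point nearest to the centre and `p i` other points on leg i; for `q`
with sum K + 1, `legSet` collects those that avoid the centre and have `q i` points on leg i. Sets
of one family are disjoint, and a set of `p` meets a set of `q` only if q = p + e_m for some m, in a
path connected set. All these sets are simply connected: the points of each leg, ordered by
distance, slide linearly to prescribed positions without colliding (`exists_motion`).

The regular configurations are exactly the standard ones (`exists_adm_of_isRegular`), with
parameters (p, m, t): a nearest point at distance t on the governing leg m, the others following at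
unit distances. Suitable motions only change t, so they stay in the spine, where the pieces of the
cover are open stars of vertices and open edges.

For such a cover the fundamental group is computed as for a graph. A locally constant function on
the overlaps glues a principal bundle, and its monodromy is a multiplicative label on path classes
(`exists_label`). Label the edge (p, m) by a free generator off an explicit maximal tree and by 1 on
it. Then the label is an isomorphism from the fundamental group onto the free group on the non-tree
edges (`IsGraphCover.bijective_label`). The label of the spine is the restriction of that of the
configuration space, so the inclusion induces an isomorphism (`bijective_toBraid`).

The tree is adapted to the leg a: whether (p, m) belongs to it does not depend on `p a`. Adding a
point on leg a replaces p by p + e_a, so it respects the trees and sends non-tree edges injectively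
to non-tree edges. In terms of labels the induced homomorphism comes from an injection of free
generators. Hence it is injective, and the image of any basis becomes a basis together with the
generators that are not hit (`exists_freeGroupBasis_extending`).

The geometric claims follow from the parameters. These are unique up to the identifications at the
ends of edges (`Adm.conf_eq_iff`), an added point of leg a must take the next position there
(`Adm.eq_add`), and unit spacing recovers vertices and edges from Hausdorff distances
(`Adm.edge_eq`, `exists_adm_of_hdist`). -/

namespace StarBraid

/-! ### Path classes and open covers -/

section Cover

open Set unitInterval

variable {X : Type*} [TopologicalSpace X]

/-- Induction on path classes along an open cover. -/
theorem pathClass_induction {ι : Type*} {c : ι → Set X} (hc : ∀ i, IsOpen (c i))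
    (hcov : ∀ x, ∃ i, x ∈ c i)
    (P : ∀ {x y : X}, Path.Homotopic.Quotient x y → Prop)
    (trans : ∀ {x y z : X} (a : Path.Homotopic.Quotient x y) (b : Path.Homotopic.Quotient y z),
      P a → P b → P (a.trans b))
    (small : ∀ {x y : X} (γ : Path x y) (i : ι), (∀ t, γ t ∈ c i) →
      P (Path.Homotopic.Quotient.mk γ))
    {x y : X} (a : Path.Homotopic.Quotient x y) : P a := by
  induction a using Path.Homotopic.Quotient.ind with | mk γ =>
  obtain ⟨t, t0, tmono, ⟨m, hm⟩, ht⟩ := exists_monotone_Icc_subset_open_cover_unitInterval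
    (c := fun i => γ ⁻¹' c i) (fun i => (hc i).preimage γ.continuous)
    (fun s _ => by simpa using hcov (γ s))
  have key : ∀ k, P (Path.Homotopic.Quotient.mk (γ.subpath (t 0) (t k))) := by
    intro k
    induction k with
    | zero =>
      obtain ⟨i, hi⟩ := hcov (γ (t 0))
      refine small _ i fun s => ?_
      simpa using hi
    | succ k ih =>
      have e : Path.Homotopic.Quotient.mk (γ.subpath (t 0) (t (k + 1))) =
          (Path.Homotopic.Quotient.mk (γ.subpath (t 0) (t k))).trans
            (Path.Homotopic.Quotient.mk (γ.subpath (t k) (t (k + 1)))) := by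
        rw [← Path.Homotopic.Quotient.mk_trans]
        exact Quotient.sound ⟨(Path.Homotopy.subpathTransSubpath γ _ _ _).symm⟩
      rw [e]
      refine trans _ _ ih ?_
      obtain ⟨i, hi⟩ := ht k
      refine small _ i fun s => ?_
      have : γ.subpath (t k) (t (k + 1)) s ∈ range (γ.subpath (t k) (t (k + 1))) := ⟨s, rfl⟩
      rw [Path.range_subpath_of_le _ _ _ (tmono k.le_succ)] at this
      obtain ⟨r, hr, hr'⟩ := this
      rw [← hr']
      exact hi hr
  have h1 := key m
  rw [t0, hm m le_rfl, Path.subpath_zero_one] at h1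
  have : ∀ {x' y' : X} (hx : x' = x) (hy : y' = y),
      P (Path.Homotopic.Quotient.mk (γ.cast hx hy)) → P (Path.Homotopic.Quotient.mk γ) := by
    rintro x' y' rfl rfl h
    exact h
  exact this _ _ h1

end Cover

/-! ### Labels of path classes from a locally constant cocycle -/

section Label

open Set

variable {X : Type*} [TopologicalSpace X] {G : Type*} [Group G]

/-- The principal bundle over `X = N ∪ O` glued from trivial ones by a locally constant `σ`. -/
noncomputable def gluedBundle [TopologicalSpace G] [DiscreteTopology G] (N O : Set X)
    (hN : IsOpen N) (hO : IsOpen O) (cov : ∀ x, x ∈ N ∨ x ∈ O) (σ : X → G)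
    (hσ : ∀ x ∈ N, x ∈ O → ∀ᶠ y in nhds x, σ y = σ x) : FiberBundleCore Bool X G where
  baseSet b := if b then O else N
  isOpen_baseSet b := by cases b <;> simpa
  indexAt x := by classical exact decide (x ∈ O)
  mem_baseSet_at x := by
    by_cases h : x ∈ O
    · simp [h]
    · simpa [h] using (cov x).resolve_right h
  coordChange b b' x g := if b = b' then g else if b then (σ x)⁻¹ * g else σ x * g
  coordChange_self b x _ g := by simp
  continuousOn_coordChange b b' := by
    have key : ∀ x ∈ N, x ∈ O → ∀ g : G, ∀ f : G → G → G,
        ContinuousAt (fun p : X × G => f (σ p.1) p.2) (x, g) := by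
      intro x hxN hxO g f
      have : (fun p : X × G => f (σ p.1) p.2) =ᶠ[nhds (x, g)] fun p => f (σ x) p.2 := by
        rw [nhds_prod_eq]
        filter_upwards [(hσ x hxN hxO).prod_inl (nhds g)] with p hp
        rw [hp]
      refine ContinuousAt.congr_of_eventuallyEq ?_ this
      exact (continuous_of_discreteTopology.comp continuous_snd).continuousAt
    cases b <;> cases b' <;> simp only [if_true, if_false, Bool.false_eq_true, reduceCtorEq]
    · exact continuousOn_snd
    · exact fun p hp => (key p.1 hp.1.1 hp.1.2 p.2 fun s g => s * g).continuousWithinAt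
    · exact fun p hp => (key p.1 hp.1.2 hp.1.1 p.2 fun s g => s⁻¹ * g).continuousWithinAt
    · exact continuousOn_snd
  coordChange_comp b b' b'' x _ g := by
    cases b <;> cases b' <;> cases b'' <;> simp

/-- Given an open cover `X = N ∪ O` and a function `σ` that is locally constant on `N ∩ O` and
trivial off `O`, there is a multiplicative functional on path classes that is trivial in `O` and
equal to the coboundary of `σ` in `N`. -/
theorem exists_label (N O : Set X)
    (hN : IsOpen N) (hO : IsOpen O) (cov : ∀ x, x ∈ N ∨ x ∈ O) (σ : X → G)
    (hσ : ∀ x ∈ N, x ∈ O → ∀ᶠ y in nhds x, σ y = σ x) (hσ1 : ∀ x, x ∉ O → σ x = 1) :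
    ∃ L : ∀ {x y : X}, Path.Homotopic.Quotient x y → G,
      (∀ {x y z : X} (a : Path.Homotopic.Quotient x y) (b : Path.Homotopic.Quotient y z),
        L (a.trans b) = L b * L a) ∧
      (∀ {x y : X} (γ : Path x y), (∀ t, γ t ∈ O) → L (Path.Homotopic.Quotient.mk γ) = 1) ∧
      (∀ {x y : X} (γ : Path x y), (∀ t, γ t ∈ N) →
        L (Path.Homotopic.Quotient.mk γ) = σ y * (σ x)⁻¹) := by
  classical
  let : TopologicalSpace G := ⊥
  have : DiscreteTopology G := ⟨rfl⟩
  let Z := gluedBundle N O hN hO cov σ hσ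
  have C : IsCoveringMap (Bundle.TotalSpace.proj : Bundle.TotalSpace G Z.Fiber → X) :=
    FiberBundle.isCoveringMap
  let pt (x : X) (g : G) : Bundle.TotalSpace.proj (F := G) (E := Z.Fiber) ⁻¹' {x} :=
    ⟨⟨x, g⟩, rfl⟩
  let crd {x : X} (e : Bundle.TotalSpace.proj (F := G) (E := Z.Fiber) ⁻¹' {x}) : G := e.1.2
  have ptcrd : ∀ {x : X} (e : Bundle.TotalSpace.proj (F := G) (E := Z.Fiber) ⁻¹' {x}),
      pt x (crd e) = e := by
    rintro x ⟨⟨y, g⟩, rfl⟩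
    rfl
  have step : ∀ (b : Bool) {x y : X} (γ : Path x y), (∀ t, γ t ∈ Z.baseSet b) → ∀ g : G,
      C.monodromy (Path.Homotopic.Quotient.mk γ) (pt x g) =
        pt y (Z.coordChange b (Z.indexAt y) y (Z.coordChange (Z.indexAt x) b x g)) := by
    intro b x y γ hγ g
    set v := Z.coordChange (Z.indexAt x) b x g with hv
    let Γ : Path (⟨x, Z.coordChange b (Z.indexAt x) x v⟩ : Bundle.TotalSpace G Z.Fiber)
        (⟨y, Z.coordChange b (Z.indexAt y) y v⟩ : Bundle.TotalSpace G Z.Fiber) :=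
      { toFun := fun t => (Z.localTriv b).toOpenPartialHomeomorph.symm (γ t, v)
        continuous_toFun := by
          refine ContinuousOn.comp_continuous
            (Z.localTriv b).toOpenPartialHomeomorph.continuousOn_symm (by fun_prop) ?_
          intro t
          exact (Z.mem_localTriv_target b _).2 (hγ t)
        source' := by simp [FiberBundleCore.localTriv_symm_apply]
        target' := by simp [FiberBundleCore.localTriv_symm_apply] }
    have hx : x ∈ Z.baseSet b := by simpa using hγ 0
    have hg : Z.coordChange b (Z.indexAt x) x v = g := by
      rw [hv, Z.coordChange_comp _ _ _ _ ⟨⟨Z.mem_baseSet_at x, hx⟩, Z.mem_baseSet_at x⟩,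
        Z.coordChange_self _ _ (Z.mem_baseSet_at x)]
    have hpt : pt x g = pt x (Z.coordChange b (Z.indexAt x) x v) := by rw [hg]
    rw [hpt]
    refine C.monodromy_eq_of_map_eq (Path.Homotopic.Quotient.mk Γ) ?_
    rfl
  -- The label is the monodromy applied to the coordinate 1. By `equiv` below, monodromy is left
  -- multiplication by the label, so concatenation becomes a product in reversed order.
  let L : ∀ {x y : X}, Path.Homotopic.Quotient x y → G := fun {x y} a =>
    crd (C.monodromy a (pt x 1))
  -- In the chart of `N` a lift is constant. Its ends are read in the preferred chart, that of `O`
  -- where available, which contributes `(σ x)⁻¹` and `σ y`. Off `O` there is no change of chart, in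
  -- accordance with `σ = 1`.
  have small : ∀ (b : Bool) {x y : X} (γ : Path x y), (∀ t, γ t ∈ Z.baseSet b) → ∀ g : G,
      crd (C.monodromy (Path.Homotopic.Quotient.mk γ) (pt x g)) =
        (if b then 1 else σ y * (σ x)⁻¹) * g := by
    intro b x y γ hγ g
    have hx : x ∈ Z.baseSet b := by simpa using hγ 0
    have hy : y ∈ Z.baseSet b := by simpa using hγ 1
    rw [step b γ hγ]
    change (if b = decide (y ∈ O) then (if decide (x ∈ O) = b then g else
        if decide (x ∈ O) = true then (σ x)⁻¹ * g else σ x * g) else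
        if b then (σ y)⁻¹ * (if decide (x ∈ O) = b then g else
        if decide (x ∈ O) = true then (σ x)⁻¹ * g else σ x * g) else
        σ y * (if decide (x ∈ O) = b then g else
        if decide (x ∈ O) = true then (σ x)⁻¹ * g else σ x * g)) = _
    cases b
    · by_cases h : x ∈ O <;> by_cases h' : y ∈ O <;> simp [h, h', hσ1, mul_assoc]
    · have h : x ∈ O := hx
      have h' : y ∈ O := hy
      simp [h, h']
  have equiv : ∀ {x y : X} (a : Path.Homotopic.Quotient x y) (g : G),
      crd (C.monodromy a (pt x g)) = L a * g := by
    intro x y a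
    refine pathClass_induction (c := Z.baseSet) Z.isOpen_baseSet
      (fun x => ⟨_, Z.mem_baseSet_at x⟩)
      (fun {x y} a => ∀ g : G, crd (C.monodromy a (pt x g)) = L a * g) ?_ ?_ a
    · intro x y z a b ha hb g
      simp only [L, C.monodromy_trans_apply]
      rw [← ptcrd (C.monodromy a (pt x g)), ← ptcrd (C.monodromy a (pt x 1)), hb, hb, ha, ha]
      simp [mul_assoc]
    · intro x y γ b hγ g
      simp only [L]
      rw [small b γ hγ, small b γ hγ, mul_one]
  refine ⟨L, ?_, ?_, ?_⟩
  · intro x y z a b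
    simp only [L, C.monodromy_trans_apply]
    rw [← ptcrd (C.monodromy a (pt x 1)), equiv b]
  · intro x y γ hγ
    simpa using small true γ hγ 1
  · intro x y γ hγ
    simpa using small false γ hγ 1

end Label


/-! ### The combinatorial graph and its maximal tree -/

section Tree

variable {n : ℕ}

/-- The edges from `p` to `p + e_m` outside the maximal tree rooted at the leg `a`. -/
def NonTree (a : Fin n) (p : Fin n → ℕ) (m : Fin n) : Prop :=
  m ≠ a ∧ ∃ i, i < m ∧ i ≠ a ∧ p i ≠ 0

/-- `j` is the first leg other than `a` that is occupied in `q`. -/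
def IsFirst (a : Fin n) (q : Fin n → ℕ) (j : Fin n) : Prop :=
  j ≠ a ∧ q j ≠ 0 ∧ ∀ i, i < j → i ≠ a → q i = 0

theorem exists_isFirst {a : Fin n} {q : Fin n → ℕ} (h : ∃ j, j ≠ a ∧ q j ≠ 0) :
    ∃ j, IsFirst a q j := by
  obtain ⟨j, hj, hmin⟩ := WellFounded.has_min (wellFounded_lt (α := Fin n))
    {j | j ≠ a ∧ q j ≠ 0} h
  exact ⟨j, hj.1, hj.2, fun i hi hia => by_contra fun h0 => hmin i ⟨hia, h0⟩ hi⟩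

theorem IsFirst.unique {a : Fin n} {q : Fin n → ℕ} {j j' : Fin n} (h : IsFirst a q j)
    (h' : IsFirst a q j') : j = j' := by
  rcases lt_trichotomy j j' with hlt | rfl | hlt
  · exact absurd (h'.2.2 j hlt h.1) h.2.1
  · rfl
  · exact absurd (h.2.2 j' hlt h'.1) h'.2.1

/-- The number of points off the leg `a`. -/
def offCount (a : Fin n) (p : Fin n → ℕ) : ℕ := ∑ i ∈ Finset.univ.erase a, p i

/-- Move a point from the leg `j` to the leg `a`. -/
def shiftTo (a j : Fin n) (p : Fin n → ℕ) : Fin n → ℕ := p + Pi.single a 1 - Pi.single j 1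

theorem shiftTo_add {a j : Fin n} {p : Fin n → ℕ} (hj : j ≠ a) (hp : p j ≠ 0) :
    shiftTo a j p + Pi.single j 1 = p + Pi.single a 1 := by
  ext i
  by_cases hij : i = j
  · subst hij
    simp [shiftTo, hj]
    omega
  · simp [shiftTo, hij]

theorem offCount_shiftTo {a j : Fin n} {p : Fin n → ℕ} (hj : j ≠ a) (hp : p j ≠ 0) :
    offCount a (shiftTo a j p) + 1 = offCount a p := by
  have hmem : j ∈ Finset.univ.erase a := by simp [hj]
  unfold offCount
  rw [← Finset.add_sum_erase _ _ hmem, ← Finset.add_sum_erase _ (f := p) hmem]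
  have : ∑ x ∈ (Finset.univ.erase a).erase j, shiftTo a j p x =
      ∑ x ∈ (Finset.univ.erase a).erase j, p x := by
    refine Finset.sum_congr rfl fun i hi => ?_
    simp only [Finset.mem_erase, Finset.mem_univ, and_true] at hi
    simp [shiftTo, hi.1, hi.2]
  rw [this]
  simp [shiftTo, hj]
  omega

theorem sum_add_single (p : Fin n → ℕ) (m : Fin n) :
    ∑ i, (p + Pi.single m 1 : Fin n → ℕ) i = ∑ i, p i + 1 := by
  simp [Finset.sum_add_distrib]

theorem add_single_cancel {p p' : Fin n → ℕ} {m : Fin n}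
    (h : p + Pi.single m 1 = p' + Pi.single m 1) : p = p' := add_right_cancel h

theorem sum_shiftTo {a j : Fin n} {p : Fin n → ℕ} (hj : j ≠ a) (hp : p j ≠ 0) :
    ∑ i, shiftTo a j p i = ∑ i, p i := by
  have h1 := sum_add_single (shiftTo a j p) j
  rw [shiftTo_add hj hp, sum_add_single] at h1
  omega

/-- Gauge transformations make any edge labelling trivial on the maximal tree. -/
theorem exists_gauge {Γ : Type*} [Group Γ] (a : Fin n) (g : (Fin n → ℕ) → Fin n → Γ) :
    ∃ h h' : (Fin n → ℕ) → Γ, ∀ p m, ¬ NonTree a p m →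
      g p m * h p = h' (p + Pi.single m 1) := by
  classical
  -- With `j` the first occupied leg other than `a`, tree edges join both `p` and `shiftTo a j p` to
  -- `p + e_a`, along the legs `a` and `j`. This fixes the value at `p` from the one at `shiftTo a j
  -- p`, where `offCount` is smaller by one. At the root, with all points on `a`, the value is 1.
  let rec_h : ℕ → (Fin n → ℕ) → Γ := fun d => Nat.rec (fun _ => 1)
    (fun _ r p => if H : ∃ j, IsFirst a p j then
      (g p a)⁻¹ * (g (shiftTo a H.choose p) H.choose * r (shiftTo a H.choose p)) else 1) d
  let h : (Fin n → ℕ) → Γ := fun p => rec_h (offCount a p) p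
  have hh : ∀ p j, IsFirst a p j →
      h p = (g p a)⁻¹ * (g (shiftTo a j p) j * h (shiftTo a j p)) := by
    intro p j hj
    have H : ∃ j, IsFirst a p j := ⟨j, hj⟩
    have e : H.choose = j := H.choose_spec.unique hj
    have d := offCount_shiftTo hj.1 hj.2.1
    simp only [h]
    rw [← d]
    change (if H : ∃ j, IsFirst a p j then (g p a)⁻¹ * (g (shiftTo a H.choose p) H.choose *
      rec_h (offCount a (shiftTo a j p)) (shiftTo a H.choose p)) else 1) = _
    rw [dif_pos H, e]
  -- The value at `q` is forced by the tree edge along its first leg other than `a`, or along `a` if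
  -- there is none; `hh` makes any other tree edge agree.
  let h' : (Fin n → ℕ) → Γ := fun q => if H : ∃ j, IsFirst a q j then
    g (q - Pi.single H.choose 1) H.choose * h (q - Pi.single H.choose 1) else
    g (q - Pi.single a 1) a * h (q - Pi.single a 1)
  have hh' : ∀ q j, IsFirst a q j → h' q = g (q - Pi.single j 1) j * h (q - Pi.single j 1) := by
    intro q j hj
    have H : ∃ j, IsFirst a q j := ⟨j, hj⟩
    have e : H.choose = j := H.choose_spec.unique hj
    simp only [h']
    rw [dif_pos H, e]
  have first_add : ∀ p j, IsFirst a (p + Pi.single a 1) j ↔ IsFirst a p j := by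
    intro p j
    unfold IsFirst
    refine and_congr_right fun hj => ?_
    have : ∀ i, i ≠ a → (p + Pi.single a 1 : Fin n → ℕ) i = p i := fun i hi => by simp [hi]
    rw [this j hj]
    refine and_congr_right fun _ => forall_congr' fun i => ?_
    refine imp_congr_right fun _ => ?_
    constructor
    · intro h hi
      rw [← this i hi]
      exact h hi
    · intro h hi
      rw [this i hi]
      exact h hi
  refine ⟨h, h', fun p m hm => ?_⟩
  by_cases hma : m = a
  · subst hma
    by_cases H : ∃ j, IsFirst m p j
    · obtain ⟨j, hj⟩ := H
      rw [hh' _ j ((first_add p j).2 hj), hh p j hj, mul_inv_cancel_left]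
      rfl
    · have H' : ¬ ∃ j, IsFirst m (p + Pi.single m 1) j := by simpa only [first_add] using H
      simp only [h']
      rw [dif_neg H']
      simp
  · have hm' : IsFirst a (p + Pi.single m 1) m := by
      refine ⟨hma, by simp, fun i hi hia => ?_⟩
      have : p i = 0 := by
        by_contra h0
        exact hm ⟨hma, i, hi, hia, h0⟩
      simp [hi.ne, this]
    rw [hh' _ m hm']
    simp

/-- Functions that agree along the edges of the maximal tree are constant. -/
theorem eq_root_of_tree {T : Type*} (a : Fin n) {K : ℕ} (l l' : (Fin n → ℕ) → T)
    (H : ∀ p m, ∑ i, p i = K → (∃ i, i ≠ m ∧ p i ≠ 0) → ¬ NonTree a p m →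
      l p = l' (p + Pi.single m 1)) (p : Fin n → ℕ) (hp : ∑ i, p i = K) :
    l p = l (Pi.single a K) := by
  induction hd : offCount a p generalizing p with
  | zero =>
    congr 1
    have h0 : ∀ i, i ≠ a → p i = 0 := fun i hi =>
      (Finset.sum_eq_zero_iff.1 hd) i (by simp [hi])
    ext i
    by_cases hi : i = a
    · subst hi
      rw [Pi.single_eq_same, ← hp]
      exact (Finset.sum_eq_single i (fun j _ hj => h0 j hj) (by simp)).symm
    · simp [hi, h0 i hi]
  | succ d ih =>
    have : ∃ j, j ≠ a ∧ p j ≠ 0 := by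
      by_contra hcon
      push Not at hcon
      have : offCount a p = 0 := Finset.sum_eq_zero fun i hi => hcon i (by simpa using hi)
      omega
    obtain ⟨j, hj⟩ := exists_isFirst this
    -- Two tree edges that end in `p + e_a` lead from `p` one step closer to the root.
    have e1 := H p a hp ⟨j, hj.1, hj.2.1⟩ (fun h => h.1 rfl)
    have hs := (sum_shiftTo hj.1 hj.2.1).trans hp
    have e2 := H (shiftTo a j p) j hs ⟨a, hj.1.symm, by simp [shiftTo, hj.1.symm]⟩ (by
      rintro ⟨-, i, hi, hia, h0⟩
      refine h0 ?_
      simp [shiftTo, hia, hi.ne, hj.2.2 i hi hia])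
    rw [shiftTo_add hj.1 hj.2.1] at e2
    rw [e1, ← e2]
    refine ih _ hs ?_
    have := offCount_shiftTo hj.1 hj.2.1
    omega

/-- The edges outside the maximal tree. -/
abbrev Edges (a : Fin n) (K : ℕ) : Type :=
  {e : (Fin n → ℕ) × Fin n // ∑ i, e.1 i = K ∧ NonTree a e.1 e.2}

open Classical in
/-- The label of an edge: a free generator off the maximal tree, and `1` on it. -/
noncomputable def edgeLabel (a : Fin n) (K : ℕ) (p : Fin n → ℕ) (m : Fin n) :
    FreeGroup (Edges a K) :=
  if h : ∑ i, p i = K ∧ NonTree a p m then FreeGroup.of ⟨(p, m), h⟩ else 1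

theorem edgeLabel_of_not {a : Fin n} {K : ℕ} {p : Fin n → ℕ} {m : Fin n} (h : ¬ NonTree a p m) :
    edgeLabel a K p m = 1 := dif_neg fun h' => h h'.2

theorem edgeLabel_edge {a : Fin n} {K : ℕ} (e : Edges a K) :
    edgeLabel a K e.1.1 e.1.2 = FreeGroup.of e := dif_pos e.2

/-- Add a point on the leg `a`. -/
def Edges.shift {a : Fin n} {K : ℕ} (e : Edges a K) : Edges a (K + 1) :=
  ⟨(e.1.1 + Pi.single a 1, e.1.2), by
    exact (sum_add_single _ _).trans (by rw [e.2.1]), e.2.2.1, by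
      obtain ⟨i, hi, hia, h0⟩ := e.2.2.2
      exact ⟨i, hi, hia, by simp [hia, h0]⟩⟩

theorem Edges.shift_injective {a : Fin n} {K : ℕ} :
    Function.Injective (Edges.shift : Edges a K → Edges a (K + 1)) := by
  rintro ⟨⟨p, m⟩, h⟩ ⟨⟨p', m'⟩, h'⟩ e
  have e' := congrArg Subtype.val e
  simp only [Edges.shift, Prod.mk.injEq] at e'
  exact Subtype.ext (Prod.ext (add_single_cancel e'.1) e'.2)

/-- `NonTree` never looks at the coordinate `a`, so raising that coordinate keeps tree edges in the
tree and the others outside. This is why the tree is rooted at the leg that receives the new point.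
-/
theorem map_edgeLabel (a : Fin n) (K : ℕ) (p : Fin n → ℕ) (m : Fin n) :
    FreeGroup.map Edges.shift (edgeLabel a K p m) =
      edgeLabel a (K + 1) (p + Pi.single a 1) m := by
  have iff : NonTree a (p + Pi.single a 1) m ↔ NonTree a p m := by
    unfold NonTree
    refine and_congr_right fun _ => exists_congr fun i => and_congr_right fun _ =>
      and_congr_right fun hi => ?_
    simp [hi]
  by_cases h : ∑ i, p i = K ∧ NonTree a p m
  · have h' : ∑ i, (p + Pi.single a 1 : Fin n → ℕ) i = K + 1 ∧ NonTree a (p + Pi.single a 1) m := by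
      rw [sum_add_single, iff]
      exact ⟨by rw [h.1], h.2⟩
    rw [edgeLabel, dif_pos h, edgeLabel, dif_pos h']
    exact FreeGroup.map.of
  · have h' : ¬ (∑ i, (p + Pi.single a 1 : Fin n → ℕ) i = K + 1 ∧ NonTree a (p + Pi.single a 1) m)
      := by
      rw [sum_add_single, iff]
      simpa using h
    rw [edgeLabel, dif_neg h, edgeLabel, dif_neg h']
    simp

end Tree


/-! ### The fundamental group of a graph-like space -/

section GraphCover

open CategoryTheory

variable {X : Type*} [TopologicalSpace X]

/-- Path classes represented by a path in `S`. -/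
def IsIn (S : Set X) {x y : X} (c : FundamentalGroupoid.mk x ⟶ FundamentalGroupoid.mk y) : Prop :=
  ∃ γ : Path x y, (∀ t, γ t ∈ S) ∧ Path.Homotopic.Quotient.mk γ = c

theorem IsIn.comp {S : Set X} {x y z : X} {c : FundamentalGroupoid.mk x ⟶ FundamentalGroupoid.mk y}
    {d : FundamentalGroupoid.mk y ⟶ FundamentalGroupoid.mk z} (hc : IsIn S c) (hd : IsIn S d) :
    IsIn S (c ≫ d) := by
  obtain ⟨γ, hγ, rfl⟩ := hc
  obtain ⟨δ, hδ, rfl⟩ := hd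
  refine ⟨γ.trans δ, fun t => ?_, rfl⟩
  have : γ.trans δ t ∈ Set.range (γ.trans δ) := ⟨t, rfl⟩
  rw [Path.trans_range] at this
  rcases this with ⟨s, hs⟩ | ⟨s, hs⟩
  · exact hs ▸ hγ s
  · exact hs ▸ hδ s

theorem IsIn.inv {S : Set X} {x y : X} {c : FundamentalGroupoid.mk x ⟶ FundamentalGroupoid.mk y}
    (hc : IsIn S c) : IsIn S (inv c) := by
  obtain ⟨γ, hγ, rfl⟩ := hc
  refine ⟨γ.symm, fun t => hγ _, ?_⟩
  rw [← Groupoid.inv_eq_inv]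
  rfl

theorem IsIn.mono {S T : Set X} (h : S ⊆ T) {x y : X}
    {c : FundamentalGroupoid.mk x ⟶ FundamentalGroupoid.mk y}
    (hc : IsIn S c) : IsIn T c := by
  obtain ⟨γ, hγ, rfl⟩ := hc
  exact ⟨γ, fun t => h (hγ t), rfl⟩

theorem IsPathConnected.exists_isIn {S : Set X} (hS : IsPathConnected S) {x y : X} (hx : x ∈ S)
    (hy : y ∈ S) : ∃ c : FundamentalGroupoid.mk x ⟶ FundamentalGroupoid.mk y, IsIn S c := by
  obtain ⟨γ, hγ⟩ := hS.joinedIn x hx y hy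
  exact ⟨Path.Homotopic.Quotient.mk γ, γ, hγ, rfl⟩

/-- The homotopy exists inside `S` and is pushed forward to `X`. Choices of paths within one member
of the cover are thereby harmless. -/
theorem IsIn.eq_of_isSimplyConnected {S : Set X} (hS : IsSimplyConnected S) {x y : X}
    {c d : FundamentalGroupoid.mk x ⟶ FundamentalGroupoid.mk y} (hc : IsIn S c) (hd : IsIn S d) :
    c = d := by
  obtain ⟨γ, hγ, rfl⟩ := hc
  obtain ⟨δ, hδ, rfl⟩ := hd
  have := hS.simplyConnectedSpace
  have hx : x ∈ S := by simpa using hγ 0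
  have hy : y ∈ S := by simpa using hγ 1
  let γ' : Path (⟨x, hx⟩ : S) ⟨y, hy⟩ :=
    { toFun := fun t => ⟨γ t, hγ t⟩
      source' := by simp
      target' := by simp }
  let δ' : Path (⟨x, hx⟩ : S) ⟨y, hy⟩ :=
    { toFun := fun t => ⟨δ t, hδ t⟩
      source' := by simp
      target' := by simp }
  have h := (SimplyConnectedSpace.paths_homotopic γ' δ').map (⟨Subtype.val,
      continuous_subtype_val⟩ : C(S, X))
  exact Quotient.sound h

variable {n : ℕ}

/-- An open cover of `X` by simply connected sets `N p` and `O q`, whose nerve is the graph with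
edges from `p` to `p + e_m`. -/
structure IsGraphCover (a : Fin n) (K : ℕ) (N O : (Fin n → ℕ) → Set X) : Prop where
  isOpen_N : ∀ p, IsOpen (N p)
  isOpen_O : ∀ q, IsOpen (O q)
  cover : ∀ x, (∃ p, x ∈ N p) ∨ ∃ q, x ∈ O q
  sum_N : ∀ p, (N p).Nonempty → ∑ i, p i = K
  disj_N : ∀ x p p', x ∈ N p → x ∈ N p' → p = p'
  disj_O : ∀ x q q', x ∈ O q → x ∈ O q' → q = q'
  inter : ∀ x p q, x ∈ N p → x ∈ O q → ∃ m, q = p + Pi.single m 1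
  simply_N : ∀ p, ∑ i, p i = K → IsSimplyConnected (N p)
  simply_O : ∀ q, (O q).Nonempty → IsSimplyConnected (O q)
  conn : ∀ p q, (N p ∩ O q).Nonempty → IsPathConnected (N p ∩ O q)
  -- Without a second occupied leg the overlap contains no regular configuration; the arguments
  -- along the tree do not need such an edge.
  meet : ∀ p m, ∑ i, p i = K → (∃ i, i ≠ m ∧ p i ≠ 0) → (N p ∩ O (p + Pi.single m 1)).Nonempty
  exists_meet : ∀ q, (O q).Nonempty → ∃ p, (N p ∩ O q).Nonempty

/-- A multiplicative functional on path classes that takes the value `w p m` across the edge from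
`p` to `p + e_m`. -/
structure IsLabel {G : Type*} [Group G] (N O : (Fin n → ℕ) → Set X) (w : (Fin n → ℕ) → Fin n → G)
    (L : ∀ {x y : X}, Path.Homotopic.Quotient x y → G) : Prop where
  trans : ∀ {x y z : X} (a : Path.Homotopic.Quotient x y) (b : Path.Homotopic.Quotient y z),
    L (a.trans b) = L b * L a
  eq_one : ∀ {x y : X} (q) (γ : Path x y), (∀ t, γ t ∈ O q) →
    L (Path.Homotopic.Quotient.mk γ) = 1
  eq_div : ∃ σ : X → G, (∀ x p m, x ∈ N p → x ∈ O (p + Pi.single m 1) → σ x = w p m) ∧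
    (∀ x, (∀ q, x ∉ O q) → σ x = 1) ∧
    ∀ {x y : X} (p) (γ : Path x y), (∀ t, γ t ∈ N p) →
      L (Path.Homotopic.Quotient.mk γ) = σ y * (σ x)⁻¹

theorem add_single_injective {p : Fin n → ℕ} {m m' : Fin n}
    (h : p + Pi.single m 1 = p + Pi.single m' 1) : m = m' := by
  by_contra hne
  have := congrFun (add_left_cancel h) m
  simp [hne] at this

/-- A point of an overlap determines `p` and `m`, because each family is disjoint. So `w` gives a
cocycle that is constant on each overlap, to which `exists_label` applies. -/
theorem IsGraphCover.exists_isLabel {G : Type*} [Group G] {a : Fin n} {K : ℕ}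
    {N O : (Fin n → ℕ) → Set X} (H : IsGraphCover a K N O) (w : (Fin n → ℕ) → Fin n → G) :
    ∃ L : ∀ {x y : X}, Path.Homotopic.Quotient x y → G, IsLabel N O w @L := by
  classical
  let σ : X → G := fun x => if h : ∃ pm : (Fin n → ℕ) × Fin n, x ∈ N pm.1 ∧
    x ∈ O (pm.1 + Pi.single pm.2 1) then w h.choose.1 h.choose.2 else 1
  have hσ : ∀ x p m, x ∈ N p → x ∈ O (p + Pi.single m 1) → σ x = w p m := by
    intro x p m hp hm
    have h : ∃ pm : (Fin n → ℕ) × Fin n, x ∈ N pm.1 ∧ x ∈ O (pm.1 + Pi.single pm.2 1) :=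
      ⟨(p, m), hp, hm⟩
    have e1 : h.choose.1 = p := H.disj_N x _ _ h.choose_spec.1 hp
    have e2 : h.choose.2 = m := by
      have := H.disj_O x _ _ h.choose_spec.2 hm
      rw [e1] at this
      exact add_single_injective this
    simp only [σ]
    rw [dif_pos h, e1, e2]
  have hσ1 : ∀ x, (∀ q, x ∉ O q) → σ x = 1 := fun x hx =>
    dif_neg fun ⟨pm, _, h⟩ => hx _ h
  obtain ⟨L, hL1, hL2, hL3⟩ := exists_label (⋃ p, N p) (⋃ q, O q)
    (isOpen_iUnion H.isOpen_N) (isOpen_iUnion H.isOpen_O)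
    (fun x => by simpa using H.cover x) σ (by
      intro x hx hx'
      obtain ⟨p, hp⟩ := Set.mem_iUnion.1 hx
      obtain ⟨q, hq⟩ := Set.mem_iUnion.1 hx'
      obtain ⟨m, rfl⟩ := H.inter x p q hp hq
      filter_upwards [(H.isOpen_N p).mem_nhds hp, (H.isOpen_O _).mem_nhds hq] with y hy hy'
      rw [hσ y p m hy hy', hσ x p m hp hq])
    (fun x hx => hσ1 x (by simpa using hx))
  exact ⟨L, ⟨hL1, fun q γ hγ => hL2 γ fun t => Set.mem_iUnion.2 ⟨q, hγ t⟩, σ, hσ, hσ1,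
    fun p γ hγ => hL3 γ fun t => Set.mem_iUnion.2 ⟨p, hγ t⟩⟩⟩

/-- Used to put the label of the configuration space on the spine, so that the two computations of
the fundamental group can be compared. -/
theorem IsLabel.comap {Y : Type*} [TopologicalSpace Y] {G : Type*} [Group G]
    {N O : (Fin n → ℕ) → Set X} {w : (Fin n → ℕ) → Fin n → G}
    {L : ∀ {x y : X}, Path.Homotopic.Quotient x y → G} (hL : IsLabel N O w @L) (f : C(Y, X)) :
    IsLabel (fun p => f ⁻¹' N p) (fun q => f ⁻¹' O q) w
      (fun {_ _} c => L (c.map f)) where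
  trans c d := by
    rw [← hL.trans]
    congr 1
    exact (FundamentalGroupoid.map f).map_comp c d
  eq_one q γ hγ := hL.eq_one q (γ.map f.continuous) hγ
  eq_div := by
    obtain ⟨σ, h1, h2, h3⟩ := hL.eq_div
    exact ⟨fun y => σ (f y), fun x p m hp hq => h1 _ p m hp hq, fun x hx => h2 _ hx,
      fun p γ hγ => h3 p (γ.map f.continuous) hγ⟩

/-- Labels are natural with respect to maps that carry cover to cover. -/
theorem IsLabel.natural {Y : Type*} [TopologicalSpace Y] {G G' : Type*} [Group G] [Group G']
    {a : Fin n} {K : ℕ} {N O : (Fin n → ℕ) → Set X} {N' O' : (Fin n → ℕ) → Set Y}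
    {w : (Fin n → ℕ) → Fin n → G} {w' : (Fin n → ℕ) → Fin n → G'}
    {L : ∀ {x y : X}, Path.Homotopic.Quotient x y → G}
    {L' : ∀ {x y : Y}, Path.Homotopic.Quotient x y → G'} (H : IsGraphCover a K N O)
    (hL : IsLabel N O w @L) (hL' : IsLabel N' O' w' @L')
    (f : C(X, Y)) (Φ : G →* G') (v : Fin n → ℕ) (hw : ∀ p m, Φ (w p m) = w' (p + v) m)
    (hN : ∀ x p, x ∈ N p → f x ∈ N' (p + v)) (hO : ∀ x q, x ∈ O q → f x ∈ O' (q + v))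
    (hO' : ∀ x, (∀ q, x ∉ O q) → ∀ q, f x ∉ O' q)
    {x y : X} (c : Path.Homotopic.Quotient x y) : L' (c.map f) = Φ (L c) := by
  obtain ⟨σ, h1, h2, h3⟩ := hL.eq_div
  obtain ⟨σ', h1', h2', h3'⟩ := hL'.eq_div
  have hσ : ∀ x p, x ∈ N p → σ' (f x) = Φ (σ x) := by
    intro x p hp
    by_cases hx : ∃ q, x ∈ O q
    · obtain ⟨q, hq⟩ := hx
      obtain ⟨m, rfl⟩ := H.inter x p q hp hq
      have := hO x _ hq
      rw [add_right_comm] at this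
      rw [h1 x p m hp hq, hw, h1' _ _ m (hN x p hp) this]
    · push Not at hx
      rw [h2 x hx, h2' _ (hO' x hx), map_one]
  refine pathClass_induction (c := Sum.elim N O) (by
      rintro (p | q)
      exacts [H.isOpen_N p, H.isOpen_O q]) (fun x => ?_)
    (fun {x y} c => L' (c.map f) = Φ (L c)) ?_ ?_ c
  · rcases H.cover x with ⟨p, hp⟩ | ⟨q, hq⟩
    exacts [⟨Sum.inl p, hp⟩, ⟨Sum.inr q, hq⟩]
  · intro x y z c d hc hd
    rw [hL.trans, map_mul, ← hc, ← hd, ← hL'.trans]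
    congr 1
    exact (FundamentalGroupoid.map f).map_comp c d
  · rintro x y γ (p | q) hγ
    · have hx : x ∈ N p := by simpa using hγ 0
      have hy : y ∈ N p := by simpa using hγ 1
      rw [h3 p γ hγ, map_mul, map_inv, ← hσ x p hx, ← hσ y p hy]
      exact h3' (p + v) (γ.map f.continuous) fun t => hN _ _ (hγ t)
    · rw [hL.eq_one q γ hγ, map_one]
      exact hL'.eq_one (q + v) (γ.map f.continuous) fun t => hO _ _ (hγ t)

/-- The path component does not change along an edge, so `eq_root_of_tree`, applied to path
components, leaves only one. -/
theorem IsGraphCover.pathConnectedSpace {a : Fin n} {K : ℕ}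
    {N O : (Fin n → ℕ) → Set X} (H : IsGraphCover a K N O) : PathConnectedSpace X := by
  classical
  have hNne : (N (Pi.single a K)).Nonempty := (H.simply_N _ (by simp)).nonempty
  obtain ⟨r, hr⟩ := hNne
  have hX : Nonempty X := ⟨r⟩
  choose! pv hpv using fun p (hp : ∑ i, p i = K) => (H.simply_N p hp).nonempty
  choose! qv hqv using fun q (hq : (O q).Nonempty) => hq
  have key := eq_root_of_tree (K := K) a (fun p => (Quotient.mk (pathSetoid X) (pv p)))
    (fun q => (Quotient.mk (pathSetoid X) (qv q))) (by
      intro p m hp hm _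
      obtain ⟨x, hx, hx'⟩ := H.meet p m hp hm
      refine Quotient.sound ?_
      exact ((H.simply_N p hp).isPathConnected.joinedIn _ (hpv p hp) _ hx).joined.trans
        ((H.simply_O _ ⟨x, hx'⟩).isPathConnected.joinedIn _ hx' _ (hqv _ ⟨x, hx'⟩)).joined)
  have hN : ∀ x p, x ∈ N p → Joined x (pv (Pi.single a K)) := by
    intro x p hx
    have hp := H.sum_N p ⟨x, hx⟩
    exact ((H.simply_N p hp).isPathConnected.joinedIn _ hx _ (hpv p hp)).joined.trans
      (Quotient.exact (key p hp))
  have hall : ∀ x, Joined x (pv (Pi.single a K)) := by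
    intro x
    rcases H.cover x with ⟨p, hp⟩ | ⟨q, hq⟩
    · exact hN x p hp
    · obtain ⟨p, y, hy, hy'⟩ := H.exists_meet q ⟨x, hq⟩
      exact ((H.simply_O q ⟨x, hq⟩).isPathConnected.joinedIn _ hq _ hy').joined.trans (hN y p hy)
  exact ⟨hX, fun x y => (hall x).trans (hall y).symm⟩

/-- The label homomorphism of a fundamental group. -/
noncomputable def IsLabel.hom {G : Type*} [Group G] {N O : (Fin n → ℕ) → Set X}
    {w : (Fin n → ℕ) → Fin n → G} {L : ∀ {x y : X}, Path.Homotopic.Quotient x y → G}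
    (hL : IsLabel N O w @L) (x : X) : FundamentalGroup X x →* G :=
  MonoidHom.mk' (fun c => L c) fun c d => hL.trans d c

/-- The label homomorphism with values in the free group on the edges off the maximal tree is an
isomorphism. -/
theorem IsGraphCover.bijective_label {a : Fin n} {K : ℕ}
    {N O : (Fin n → ℕ) → Set X} (H : IsGraphCover a K N O)
    {L : ∀ {x y : X}, Path.Homotopic.Quotient x y → FreeGroup (Edges a K)}
    (hL : IsLabel N O (edgeLabel a K) @L) (x₀ : X) : Function.Bijective (hL.hom x₀) := by
  classical
  have := H.pathConnectedSpace
  have : Nonempty X := ⟨x₀⟩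
  choose! pv hpv using fun p (hp : ∑ i, p i = K) => (H.simply_N p hp).nonempty
  choose! qv hqv using fun q (hq : (O q).Nonempty) => hq
  have hex : ∀ x y : X, Nonempty (FundamentalGroupoid.mk x ⟶ FundamentalGroupoid.mk y) :=
    fun x y => ⟨Path.Homotopic.Quotient.mk (PathConnectedSpace.somePath x y)⟩
  let s : ∀ p, FundamentalGroupoid.mk x₀ ⟶ FundamentalGroupoid.mk (pv p) :=
    fun p => (hex _ _).some
  let u : ∀ q, FundamentalGroupoid.mk x₀ ⟶ FundamentalGroupoid.mk (qv q) :=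
    fun q => (hex _ _).some
  -- The loop of the edge (p, m): out along `s p`, through the two sets, back along `u`. It is
  -- independent of the crossing point and of the paths, since the overlap is path connected and
  -- both sets are simply connected.
  have hg : ∀ p m, ∃ g : FundamentalGroup X x₀, ∀ x, x ∈ N p → x ∈ O (p + Pi.single m 1) →
      ∀ (c : FundamentalGroupoid.mk (pv p) ⟶ FundamentalGroupoid.mk x)
        (d : FundamentalGroupoid.mk x ⟶ FundamentalGroupoid.mk (qv (p + Pi.single m 1))),
      IsIn (N p) c → IsIn (O (p + Pi.single m 1)) d →
        g = s p ≫ c ≫ d ≫ inv (u (p + Pi.single m 1)) := by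
    intro p m
    by_cases hne : (N p ∩ O (p + Pi.single m 1)).Nonempty
    · obtain ⟨x₁, hx₁, hx₁'⟩ := hne
      have hp := H.sum_N p ⟨x₁, hx₁⟩
      obtain ⟨c₁, hc₁⟩ := IsPathConnected.exists_isIn (H.simply_N p hp).isPathConnected
        (hpv p hp) hx₁
      obtain ⟨d₁, hd₁⟩ := IsPathConnected.exists_isIn
        (H.simply_O _ ⟨x₁, hx₁'⟩).isPathConnected hx₁' (hqv _ ⟨x₁, hx₁'⟩)
      refine ⟨s p ≫ c₁ ≫ d₁ ≫ inv (u (p + Pi.single m 1)), fun x hx hx' c d hc hd => ?_⟩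
      obtain ⟨e, he⟩ := IsPathConnected.exists_isIn
        (H.conn p (p + Pi.single m 1) ⟨x₁, hx₁, hx₁'⟩) ⟨hx₁, hx₁'⟩ ⟨hx, hx'⟩
      have e1 : c = c₁ ≫ e := IsIn.eq_of_isSimplyConnected (H.simply_N p hp) hc
        (hc₁.comp (he.mono Set.inter_subset_left))
      have e2 : d = inv e ≫ d₁ := IsIn.eq_of_isSimplyConnected (H.simply_O _ ⟨x, hx'⟩) hd
        ((he.mono Set.inter_subset_right).inv.comp hd₁)
      rw [e1, e2]
      simp
    · exact ⟨1, fun x hx hx' => absurd ⟨x, hx, hx'⟩ hne⟩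
  choose g hg using hg
  -- Once the loops `h` and `h'` are put in front of `s` and `u`, tree edges have trivial loops, and
  -- `θ` sends each generator to the corrected loop of its edge.
  obtain ⟨h, h', hh⟩ := exists_gauge a g
  let θ : FreeGroup (Edges a K) →* FundamentalGroup X x₀ :=
    FreeGroup.lift fun e => (h' (e.1.1 + Pi.single e.1.2 1))⁻¹ * (g e.1.1 e.1.2 * h e.1.1)
  have hθ : ∀ p m, ∑ i, p i = K →
      θ (edgeLabel a K p m) = (h' (p + Pi.single m 1))⁻¹ * (g p m * h p) := by
    intro p m hp
    by_cases hnt : NonTree a p m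
    · rw [edgeLabel, dif_pos ⟨hp, hnt⟩]
      exact FreeGroup.lift_apply_of
    · rw [edgeLabel_of_not hnt, map_one, hh p m hnt, inv_mul_cancel]
  obtain ⟨σ, hσ, hσ1, hσN⟩ := hL.eq_div
  have LN : ∀ {x y : X} (p) (c : FundamentalGroupoid.mk x ⟶ FundamentalGroupoid.mk y),
      IsIn (N p) c → L c = σ y * (σ x)⁻¹ := by
    rintro x y p _ ⟨γ, hγ, rfl⟩
    exact hσN p γ hγ
  have LO : ∀ {x y : X} (q) (c : FundamentalGroupoid.mk x ⟶ FundamentalGroupoid.mk y),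
      IsIn (O q) c → L c = 1 := by
    rintro x y q _ ⟨γ, hγ, rfl⟩
    exact hL.eq_one q γ hγ
  have Lcomp : ∀ {x y z : X} (c : FundamentalGroupoid.mk x ⟶ FundamentalGroupoid.mk y)
      (d : FundamentalGroupoid.mk y ⟶ FundamentalGroupoid.mk z), L (c ≫ d) = L d * L c :=
    fun c d => hL.trans c d
  -- the tree path to a point
  have ht : ∀ x : X, ∃ t : FundamentalGroupoid.mk x₀ ⟶ FundamentalGroupoid.mk x,
      (∀ q, x ∈ O q → ∀ c : FundamentalGroupoid.mk (qv q) ⟶ FundamentalGroupoid.mk x,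
        IsIn (O q) c → t = FundamentalGroup.toArrow (h' q) ≫ u q ≫ c) ∧
      (∀ p, x ∈ N p → (∀ q, x ∉ O q) →
        ∀ c : FundamentalGroupoid.mk (pv p) ⟶ FundamentalGroupoid.mk x,
        IsIn (N p) c → t = FundamentalGroup.toArrow (h p) ≫ s p ≫ c) := by
    intro x
    by_cases hx : ∃ q, x ∈ O q
    · obtain ⟨q, hq⟩ := hx
      have hO := H.simply_O q ⟨x, hq⟩
      obtain ⟨c, hc⟩ := IsPathConnected.exists_isIn hO.isPathConnected (hqv q ⟨x, hq⟩) hq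
      refine ⟨FundamentalGroup.toArrow (h' q) ≫ u q ≫ c, fun q' hq' c' hc' => ?_,
        fun p _ hx => absurd hq (hx q)⟩
      obtain rfl := H.disj_O x _ _ hq hq'
      rw [hc.eq_of_isSimplyConnected hO hc']
    · push Not at hx
      obtain ⟨p, hp⟩ := (H.cover x).resolve_right (by simpa using hx)
      have hN := H.simply_N p (H.sum_N p ⟨x, hp⟩)
      obtain ⟨c, hc⟩ := IsPathConnected.exists_isIn hN.isPathConnected
        (hpv p (H.sum_N p ⟨x, hp⟩)) hp
      refine ⟨FundamentalGroup.toArrow (h p) ≫ s p ≫ c, fun q hq => absurd hq (hx q),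
        fun p' hp' _ c' hc' => ?_⟩
      obtain rfl := H.disj_N x _ _ hp hp'
      rw [hc.eq_of_isSimplyConnected hN hc']
  choose t htO htN using ht
  have claim : ∀ x p, x ∈ N p → ∀ c : FundamentalGroupoid.mk (pv p) ⟶ FundamentalGroupoid.mk x,
      IsIn (N p) c → FundamentalGroup.toArrow (h p) ≫ s p ≫ c =
        FundamentalGroup.toArrow (θ (σ x)) ≫ t x := by
    intro x p hx c hc
    by_cases hxO : ∃ q, x ∈ O q
    · obtain ⟨q, hq⟩ := hxO
      obtain ⟨m, rfl⟩ := H.inter x p q hx hq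
      have hO := H.simply_O _ ⟨x, hq⟩
      obtain ⟨d, hd⟩ := IsPathConnected.exists_isIn hO.isPathConnected hq (hqv _ ⟨x, hq⟩)
      rw [hσ x p m hx hq, hθ p m (H.sum_N p ⟨x, hx⟩), htO x _ hq (inv d) hd.inv]
      have e : FundamentalGroup.toArrow ((h' (p + Pi.single m 1))⁻¹ * (g p m * h p)) =
          (FundamentalGroup.toArrow (h p) ≫ FundamentalGroup.toArrow (g p m)) ≫
            inv (FundamentalGroup.toArrow (h' (p + Pi.single m 1))) := by
        rw [← Groupoid.inv_eq_inv]
        rfl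
      rw [e, hg p m x hx hq c d hc hd]
      simp
    · push Not at hxO
      rw [hσ1 x hxO, map_one, htN x p hx hxO c hc]
      exact (Category.id_comp _).symm
  -- Between the tree paths at its ends, every class is `θ` of its label. At `x₀` a class with
  -- trivial label is therefore trivial, which is injectivity.
  have main : ∀ {x y : X} (c : FundamentalGroupoid.mk x ⟶ FundamentalGroupoid.mk y),
      t x ≫ c = FundamentalGroup.toArrow (θ (L c)) ≫ t y := by
    intro x y c
    refine pathClass_induction (c := Sum.elim N O) (by
        rintro (p | q)
        exacts [H.isOpen_N p, H.isOpen_O q]) (fun x => ?_)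
      (fun {x y} (c : FundamentalGroupoid.mk x ⟶ FundamentalGroupoid.mk y) =>
        t x ≫ c = FundamentalGroup.toArrow (θ (L c)) ≫ t y) ?_ ?_ c
    · rcases H.cover x with ⟨p, hp⟩ | ⟨q, hq⟩
      exacts [⟨Sum.inl p, hp⟩, ⟨Sum.inr q, hq⟩]
    · intro x y z c d hc hd
      change FundamentalGroupoid.mk x ⟶ FundamentalGroupoid.mk y at c
      change FundamentalGroupoid.mk y ⟶ FundamentalGroupoid.mk z at d
      change t x ≫ (c ≫ d) = FundamentalGroup.toArrow (θ (L (c ≫ d))) ≫ t z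
      rw [← Category.assoc, hc, Category.assoc, hd, Lcomp, map_mul]
      exact (Category.assoc _ _ _).symm
    · rintro x y γ (p | q) hγ
      · have hx : x ∈ N p := by simpa using hγ 0
        have hy : y ∈ N p := by simpa using hγ 1
        have hp := H.sum_N p ⟨x, hx⟩
        obtain ⟨c, hc⟩ := IsPathConnected.exists_isIn (H.simply_N p hp).isPathConnected
          (hpv p hp) hx
        have hin : IsIn (N p) (x := x) (y := y) (Path.Homotopic.Quotient.mk γ) := ⟨γ, hγ, rfl⟩
        have e1 := claim x p hx c hc
        have e2 := claim y p hy _ (hc.comp hin)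
        rw [← Category.assoc, ← Category.assoc, Category.assoc _ (s p) c, e1] at e2
        rw [LN p _ hin, map_mul, map_inv]
        have e : FundamentalGroup.toArrow (θ (σ y) * (θ (σ x))⁻¹) =
            inv (FundamentalGroup.toArrow (θ (σ x))) ≫ FundamentalGroup.toArrow (θ (σ y)) := by
          rw [← Groupoid.inv_eq_inv]
          rfl
        rw [e, Category.assoc, IsIso.eq_inv_comp, ← e2]
        exact (Category.assoc _ _ _).symm
      · have hx : x ∈ O q := by simpa using hγ 0
        have hy : y ∈ O q := by simpa using hγ 1
        have hO := H.simply_O q ⟨x, hx⟩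
        obtain ⟨c, hc⟩ := IsPathConnected.exists_isIn hO.isPathConnected (hqv q ⟨x, hx⟩) hx
        have hin : IsIn (O q) (x := x) (y := y) (Path.Homotopic.Quotient.mk γ) := ⟨γ, hγ, rfl⟩
        rw [LO q _ hin, map_one, htO x q hx c hc, htO y q hy _ (hc.comp hin)]
        simp only [Category.assoc]
        exact (Category.id_comp _).symm
  constructor
  · rw [injective_iff_map_eq_one]
    intro c hc
    have e := main (x := x₀) (y := x₀) c
    have hc' : L c = 1 := hc
    rw [hc', map_one] at e
    have e' : t x₀ ≫ FundamentalGroup.toArrow c = t x₀ ≫ 𝟙 _ := by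
      rw [Category.comp_id]
      exact e.trans (Category.id_comp _)
    exact (cancel_epi (t x₀)).1 e'
  · -- conjugate generators are in the image
    let l : (Fin n → ℕ) → FreeGroup (Edges a K) := fun p =>
      (σ (pv p))⁻¹ * L (FundamentalGroup.toArrow (h p) ≫ s p)
    let l' : (Fin n → ℕ) → FreeGroup (Edges a K) := fun q =>
      L (FundamentalGroup.toArrow (h' q) ≫ u q)
    -- This is `claim` after applying `L`. On tree edges it says that `l` and `l'` agree, so both
    -- have one value `r` along the tree; on the other edges it then says that the label of `θ w` is
    -- the conjugate of the generator `w` by `r`.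
    have hl : ∀ p m, ∑ i, p i = K → (∃ i, i ≠ m ∧ p i ≠ 0) →
        edgeLabel a K p m * l p =
          l' (p + Pi.single m 1) * L (FundamentalGroup.toArrow (θ (edgeLabel a K p m))) := by
      intro p m hp hm
      obtain ⟨x, hx, hx'⟩ := H.meet p m hp hm
      obtain ⟨c, hc⟩ := IsPathConnected.exists_isIn (H.simply_N p hp).isPathConnected
        (hpv p hp) hx
      have hO := H.simply_O _ ⟨x, hx'⟩
      obtain ⟨d, hd⟩ := IsPathConnected.exists_isIn hO.isPathConnected (hqv _ ⟨x, hx'⟩) hx'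
      have e := congrArg (fun c => L c) (claim x p hx c hc)
      simp only [htO x _ hx' d hd] at e
      simp only [Lcomp, LN p c hc, LO _ d hd, hσ x p m hx hx', one_mul] at e
      simp only [l, l', Lcomp]
      simpa only [mul_assoc] using e
    have htree : ∀ p m, ∑ i, p i = K → (∃ i, i ≠ m ∧ p i ≠ 0) → ¬ NonTree a p m →
        l p = l' (p + Pi.single m 1) := by
      intro p m hp hm hnt
      have := hl p m hp hm
      rw [edgeLabel_of_not hnt, map_one, one_mul] at this
      rw [this]
      have h1 : L (FundamentalGroup.toArrow (1 : FundamentalGroup X x₀)) = 1 :=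
        (hL.hom x₀).map_one
      rw [h1, mul_one]
    have hconst := eq_root_of_tree (K := K) a l l' htree
    set r := l (Pi.single a K) with hr
    have hrange : ∀ w : FreeGroup (Edges a K), r⁻¹ * w * r ∈ (hL.hom x₀).range := by
      intro w
      have hw : (MulAut.conj r⁻¹).toMonoidHom w ∈ (hL.hom x₀).range := by
        induction w using FreeGroup.induction_on with
        | C1 => simp [one_mem]
        | of e =>
          have hne : ∃ i, i ≠ e.1.2 ∧ e.1.1 i ≠ 0 := by
            obtain ⟨i, hi, -, h0⟩ := e.2.2.2
            exact ⟨i, hi.ne, h0⟩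
          have e1 := hl e.1.1 e.1.2 e.2.1 hne
          -- The upper end of a non-tree edge is also the upper end of a tree edge, namely the one
          -- along its first leg `j`, which starts at `p - e_j + e_m`.
          have e2 : l' (e.1.1 + Pi.single e.1.2 1) = r := by
            obtain ⟨i, hi, hia, h0⟩ := e.2.2.2
            obtain ⟨j, hj⟩ := exists_isFirst (a := a) (q := e.1.1) ⟨i, hia, h0⟩
            have hjm : j < e.1.2 := by
              by_contra hcon
              exact h0 (hj.2.2 i (hi.trans_le (not_lt.1 hcon)) hia)
            set p' : Fin n → ℕ := e.1.1 - Pi.single j 1 + Pi.single e.1.2 1 with hp'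
            have e3 : p' + Pi.single j 1 = e.1.1 + Pi.single e.1.2 1 := by
              rw [hp', add_right_comm, tsub_add_cancel_of_le]
              intro k
              by_cases hk : k = j
              · subst hk
                simpa using Nat.one_le_iff_ne_zero.2 hj.2.1
              · simp [hk]
            have hs : ∑ i, p' i = K := by
              have h1 := sum_add_single p' j
              rw [e3, sum_add_single, e.2.1] at h1
              omega
            rw [← e3, ← htree p' j hs ⟨e.1.2, hjm.ne', by simp [hp']⟩, hconst _ hs]
            rintro ⟨-, k, hk, hka, hk0⟩
            refine hk0 ?_
            simp [hp', hk.ne, (hk.trans hjm).ne, hj.2.2 k hk hka]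
          rw [edgeLabel_edge, hconst _ e.2.1, e2] at e1
          refine ⟨θ (FreeGroup.of e), ?_⟩
          have e3 : hL.hom x₀ (θ (FreeGroup.of e)) = r⁻¹ * (FreeGroup.of e * r) := by
            rw [e1, inv_mul_cancel_left]
            rfl
          rw [e3]
          simp [mul_assoc]
        | inv_of e he =>
          rw [map_inv]
          exact inv_mem he
        | mul x y hx hy =>
          rw [map_mul]
          exact mul_mem hx hy
      simpa using hw
    intro w
    have := hrange (r * w * r⁻¹)
    simpa [mul_assoc] using this

end GraphCover


/-! ### Extending free bases -/

/-- Along the map of free groups induced by an injection of generators, every free basis extends. -/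
theorem exists_freeGroupBasis_extending {A B ι : Type} {s : A → B} (hs : Function.Injective s)
    (β : FreeGroupBasis ι (FreeGroup A)) :
    ∃ (ι' : Type) (β' : FreeGroupBasis ι' (FreeGroup B)) (g : ι → ι'), Function.Injective g ∧
      ∀ i, FreeGroup.map s (β i) = β' (g i) := by
  classical
  -- The new basis consists of the images of `β` and the generators outside the range of `s`. `F`
  -- and `G` are the two mutually inverse changes of generators.
  let F : FreeGroup (ι ⊕ {b // b ∉ Set.range s}) →* FreeGroup B :=
    FreeGroup.lift (Sum.elim (fun i => FreeGroup.map s (β i)) fun r => FreeGroup.of r.1)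
  let G : FreeGroup B →* FreeGroup (ι ⊕ {b // b ∉ Set.range s}) :=
    FreeGroup.lift fun b => if h : b ∈ Set.range s then
      FreeGroup.map Sum.inl (β.repr (FreeGroup.of h.choose)) else FreeGroup.of (Sum.inr ⟨b, h⟩)
  have hGs : ∀ w : FreeGroup A, G (FreeGroup.map s w) = FreeGroup.map Sum.inl (β.repr w) := by
    intro w
    have : G.comp (FreeGroup.map s) = (FreeGroup.map Sum.inl).comp β.repr.toMonoidHom := by
      ext a
      have h : s a ∈ Set.range s := ⟨a, rfl⟩
      have e : h.choose = a := hs h.choose_spec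
      simp only [MonoidHom.comp_apply, FreeGroup.map.of, G, FreeGroup.lift_apply_of]
      rw [dif_pos h, e]
      rfl
    exact DFunLike.congr_fun this w
  have hFs : ∀ w : FreeGroup ι, F (FreeGroup.map Sum.inl w) = FreeGroup.map s (β.repr.symm w) := by
    intro w
    have : F.comp (FreeGroup.map Sum.inl) =
        (FreeGroup.map s).comp β.repr.symm.toMonoidHom := by
      ext i
      simp only [MonoidHom.comp_apply, FreeGroup.map.of, F, FreeGroup.lift_apply_of]
      rfl
    exact DFunLike.congr_fun this w
  have h1 : F.comp G = MonoidHom.id _ := by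
    ext b
    simp only [MonoidHom.comp_apply, G, FreeGroup.lift_apply_of, MonoidHom.id_apply]
    split_ifs with h
    · rw [hFs, MulEquiv.symm_apply_apply, FreeGroup.map.of, h.choose_spec]
    · simp [F]
  have h2 : G.comp F = MonoidHom.id _ := by
    ext (i | r)
    · simp only [MonoidHom.comp_apply, F, FreeGroup.lift_apply_of, Sum.elim_inl, hGs,
        MonoidHom.id_apply]
      rw [show β.repr (β i) = FreeGroup.of i from β.repr.apply_symm_apply _, FreeGroup.map.of]
    · simp only [MonoidHom.comp_apply, F, FreeGroup.lift_apply_of, Sum.elim_inr, G,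
        MonoidHom.id_apply]
      rw [dif_neg r.2]
  refine ⟨_, ⟨MonoidHom.toMulEquiv G F h1 h2⟩, Sum.inl, Sum.inl_injective, fun i => ?_⟩
  change _ = F (FreeGroup.of (Sum.inl i))
  simp [F]


/-! ### Points of the star -/

section Points

variable {n : ℕ} {κ : ℝ≥0}

theorem Star.nonneg (x : Star n κ) (i : Fin n) : 0 ≤ x.1 i := (x.2.1 i).1

theorem Star.le (x : Star n κ) (i : Fin n) : x.1 i ≤ κ := (x.2.1 i).2

theorem Star.ext {x y : Star n κ} (h : ∀ i, x.1 i = y.1 i) : x = y :=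
  Subtype.ext (PiLp.ext h)

theorem Star.eq_zero_of_pos {x : Star n κ} {i j : Fin n} (h : 0 < x.1 i) (hij : j ≠ i) :
    x.1 j = 0 := ((x.2.2 i j hij.symm).resolve_left h.ne')

theorem Star.ext_of_pos {x y : Star n κ} {i : Fin n} (hx : 0 < x.1 i) (h : x.1 i = y.1 i) :
    x = y := by
  refine Star.ext fun j => ?_
  by_cases hj : j = i
  · rw [hj, h]
  · rw [Star.eq_zero_of_pos hx hj, Star.eq_zero_of_pos (h ▸ hx) hj]

theorem Star.eq_center {x : Star n κ} (h : ∀ i, ¬ 0 < x.1 i) : x = center n κ :=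
  Star.ext fun i => le_antisymm (not_lt.1 (h i)) (x.nonneg i)

@[simp] theorem center_apply (i : Fin n) : (center n κ).1 i = 0 := rfl

theorem Star.continuous_apply (i : Fin n) : Continuous fun x : Star n κ => x.1 i := by
  fun_prop

/-- A map to the star is continuous if its coordinates are. -/
theorem Star.continuous_of {Y : Type*} [TopologicalSpace Y] {f : Y → Star n κ}
    (h : ∀ i, Continuous fun y => (f y).1 i) : Continuous f := by
  refine Continuous.subtype_mk (p := fun x => x ∈ starSet n κ) (f := fun y => (f y).1) ?_ fun y =>
      (f y).2
  have : (fun y => (f y).1) = fun y => WithLp.toLp 1 fun i => (f y).1 i := rfl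
  rw [this]
  exact (PiLp.continuous_toLp 1 _).comp (continuous_pi h)

/-- The point at distance `r` from the centre on the leg `i`; `r` is clamped to `[0, κ]`. -/
noncomputable def pt (i : Fin n) (r : ℝ) : Star n κ :=
  ⟨WithLp.toLp 1 (Pi.single i (max 0 (min r κ))), by
    refine ⟨fun j => ?_, fun j l hjl => ?_⟩
    · by_cases h : j = i
      · subst h
        simp
      · simp [h]
    · by_cases h : j = i
      · right
        have : l ≠ i := fun hl => hjl (h.trans hl.symm)
        simp [this]
      · simp [h]⟩

theorem pt_same (i : Fin n) {r : ℝ} (h0 : 0 ≤ r) (h1 : r ≤ κ) : (pt i r : Star n κ).1 i = r := by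
  simp [pt, h0, h1]

theorem pt_ne {i j : Fin n} (h : j ≠ i) (r : ℝ) : (pt i r : Star n κ).1 j = 0 := by
  simp [pt, h]

theorem Star.eq_pt {x : Star n κ} {i : Fin n} (h : ∀ j, j ≠ i → x.1 j = 0) :
    x = pt i (x.1 i) := by
  refine Star.ext fun j => ?_
  by_cases hj : j = i
  · rw [hj, pt_same i (x.nonneg i) (x.le i)]
  · rw [pt_ne hj, h j hj]

theorem Star.eq_pt_of_pos {x : Star n κ} {i : Fin n} (h : 0 < x.1 i) : x = pt i (x.1 i) :=
  Star.eq_pt fun _ hj => Star.eq_zero_of_pos h hj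

theorem pt_zero (i : Fin n) : (pt i 0 : Star n κ) = center n κ := by
  refine Star.ext fun j => ?_
  by_cases hj : j = i
  · rw [hj, pt_same i le_rfl κ.coe_nonneg]
    rfl
  · rw [pt_ne hj]
    rfl

theorem continuous_pt (i : Fin n) : Continuous (pt i : ℝ → Star n κ) := by
  refine Star.continuous_of fun j => ?_
  by_cases hj : j = i
  · subst hj
    simp only [pt, Pi.single_eq_same]
    fun_prop
  · simp only [pt_ne hj]
    exact continuous_const

theorem Star.dist_eq (x y : Star n κ) : dist x y = ∑ i, |x.1 i - y.1 i| := by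
  rw [Subtype.dist_eq, PiLp.dist_eq_of_L1]
  rfl

/-- The distance to the centre. -/
noncomputable def rad (x : Star n κ) : ℝ := ∑ i, x.1 i

theorem rad_nonneg (x : Star n κ) : 0 ≤ rad x := Finset.sum_nonneg fun i _ => x.nonneg i

theorem continuous_rad : Continuous (rad : Star n κ → ℝ) :=
  continuous_finsetSum _ fun i _ => Star.continuous_apply i

theorem dist_center (x : Star n κ) : dist (center n κ) x = rad x := by
  rw [Star.dist_eq]
  exact Finset.sum_congr rfl fun i _ => by simp [abs_of_nonneg (x.nonneg i)]

theorem rad_eq {x : Star n κ} {i : Fin n} (h : ∀ j, j ≠ i → x.1 j = 0) : rad x = x.1 i :=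
  Finset.sum_eq_single i (fun j _ hj => h j hj) (by simp)

theorem rad_of_pos {x : Star n κ} {i : Fin n} (h : 0 < x.1 i) : rad x = x.1 i :=
  rad_eq fun _ hj => Star.eq_zero_of_pos h hj

theorem exists_pos_of_rad_pos {x : Star n κ} (h : 0 < rad x) : ∃ i, 0 < x.1 i := by
  by_contra hcon
  push Not at hcon
  exact absurd (Finset.sum_nonpos fun i _ => hcon i) (not_le.2 h)

theorem rad_pt (i : Fin n) {r : ℝ} (h0 : 0 ≤ r) (h1 : r ≤ κ) : rad (pt i r : Star n κ) = r := by
  rw [rad_eq fun j hj => pt_ne hj r, pt_same i h0 h1]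

theorem rad_center : rad (center n κ) = 0 := by simp [rad]

theorem dist_pt_same (i : Fin n) {r s : ℝ} (hr0 : 0 ≤ r) (hr1 : r ≤ κ) (hs0 : 0 ≤ s)
    (hs1 : s ≤ κ) : dist (pt i r : Star n κ) (pt i s) = |r - s| := by
  rw [Star.dist_eq, Finset.sum_eq_single i, pt_same i hr0 hr1, pt_same i hs0 hs1]
  · intro j _ hj
    rw [pt_ne hj, pt_ne hj]
    simp
  · simp

theorem dist_pt_ne {i j : Fin n} (hij : i ≠ j) {r s : ℝ} (hr0 : 0 ≤ r) (hr1 : r ≤ κ) (hs0 : 0 ≤ s)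
    (hs1 : s ≤ κ) : dist (pt i r : Star n κ) (pt j s) = r + s := by
  have : ∀ l, |(pt i r : Star n κ).1 l - (pt j s : Star n κ).1 l| =
      (pt i r : Star n κ).1 l + (pt j s : Star n κ).1 l := by
    intro l
    by_cases hl : l = i
    · subst hl
      rw [pt_ne hij]
      simp [abs_of_nonneg (Star.nonneg _ _)]
    · rw [pt_ne hl]
      simp [abs_of_nonneg (Star.nonneg _ _)]
  rw [Star.dist_eq, Finset.sum_congr rfl fun l _ => this l, Finset.sum_add_distrib]
  exact congrArg₂ _ (rad_pt i hr0 hr1) (rad_pt j hs0 hs1)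

theorem leaf_eq_pt (i : Fin n) : leaf κ i = pt i (κ : ℝ) := by
  refine Star.ext fun j => ?_
  by_cases hj : j = i
  · subst hj
    rw [pt_same j κ.coe_nonneg le_rfl]
    simp [leaf]
  · rw [pt_ne hj]
    simp [leaf, hj]

theorem mem_seg_leaf {x : Star n κ} {i : Fin n} :
    x ∈ seg (center n κ) (leaf κ i) ↔ ∀ j, j ≠ i → x.1 j = 0 := by
  rw [seg, Set.mem_ofPred_eq, leaf_eq_pt, dist_center, dist_center, rad_pt i κ.coe_nonneg le_rfl]
  constructor
  · intro h j hj
    by_contra hne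
    have hpos : 0 < x.1 j := lt_of_le_of_ne (x.nonneg j) (Ne.symm hne)
    have hx := Star.eq_pt_of_pos hpos
    rw [rad_of_pos hpos, hx, dist_pt_ne hj (x.nonneg j) (x.le j) κ.coe_nonneg le_rfl,
      pt_same j (x.nonneg j) (x.le j)] at h
    linarith
  · intro h
    have hx := Star.eq_pt h
    rw [rad_eq h]
    nth_rw 2 [hx]
    rw [dist_pt_same i (x.nonneg i) (x.le i) κ.coe_nonneg le_rfl,
      abs_of_nonpos (by linarith [x.le i])]
    ring

end Points

/-! ### The topology of unordered configuration spaces -/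

section Unordered

theorem UConf.proj_surjective {X : Type*} {J : ℕ} : Function.Surjective (UConf.proj X J) := by
  rintro ⟨c, hc⟩
  let e := (c.equivFin.trans (finCongr hc)).symm
  refine ⟨⟨fun l => (e l : X), Subtype.val_injective.comp e.injective⟩, Subtype.ext ?_⟩
  ext x
  simp only [UConf.proj, Finset.mem_map, Finset.mem_univ, true_and, Function.Embedding.coeFn_mk]
  exact ⟨fun ⟨l, hl⟩ => hl ▸ (e l).2, fun hx => ⟨e.symm ⟨x, hx⟩, by simp⟩⟩

theorem UConf.mem_proj {X : Type*} {J : ℕ} {x : {x : Fin J → X // Function.Injective x}} {z : X} :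
    z ∈ (UConf.proj X J x).1 ↔ ∃ l, x.1 l = z := by
  simp [UConf.proj]

variable {X : Type*} [TopologicalSpace X] {J : ℕ}

theorem UConf.continuous_proj : Continuous (UConf.proj X J) := continuous_coinduced_rng

/-- The saturation of an open set is the union of its translates under permutations. Openness
matters because it keeps the projection a quotient map after restriction to a subset and
multiplication by the interval. -/
theorem UConf.isOpenMap_proj : IsOpenMap (UConf.proj X J) := by
  intro V hV
  rw [isOpen_coinduced]
  have : UConf.proj X J ⁻¹' (UConf.proj X J '' V) =
      ⋃ σ : Equiv.Perm (Fin J), (fun x : {x : Fin J → X // Function.Injective x} =>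
        (⟨x.1 ∘ σ, x.2.comp σ.injective⟩ : {x : Fin J → X // Function.Injective x})) ⁻¹' V := by
    ext x
    simp only [Set.mem_preimage, Set.mem_image, Set.mem_iUnion]
    constructor
    · rintro ⟨y, hy, hyx⟩
      have h1 : ∀ l, ∃ l', x.1 l' = y.1 l := fun l =>
        UConf.mem_proj.1 (hyx ▸ UConf.mem_proj.2 ⟨l, rfl⟩)
      choose σ hσ using h1
      have hinj : Function.Injective σ := fun l l' h => y.2 (by rw [← hσ, ← hσ, h])
      refine ⟨Equiv.ofBijective σ (Finite.injective_iff_bijective.1 hinj), ?_⟩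
      convert hy
      ext l
      exact hσ l
    · rintro ⟨σ, hσ⟩
      refine ⟨_, hσ, Subtype.ext ?_⟩
      ext z
      rw [UConf.mem_proj, UConf.mem_proj]
      exact ⟨fun ⟨l, hl⟩ => ⟨σ l, hl⟩, fun ⟨l, hl⟩ => ⟨σ.symm l, by simpa using hl⟩⟩
  rw [this]
  refine isOpen_iUnion fun σ => hV.preimage ?_
  refine Continuous.subtype_mk ?_ _
  exact continuous_pi fun l => (continuous_apply (σ l)).comp continuous_subtype_val

theorem UConf.isOpenQuotientMap_proj : IsOpenQuotientMap (UConf.proj X J) :=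
  ⟨UConf.proj_surjective, UConf.continuous_proj, UConf.isOpenMap_proj⟩

end Unordered


/-! ### Numbers of points on the legs and the two families of open sets -/

section Counts

open scoped Classical

variable {n : ℕ} {κ : ℝ≥0}

/-- The number of points on the `i`-th leg without the centre. -/
noncomputable def cnt (c : Finset (Star n κ)) (i : Fin n) : ℕ :=
  (c.filter fun y => 0 < y.1 i).card

/-- `x` is the unique point of `c` nearest to the centre. -/
def IsNearest (c : Finset (Star n κ)) (x : Star n κ) : Prop :=
  x ∈ c ∧ ∀ y ∈ c, y ≠ x → rad x < rad y

/-- The configurations with `q i` points in the interior of the `i`-th leg and none at the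
centre. -/
def legSet (n : ℕ) (κ : ℝ≥0) (J : ℕ) (q : Fin n → ℕ) : Set (UConf (Star n κ) J) :=
  {c | (∀ i, cnt c.1 i = q i) ∧ ∑ i, q i = J}

/-- The configurations with a unique point nearest to the centre and `p i` other points on the
`i`-th leg. -/
def nearSet (n : ℕ) (κ : ℝ≥0) (J : ℕ) (p : Fin n → ℕ) : Set (UConf (Star n κ) J) :=
  {c | (∃ x, IsNearest c.1 x ∧ ∀ i, cnt (c.1.erase x) i = p i) ∧ ∑ i, p i + 1 = J}

theorem sum_cnt (c : Finset (Star n κ)) :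
    ∑ i, cnt c i = (c.filter fun y => y ≠ center n κ).card := by
  unfold cnt
  rw [← Finset.card_biUnion]
  · congr 1
    ext y
    simp only [Finset.mem_biUnion, Finset.mem_univ, true_and, Finset.mem_filter]
    constructor
    · rintro ⟨i, hy, hi⟩
      refine ⟨hy, ?_⟩
      rintro rfl
      simp at hi
    · rintro ⟨hy, hne⟩
      by_contra hcon
      push Not at hcon
      exact hne (Star.eq_center fun i => not_lt.2 (hcon i hy))
  · intro i _ j _ hij
    refine Finset.disjoint_left.2 fun y hy hy' => ?_
    rw [Finset.mem_filter] at hy hy'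
    exact hy'.2.ne' (Star.eq_zero_of_pos hy.2 hij.symm)

theorem sum_cnt_le (c : Finset (Star n κ)) : ∑ i, cnt c i ≤ c.card := by
  rw [sum_cnt]
  exact Finset.card_filter_le _ _

theorem cnt_erase_add {c : Finset (Star n κ)} {x : Star n κ} (hx : x ∈ c) (i : Fin n) :
    cnt c i = cnt (c.erase x) i + if 0 < x.1 i then 1 else 0 := by
  unfold cnt
  rw [Finset.filter_erase]
  split_ifs with h
  · rw [Finset.card_erase_add_one (by simp [hx, h])]
  · rw [Finset.erase_eq_of_notMem (by simp [h]), add_zero]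

theorem IsNearest.unique {c : Finset (Star n κ)} {x y : Star n κ} (hx : IsNearest c x)
    (hy : IsNearest c y) : x = y := by
  by_contra h
  exact lt_asymm (hx.2 y hy.1 (Ne.symm h)) (hy.2 x hx.1 h)

variable {J : ℕ}

theorem card_filter_proj (x : {x : Fin J → Star n κ // Function.Injective x})
    (P : Star n κ → Prop) [DecidablePred P] :
    ((UConf.proj _ J x).1.filter P).card = (Finset.univ.filter fun l => P (x.1 l)).card := by
  simp only [UConf.proj, Finset.filter_map, Finset.card_map]
  rfl

theorem eventually_pos (x : {x : Fin J → Star n κ // Function.Injective x}) :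
    ∀ᶠ x' in nhds x, ∀ l i, 0 < (x.1 l).1 i → 0 < (x'.1 l).1 i := by
  simp only [Filter.eventually_all]
  intro l i h
  have hc : Continuous fun x' : {x : Fin J → Star n κ // Function.Injective x} => (x'.1 l).1 i :=
    (Star.continuous_apply i).comp ((continuous_apply l).comp continuous_subtype_val)
  exact hc.continuousAt.eventually (lt_mem_nhds h)

/-- A positive coordinate stays positive nearby, so no leg loses points; the total is already the
maximum `J`, so no leg gains any. -/
theorem isOpen_legSet (q : Fin n → ℕ) : IsOpen (legSet n κ J q) := by
  change IsOpen (UConf.proj (Star n κ) J ⁻¹' _)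
  rw [isOpen_iff_eventually]
  rintro x ⟨hx, hq⟩
  filter_upwards [eventually_pos x] with x' hx'
  have hle : ∀ i ∈ Finset.univ, q i ≤ cnt (UConf.proj _ J x').1 i := by
    intro i _
    rw [← hx i]
    unfold cnt
    rw [card_filter_proj, card_filter_proj]
    refine Finset.card_le_card fun l hl => ?_
    simp only [Finset.mem_filter, Finset.mem_univ, true_and] at hl ⊢
    exact hx' l i hl
  refine ⟨fun i => ?_, hq⟩
  have h1 : ∑ i, q i = ∑ i, cnt (UConf.proj _ J x').1 i := by
    refine le_antisymm (Finset.sum_le_sum hle) ?_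
    rw [hq]
    exact (sum_cnt_le _).trans (UConf.proj _ J x').2.le
  exact ((Finset.sum_eq_sum_iff_of_le hle).1 h1 i (Finset.mem_univ i)).symm

/-- Being strictly nearest is an open condition, and the remaining `J - 1` points are counted as in
`isOpen_legSet`. -/
theorem isOpen_nearSet (p : Fin n → ℕ) : IsOpen (nearSet n κ J p) := by
  change IsOpen (UConf.proj (Star n κ) J ⁻¹' _)
  rw [isOpen_iff_eventually]
  rintro x ⟨⟨z, hz, hx⟩, hp⟩
  obtain ⟨l₀, rfl⟩ := UConf.mem_proj.1 hz.1
  have hrad : ∀ᶠ x' in nhds x, ∀ l, l ≠ l₀ → rad (x'.1 l₀) < rad (x'.1 l) := by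
    simp only [Filter.eventually_all]
    intro l hl
    have hc : ∀ l, Continuous fun x' : {x : Fin J → Star n κ // Function.Injective x} =>
        rad (x'.1 l) := fun l =>
      continuous_rad.comp ((continuous_apply l).comp continuous_subtype_val)
    exact (hc l₀).continuousAt.eventually_lt (hc l).continuousAt
      (hz.2 _ (UConf.mem_proj.2 ⟨l, rfl⟩) fun h => hl (x.2 h))
  have herase : ∀ (y : {x : Fin J → Star n κ // Function.Injective x}) (i : Fin n),
      cnt ((UConf.proj _ J y).1.erase (y.1 l₀)) i =
        (Finset.univ.filter fun l => l ≠ l₀ ∧ 0 < (y.1 l).1 i).card := by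
    intro y i
    have := card_filter_proj y fun z => z ≠ y.1 l₀ ∧ 0 < z.1 i
    unfold cnt
    rw [← Finset.filter_ne', Finset.filter_filter, this]
    congr 1
    ext l
    simp [y.2.eq_iff]
  filter_upwards [eventually_pos x, hrad] with x' hx' hr
  have hmem : x'.1 l₀ ∈ (UConf.proj _ J x').1 := UConf.mem_proj.2 ⟨l₀, rfl⟩
  refine ⟨⟨x'.1 l₀, ⟨hmem, fun y hy hne => ?_⟩, ?_⟩, hp⟩
  · obtain ⟨l, rfl⟩ := UConf.mem_proj.1 hy
    exact hr l fun h => hne (by rw [h])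
  · have hle : ∀ i ∈ Finset.univ, p i ≤ cnt ((UConf.proj _ J x').1.erase (x'.1 l₀)) i := by
      intro i _
      rw [← hx i, herase, herase]
      refine Finset.card_le_card fun l hl => ?_
      simp only [Finset.mem_filter, Finset.mem_univ, true_and] at hl ⊢
      exact ⟨hl.1, hx' l i hl.2⟩
    have h1 : ∑ i, p i = ∑ i, cnt ((UConf.proj _ J x').1.erase (x'.1 l₀)) i := by
      refine le_antisymm (Finset.sum_le_sum hle) ((sum_cnt_le _).trans ?_)
      rw [Finset.card_erase_of_mem hmem, (UConf.proj _ J x').2]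
      omega
    exact fun i => ((Finset.sum_eq_sum_iff_of_le hle).1 h1 i (Finset.mem_univ i)).symm

theorem legSet_unique {c : UConf (Star n κ) J} {q q' : Fin n → ℕ} (h : c ∈ legSet n κ J q)
    (h' : c ∈ legSet n κ J q') : q = q' := funext fun i => (h.1 i).symm.trans (h'.1 i)

theorem nearSet_unique {c : UConf (Star n κ) J} {p p' : Fin n → ℕ} (h : c ∈ nearSet n κ J p)
    (h' : c ∈ nearSet n κ J p') : p = p' := by
  obtain ⟨⟨x, hx, hp⟩, -⟩ := h
  obtain ⟨⟨x', hx', hp'⟩, -⟩ := h'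
  obtain rfl := hx.unique hx'
  exact funext fun i => (hp i).symm.trans (hp' i)

theorem mem_legSet_of_center_notMem {c : UConf (Star n κ) J} (h : center n κ ∉ c.1) :
    c ∈ legSet n κ J (cnt c.1) := by
  refine ⟨fun _ => rfl, ?_⟩
  rw [sum_cnt, Finset.filter_true_of_mem, c.2]
  rintro y hy rfl
  exact h hy

theorem center_notMem_of_mem_legSet {c : UConf (Star n κ) J} {q : Fin n → ℕ}
    (h : c ∈ legSet n κ J q) : center n κ ∉ c.1 := by
  intro hc
  have h1 := sum_cnt c.1
  rw [Finset.sum_congr rfl fun i _ => h.1 i, h.2, Finset.filter_ne', Finset.card_erase_of_mem hc,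
    c.2] at h1
  have : 0 < c.1.card := Finset.card_pos.2 ⟨_, hc⟩
  rw [c.2] at this
  omega

theorem isNearest_center {c : Finset (Star n κ)} (h : center n κ ∈ c) :
    IsNearest c (center n κ) := by
  refine ⟨h, fun y _ hne => ?_⟩
  rw [rad_center]
  refine lt_of_le_of_ne (rad_nonneg y) fun h0 => hne (Star.eq_center fun i hi => ?_)
  rw [rad_of_pos hi] at h0
  exact hi.ne h0

theorem mem_nearSet_of_center_mem {c : UConf (Star n κ) J} (h : center n κ ∈ c.1) :
    c ∈ nearSet n κ J (cnt c.1) := by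
  have he : ∀ i, cnt (c.1.erase (center n κ)) i = cnt c.1 i := by
    intro i
    have := cnt_erase_add h i
    simpa using this.symm
  refine ⟨⟨center n κ, isNearest_center h, he⟩, ?_⟩
  rw [sum_cnt, Finset.filter_ne', Finset.card_erase_add_one h, c.2]

/-- Away from the centre the nearest point lies on exactly one leg, and this leg is `m`. -/
theorem exists_add_single {c : UConf (Star n κ) J} {p q : Fin n → ℕ} (hp : c ∈ nearSet n κ J p)
    (hq : c ∈ legSet n κ J q) : ∃ m, q = p + Pi.single m 1 := by
  obtain ⟨⟨x, hx, hp⟩, hpJ⟩ := hp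
  have hne : x ≠ center n κ := fun h => center_notMem_of_mem_legSet hq (h ▸ hx.1)
  obtain ⟨m, hm⟩ : ∃ m, 0 < x.1 m := by
    by_contra hcon
    push Not at hcon
    exact hne (Star.eq_center fun i => not_lt.2 (hcon i))
  refine ⟨m, funext fun i => ?_⟩
  rw [← hq.1 i, cnt_erase_add hx.1, hp i]
  by_cases hi : i = m
  · subst hi
    simp [hm]
  · have h0 : x.1 i = 0 := Star.eq_zero_of_pos hm hi
    simp [hi, h0]

end Counts


/-! ### Straight-line motions of configurations -/

section Motion

open scoped Classical unitInterval

variable {n : ℕ} {κ : ℝ≥0} {J : ℕ}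

/-- The number of points of `c` on the `i`-th leg at distance more than `r` from the centre. -/
noncomputable def rank (c : Finset (Star n κ)) (r : ℝ) (i : Fin n) : ℕ :=
  (c.filter fun z => r < z.1 i).card

/-- The `i`-th coordinate of the target of `y`: a point on the `i`-th leg is sent to the position
that `T` prescribes for its rank. -/
noncomputable def target (T : Fin n → ℕ → Set.Icc (0 : ℝ) κ) (c : Finset (Star n κ))
    (y : Star n κ) (i : Fin n) : ℝ :=
  if 0 < y.1 i then T i (rank c (y.1 i) i) else 0

theorem target_nonneg (T : Fin n → ℕ → Set.Icc (0 : ℝ) κ) (c : Finset (Star n κ))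
    (y : Star n κ) (i : Fin n) : 0 ≤ target T c y i := by
  unfold target
  split_ifs
  exacts [(T _ _).2.1, le_rfl]

theorem target_of_pos (T : Fin n → ℕ → Set.Icc (0 : ℝ) κ) (c : Finset (Star n κ))
    {y : Star n κ} {i : Fin n} (h : 0 < y.1 i) : target T c y i = T i (rank c (y.1 i) i) :=
  if_pos h

theorem target_of_eq_zero (T : Fin n → ℕ → Set.Icc (0 : ℝ) κ) (c : Finset (Star n κ))
    {y : Star n κ} {i : Fin n} (h : y.1 i = 0) : target T c y i = 0 :=
  if_neg (by rw [h]; exact lt_irrefl _)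

/-- The motion of a point `y` of `c` to its target, at constant speed. -/
noncomputable def move (T : Fin n → ℕ → Set.Icc (0 : ℝ) κ) (t : I) (c : Finset (Star n κ))
    (y : Star n κ) : Star n κ :=
  ⟨WithLp.toLp 1 fun i => (1 - t) * y.1 i + t * target T c y i, by
    have h0 : (0 : ℝ) ≤ t := t.2.1
    have h1 : (t : ℝ) ≤ 1 := t.2.2
    refine ⟨fun i => ⟨?_, ?_⟩, fun i j hij => ?_⟩
    · exact add_nonneg (mul_nonneg (sub_nonneg.2 h1) (y.nonneg i))
        (mul_nonneg h0 (target_nonneg T c y i))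
    · have h2 : target T c y i ≤ κ := by
        unfold target
        split_ifs
        exacts [(T _ _).2.2, κ.coe_nonneg]
      change (1 - t) * y.1 i + t * target T c y i ≤ (κ : ℝ)
      nlinarith [y.le i]
    · rcases y.2.2 i j hij with h | h
      · left
        change (1 - t) * y.1 i + t * target T c y i = 0
        rw [target_of_eq_zero T c h, h]
        ring
      · right
        change (1 - t) * y.1 j + t * target T c y j = 0
        rw [target_of_eq_zero T c h, h]
        ring⟩

theorem move_apply (T : Fin n → ℕ → Set.Icc (0 : ℝ) κ) (t : I) (c : Finset (Star n κ))
    (y : Star n κ) (i : Fin n) :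
    (move T t c y).1 i = (1 - t) * y.1 i + t * target T c y i := rfl

theorem move_zero (T : Fin n → ℕ → Set.Icc (0 : ℝ) κ) (c : Finset (Star n κ))
    (y : Star n κ) : move T 0 c y = y :=
  Star.ext fun i => by simp [move_apply]

theorem move_one_apply (T : Fin n → ℕ → Set.Icc (0 : ℝ) κ) (c : Finset (Star n κ))
    (y : Star n κ) (i : Fin n) : (move T 1 c y).1 i = target T c y i := by simp [move_apply]

/-- The configurations whose points do not collide on the way to their targets. -/
structure Movable (T : Fin n → ℕ → Set.Icc (0 : ℝ) κ) (c : Finset (Star n κ)) : Prop where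
  anti : ∀ i r r', r < r' → r' < cnt c i → (T i r' : ℝ) < T i r
  inj : ∀ y ∈ c, ∀ z ∈ c, (∀ i, target T c y i = 0) → (∀ i, target T c z i = 0) → y = z
  zero : center n κ ∈ c → ∀ i, (T i (cnt c i) : ℝ) = 0

theorem rank_lt_rank {c : Finset (Star n κ)} {y z : Star n κ} {i : Fin n} (hz : z ∈ c)
    (h : y.1 i < z.1 i) : rank c (z.1 i) i < rank c (y.1 i) i := by
  refine Finset.card_lt_card (Finset.ssubset_iff_of_subset ?_ |>.2 ⟨z, ?_, ?_⟩)
  · intro w hw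
    rw [Finset.mem_filter] at hw ⊢
    exact ⟨hw.1, h.trans hw.2⟩
  · simp [hz, h]
  · simp

theorem rank_lt_cnt {c : Finset (Star n κ)} {y : Star n κ} {i : Fin n} (hy : y ∈ c)
    (h : 0 < y.1 i) : rank c (y.1 i) i < cnt c i := by
  refine Finset.card_lt_card (Finset.ssubset_iff_of_subset ?_ |>.2 ⟨y, ?_, ?_⟩)
  · intro w hw
    rw [Finset.mem_filter] at hw ⊢
    exact ⟨hw.1, h.trans hw.2⟩
  · simp [hy, h]
  · simp

theorem Movable.lt {T : Fin n → ℕ → Set.Icc (0 : ℝ) κ} {c : Finset (Star n κ)} (H : Movable T c)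
    (t : I) {y z : Star n κ} {i : Fin n} (hy : y ∈ c) (hz : z ∈ c) (h0 : 0 < y.1 i)
    (h : y.1 i < z.1 i) : (move T t c y).1 i < (move T t c z).1 i := by
  have h1 := H.anti i _ _ (rank_lt_rank hz h) (rank_lt_cnt hy h0)
  rw [move_apply, move_apply, target_of_pos T c h0, target_of_pos T c (h0.trans h)]
  rcases eq_or_lt_of_le t.2.1 with ht | ht
  · rw [← ht]
    linarith
  · have := mul_lt_mul_of_pos_left h1 ht
    have := mul_le_mul_of_nonneg_left h.le (sub_nonneg.2 t.2.2)
    linarith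

/-- Points of one leg keep their order. Points without a common leg can meet only at the centre, and
then both have it as target, which `inj` grants to a single point. -/
theorem Movable.injOn {T : Fin n → ℕ → Set.Icc (0 : ℝ) κ} {c : Finset (Star n κ)}
    (H : Movable T c) (t : I) : Set.InjOn (move T t c) c := by
  intro y hy z hz hyz
  by_cases hcom : ∃ i, 0 < y.1 i ∧ 0 < z.1 i
  · obtain ⟨i, hyi, hzi⟩ := hcom
    rcases lt_trichotomy (y.1 i) (z.1 i) with h | h | h
    · exact absurd (hyz ▸ H.lt t hy hz hyi h) (lt_irrefl _)
    · exact Star.ext_of_pos hyi h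
    · exact absurd (hyz ▸ H.lt t hz hy hzi h) (lt_irrefl _)
  · have key : ∀ y z : Star n κ, move T t c y = move T t c z → (¬ ∃ i, 0 < y.1 i ∧ 0 < z.1 i) →
        ∀ i, target T c y i = 0 := by
      intro y z hyz hcom i
      by_cases hi : 0 < y.1 i
      · have hz0 : z.1 i = 0 := le_antisymm (not_lt.1 fun h => hcom ⟨i, hi, h⟩) (z.nonneg i)
        have h1 : (move T t c y).1 i = (move T t c z).1 i := by rw [hyz]
        rw [move_apply, move_apply, target_of_eq_zero T c hz0, hz0] at h1
        have h2 := mul_nonneg t.2.1 (target_nonneg T c y i)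
        have h3 := mul_nonneg (sub_nonneg.2 t.2.2) hi.le
        have h4 : (1 - (t : ℝ)) * y.1 i = 0 := by linarith
        have h5 : (t : ℝ) = 1 := by
          rcases mul_eq_zero.1 h4 with h | h
          · linarith
          · exact absurd h hi.ne'
        rw [h5] at h1
        linarith
      · exact target_of_eq_zero T c (le_antisymm (not_lt.1 hi) (y.nonneg i))
    exact H.inj y hy z hz (key y z hyz hcom)
      (key z y hyz.symm fun ⟨i, h, h'⟩ => hcom ⟨i, h', h⟩)

theorem eventually_eq_zero {x : {x : Fin J → Star n κ // Function.Injective x}} {l : Fin J}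
    {i j : Fin n} (hij : i ≠ j) (h : 0 < (x.1 l).1 j) : ∀ᶠ x' in nhds x, (x'.1 l).1 i = 0 := by
  filter_upwards [eventually_pos x] with x' hx'
  exact Star.eq_zero_of_pos (hx' l j h) hij

theorem continuous_coord (l : Fin J) (i : Fin n) :
    Continuous fun x : {x : Fin J → Star n κ // Function.Injective x} => (x.1 l).1 i :=
  (Star.continuous_apply i).comp ((continuous_apply l).comp continuous_subtype_val)

/-- Targets are locally constant. -/
theorem eventually_target_eq (T : Fin n → ℕ → Set.Icc (0 : ℝ) κ)
    (x : {x : Fin J → Star n κ // Function.Injective x})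
    (H : center n κ ∈ (UConf.proj _ J x).1 → ∀ i, (T i (cnt (UConf.proj _ J x).1 i) : ℝ) = 0)
    (l : Fin J) (i : Fin n) :
    ∀ᶠ x' in nhds x, target T (UConf.proj _ J x').1 (x'.1 l) i =
      target T (UConf.proj _ J x).1 (x.1 l) i := by
  by_cases hi : 0 < (x.1 l).1 i
  · have h1 : ∀ᶠ x' in nhds x, ∀ l', (x'.1 l).1 i < (x'.1 l').1 i ↔ (x.1 l).1 i < (x.1 l').1 i := by
      rw [Filter.eventually_all]
      intro l'
      rcases lt_trichotomy ((x.1 l).1 i) ((x.1 l').1 i) with h | h | h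
      · filter_upwards [(continuous_coord l i).continuousAt.eventually_lt
          (continuous_coord l' i).continuousAt h] with x' hx'
        simp [h, hx']
      · have hl : l = l' := x.2 (Star.ext_of_pos hi h)
        subst hl
        simp
      · filter_upwards [(continuous_coord l' i).continuousAt.eventually_lt
          (continuous_coord l i).continuousAt h] with x' hx'
        exact iff_of_false (lt_asymm hx') (lt_asymm h)
    filter_upwards [h1, eventually_pos x] with x' hx' hpos
    rw [target_of_pos T _ hi, target_of_pos T _ (hpos l i hi)]
    congr 2
    unfold rank
    rw [card_filter_proj, card_filter_proj]
    congr 1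
    ext l'
    simp [hx' l']
  · have hi0 : (x.1 l).1 i = 0 := le_antisymm (not_lt.1 hi) (Star.nonneg _ i)
    rw [target_of_eq_zero T _ hi0]
    by_cases hc : ∃ j, 0 < (x.1 l).1 j
    · obtain ⟨j, hj⟩ := hc
      have hij : i ≠ j := by
        rintro rfl
        exact hi hj
      filter_upwards [eventually_eq_zero hij hj] with x' hx'
      exact target_of_eq_zero T _ hx'
    · push Not at hc
      have hl : x.1 l = center n κ := Star.eq_center fun i => not_lt.2 (hc i)
      -- A point at the centre can be perturbed onto any leg `i`. There it is innermost, with rank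
      -- `cnt i`, and `H` makes the target of this rank the centre.
      have hmem : center n κ ∈ (UConf.proj _ J x).1 := UConf.mem_proj.2 ⟨l, hl⟩
      have h1 : ∀ᶠ x' in nhds x, ∀ l', 0 < (x'.1 l).1 i →
          ((x'.1 l).1 i < (x'.1 l').1 i ↔ 0 < (x.1 l').1 i) := by
        rw [Filter.eventually_all]
        intro l'
        by_cases h : 0 < (x.1 l').1 i
        · filter_upwards [(continuous_coord l i).continuousAt.eventually_lt
            (continuous_coord l' i).continuousAt (by rwa [hi0])] with x' hx' _
          simp [h, hx']
        · by_cases hll : l' = l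
          · subst hll
            simp [hi]
          · have hne : x.1 l' ≠ center n κ := fun h' => hll (x.2 (h'.trans hl.symm))
            obtain ⟨j, hj⟩ : ∃ j, 0 < (x.1 l').1 j := by
              by_contra hcon
              push Not at hcon
              exact hne (Star.eq_center fun i => not_lt.2 (hcon i))
            have hij : i ≠ j := by
              rintro rfl
              exact h hj
            filter_upwards [eventually_eq_zero hij hj] with x' hx' hpos
            rw [hx']
            simp [h, hpos.le]
      filter_upwards [h1] with x' hx'
      by_cases hpos : 0 < (x'.1 l).1 i
      · rw [target_of_pos T _ hpos]
        refine Eq.trans ?_ (H hmem i)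
        congr 2
        unfold rank cnt
        rw [card_filter_proj, card_filter_proj]
        congr 1
        ext l'
        simp [hx' l' hpos]
      · exact if_neg hpos

/-- The motion of configurations is continuous. -/
theorem exists_motion (T : Fin n → ℕ → Set.Icc (0 : ℝ) κ) (W : Set (UConf (Star n κ) J))
    (hW : ∀ c ∈ W, Movable T c.1) :
    ∃ H : W × I → UConf (Star n κ) J, Continuous H ∧
      ∀ c t, (H (c, t)).1 = c.1.1.image (move T t c.1.1) := by
  let H : W × I → UConf (Star n κ) J := fun a =>
    ⟨a.1.1.1.image (move T a.2 a.1.1.1), by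
      rw [Finset.card_image_of_injOn ((hW _ a.1.2).injOn _), a.1.1.2]⟩
  refine ⟨H, ?_, fun c t => rfl⟩
  have hq := (UConf.isOpenQuotientMap_proj (X := Star n κ) (J := J)).restrictPreimage W
  rw [← (hq.prodMap (IsOpenQuotientMap.id (X := I))).continuous_comp_iff]
  have hinj : ∀ a : (UConf.proj (Star n κ) J ⁻¹' W) × I,
      Function.Injective fun l => move T a.2 (UConf.proj _ J a.1.1).1 (a.1.1.1 l) := by
    intro a l l' h
    exact a.1.1.2 ((hW _ a.1.2).injOn a.2 (UConf.mem_proj.2 ⟨l, rfl⟩)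
      (UConf.mem_proj.2 ⟨l', rfl⟩) h)
  have he : H ∘ Prod.map (W.restrictPreimage (UConf.proj (Star n κ) J)) id = fun a =>
      UConf.proj _ J ⟨_, hinj a⟩ := by
    funext a
    refine Subtype.ext ?_
    ext z
    rw [UConf.mem_proj]
    change z ∈ (UConf.proj _ J a.1.1).1.image (move T a.2 (UConf.proj _ J a.1.1).1) ↔ _
    rw [Finset.mem_image]
    constructor
    · rintro ⟨y, hy, rfl⟩
      obtain ⟨l, rfl⟩ := UConf.mem_proj.1 hy
      exact ⟨l, rfl⟩
    · rintro ⟨l, rfl⟩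
      exact ⟨_, UConf.mem_proj.2 ⟨l, rfl⟩, rfl⟩
  rw [he]
  refine UConf.continuous_proj.comp (Continuous.subtype_mk (continuous_pi fun l => ?_) _)
  refine Star.continuous_of fun i => ?_
  simp only [move_apply]
  have h1 : Continuous fun a : (UConf.proj (Star n κ) J ⁻¹' W) × I => (a.1.1.1 l).1 i :=
    (continuous_coord l i).comp (continuous_subtype_val.comp continuous_fst)
  have h2 : Continuous fun a : (UConf.proj (Star n κ) J ⁻¹' W) × I =>
      target T (UConf.proj _ J a.1.1).1 (a.1.1.1 l) i := by
    have : Continuous fun x : UConf.proj (Star n κ) J ⁻¹' W =>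
        target T (UConf.proj _ J x.1).1 (x.1.1 l) i := by
      rw [continuous_iff_continuousAt]
      intro x
      have ev := eventually_target_eq T x.1 (hW _ x.2).zero l i
      exact continuousAt_const.congr (Filter.EventuallyEq.symm
        (continuous_subtype_val.continuousAt.eventually ev))
    exact this.comp continuous_fst
  have h3 : Continuous fun a : (UConf.proj (Star n κ) J ⁻¹' W) × I => (a.2 : ℝ) :=
    continuous_subtype_val.comp continuous_snd
  exact ((continuous_const.sub h3).mul h1).add (h3.mul h2)

/-- A set of configurations that a motion carries into itself and to a single configuration is
simply connected. -/
theorem isSimplyConnected_of_motion {Y : Type*} [TopologicalSpace Y]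
    {j : Y → UConf (Star n κ) J} (hj : Topology.IsEmbedding j) {S : Set Y} (hne : S.Nonempty)
    (T : Fin n → ℕ → Set.Icc (0 : ℝ) κ) (hmov : ∀ y ∈ S, Movable T (j y).1)
    (hstay : ∀ y ∈ S, ∀ t : I, ∃ y' ∈ S, (j y').1 = (j y).1.image (move T t (j y).1))
    (B : Finset (Star n κ)) (hB : ∀ y ∈ S, ∀ z ∈ (j y).1, move T 1 (j y).1 z ∈ B)
    (hcard : B.card ≤ J) : IsSimplyConnected S := by
  obtain ⟨H, hH, hHe⟩ := exists_motion T (j '' S) (by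
    rintro _ ⟨y, hy, rfl⟩
    exact hmov y hy)
  choose! F hFS hF using hstay
  have hjF : ∀ (y : S) (t : I), j (F y t) = H (⟨j y, ⟨y, y.2, rfl⟩⟩, t) := fun y t =>
    Subtype.ext ((hF y y.2 t).trans (hHe ⟨j y, ⟨y, y.2, rfl⟩⟩ t).symm)
  -- At time 1 all `J` distinct points lie in `B`, which has no more than `J` elements.
  have hend : ∀ y ∈ S, (j (F y 1)).1 = B := by
    intro y hy
    refine Finset.eq_of_subset_of_card_le ?_ (hcard.trans (j (F y 1)).2.ge)
    intro w hw
    have hw' : w ∈ (j y).1.image (move T 1 (j y).1) := hF y hy 1 ▸ hw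
    obtain ⟨z, hz, hzw⟩ := Finset.mem_image.1 hw'
    exact hzw ▸ hB y hy z hz
  obtain ⟨y₀, hy₀⟩ := hne
  have hcont : Continuous fun a : I × S => (⟨F a.2 a.1, hFS a.2 a.2.2 a.1⟩ : S) := by
    refine Continuous.subtype_mk (hj.continuous_iff.2 ?_) _
    have : (j ∘ fun a : I × S => F a.2 a.1) = fun a : I × S =>
        H (⟨j a.2, ⟨a.2, a.2.2, rfl⟩⟩, a.1) := by
      funext a
      exact hjF a.2 a.1
    rw [this]
    refine hH.comp (Continuous.prodMk (Continuous.subtype_mk ?_ _) continuous_fst)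
    exact hj.continuous.comp (continuous_subtype_val.comp continuous_snd)
  have h0 : ∀ y : S, (⟨F y 0, hFS y y.2 0⟩ : S) = y := by
    intro y
    refine Subtype.ext (hj.injective (Subtype.ext ?_))
    refine (hF y y.2 0).trans ?_
    rw [Finset.image_congr (g := id) fun z _ => move_zero T _ z, Finset.image_id]
  have h1 : ∀ y : S, (⟨F y 1, hFS y y.2 1⟩ : S) = ⟨F y₀ 1, hFS y₀ hy₀ 1⟩ := fun y =>
    Subtype.ext (hj.injective (Subtype.ext ((hend y y.2).trans (hend y₀ hy₀).symm)))
  have hc : ContractibleSpace S := by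
    refine (contractible_iff_id_nullhomotopic S).2 ⟨⟨F y₀ 1, hFS y₀ hy₀ 1⟩, ⟨?_⟩⟩
    exact
      { toFun := fun a => ⟨F a.2 a.1, hFS a.2 a.2.2 a.1⟩
        continuous_toFun := hcont
        map_zero_left := h0
        map_one_left := h1 }
  exact SimplyConnectedSpace.ofContractible S

end Motion


/-! ### Motions that preserve the open sets -/

section Stay

open scoped Classical unitInterval

variable {n : ℕ} {κ : ℝ≥0} {J : ℕ}

theorem move_pos {T : Fin n → ℕ → Set.Icc (0 : ℝ) κ} {t : I} {c : Finset (Star n κ)}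
    {y : Star n κ} {i : Fin n} (h : 0 < y.1 i → 0 < target T c y i) :
    0 < (move T t c y).1 i ↔ 0 < y.1 i := by
  constructor
  · intro hm
    by_contra hy
    have h0 : y.1 i = 0 := le_antisymm (not_lt.1 hy) (y.nonneg i)
    rw [move_apply, target_of_eq_zero T c h0, h0] at hm
    simp at hm
  · intro hy
    rw [move_apply]
    rcases eq_or_lt_of_le t.2.1 with ht | ht
    · rw [← ht]
      simpa using hy
    · exact add_pos_of_nonneg_of_pos (mul_nonneg (sub_nonneg.2 t.2.2) hy.le)
        (mul_pos ht (h hy))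

theorem cnt_image_move {T : Fin n → ℕ → Set.Icc (0 : ℝ) κ} (t : I) {c S : Finset (Star n κ)}
    (hinj : Set.InjOn (move T t c) S) {i : Fin n}
    (h : ∀ y ∈ S, 0 < y.1 i → 0 < target T c y i) : cnt (S.image (move T t c)) i = cnt S i := by
  unfold cnt
  rw [Finset.filter_image, Finset.card_image_of_injOn]
  · congr 1
    exact Finset.filter_congr fun y hy => move_pos (h y hy)
  · exact hinj.mono fun y hy => (Finset.mem_filter.1 hy).1

/-- The configuration at time `t`. -/
noncomputable def Movable.conf {T : Fin n → ℕ → Set.Icc (0 : ℝ) κ} {c : UConf (Star n κ) J}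
    (H : Movable T c.1) (t : I) : UConf (Star n κ) J :=
  ⟨c.1.image (move T t c.1), by rw [Finset.card_image_of_injOn (H.injOn t), c.2]⟩

/-- No point starts at the centre and no target lies there, so the conditions `inj` and `zero` are
vacuous. -/
theorem movable_of_mem_legSet {T : Fin n → ℕ → Set.Icc (0 : ℝ) κ} {q : Fin n → ℕ}
    (hA : ∀ i r r', r < r' → r' < q i → (T i r' : ℝ) < T i r)
    (hB : ∀ i r, r < q i → 0 < (T i r : ℝ)) {c : UConf (Star n κ) J} (hc : c ∈ legSet n κ J q) :
    Movable T c.1 where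
  anti i r r' h h' := hA i r r' h (hc.1 i ▸ h')
  inj y hy z hz hy0 _ := by
    exfalso
    have hne : y ≠ center n κ := fun h => center_notMem_of_mem_legSet hc (h ▸ hy)
    refine hne (Star.eq_center fun i hi => ?_)
    have h1 := hy0 i
    rw [target_of_pos T _ hi] at h1
    exact (hB i _ (hc.1 i ▸ rank_lt_cnt hy hi)).ne' h1
  zero h := absurd h (center_notMem_of_mem_legSet hc)

theorem conf_mem_legSet {T : Fin n → ℕ → Set.Icc (0 : ℝ) κ} {q : Fin n → ℕ}
    (hB : ∀ i r, r < q i → 0 < (T i r : ℝ)) {c : UConf (Star n κ) J} (hc : c ∈ legSet n κ J q)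
    (H : Movable T c.1) (t : I) : H.conf t ∈ legSet n κ J q := by
  refine ⟨fun i => ?_, hc.2⟩
  rw [← hc.1 i]
  refine cnt_image_move t (H.injOn t) fun y hy hi => ?_
  rw [target_of_pos T _ hi]
  exact hB i _ (hc.1 i ▸ rank_lt_cnt hy hi)

theorem rank_lt_of_ne {c : Finset (Star n κ)} {x y : Star n κ} (hx : IsNearest c x) (hy : y ∈ c)
    (hne : y ≠ x) {i : Fin n} (hi : 0 < y.1 i) : rank c (y.1 i) i < cnt (c.erase x) i := by
  have h : rank c (y.1 i) i = rank (c.erase x) (y.1 i) i := by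
    unfold rank
    rw [Finset.filter_erase, Finset.erase_eq_of_notMem]
    simp only [Finset.mem_filter, not_and, not_lt]
    intro _
    by_contra hcon
    have h1 := hx.2 y hy hne
    rw [rad_of_pos hi, rad_of_pos (hi.trans (not_le.1 hcon))] at h1
    exact hcon h1.le
  rw [h]
  exact rank_lt_cnt (Finset.mem_erase.2 ⟨hne, hy⟩) hi

/-- The nearest point is innermost on its leg. So it is the point whose target is `T i (p i)`, one
entry beyond the targets of the others. -/
theorem rank_nearest {c : Finset (Star n κ)} {x : Star n κ} (hx : IsNearest c x) {i : Fin n}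
    (hi : 0 < x.1 i) : rank c (x.1 i) i = cnt (c.erase x) i := by
  unfold rank cnt
  congr 1
  ext y
  simp only [Finset.mem_filter, Finset.mem_erase]
  constructor
  · rintro ⟨hy, h⟩
    refine ⟨⟨?_, hy⟩, hi.trans h⟩
    rintro rfl
    exact lt_irrefl _ h
  · rintro ⟨⟨hne, hy⟩, h⟩
    have h1 := hx.2 y hy hne
    rw [rad_of_pos h, rad_of_pos hi] at h1
    exact ⟨hy, h1⟩

theorem pos_of_ne_nearest {c : Finset (Star n κ)} {x y : Star n κ} (hx : IsNearest c x)
    (hy : y ∈ c) (hne : y ≠ x) : ∃ i, 0 < y.1 i :=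
  exists_pos_of_rad_pos ((rad_nonneg x).trans_lt (hx.2 y hy hne))

theorem sum_target_of_pos {T : Fin n → ℕ → Set.Icc (0 : ℝ) κ} {c : Finset (Star n κ)}
    {y : Star n κ} {i : Fin n} (hi : 0 < y.1 i) :
    ∑ j, target T c y j = T i (rank c (y.1 i) i) := by
  rw [Finset.sum_eq_single i, target_of_pos T c hi]
  · intro j _ hj
    exact target_of_eq_zero T c (Star.eq_zero_of_pos hi hj)
  · simp

theorem rad_move (T : Fin n → ℕ → Set.Icc (0 : ℝ) κ) (t : I) (c : Finset (Star n κ))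
    (y : Star n κ) : rad (move T t c y) = (1 - t) * rad y + t * ∑ i, target T c y i := by
  unfold rad
  rw [Finset.mul_sum, Finset.mul_sum, ← Finset.sum_add_distrib]
  exact Finset.sum_congr rfl fun i _ => move_apply T t c y i

/-- Only the nearest point can be sent to the centre: any other has rank below `p i`, hence a target
beyond `T i (p i) ≥ 0`. -/
theorem movable_of_mem_nearSet {T : Fin n → ℕ → Set.Icc (0 : ℝ) κ} {p : Fin n → ℕ}
    (hA : ∀ i r r', r < r' → r' ≤ p i → (T i r' : ℝ) < T i r)
    {c : UConf (Star n κ) J} (hc : c ∈ nearSet n κ J p)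
    (hC : center n κ ∈ c.1 → ∀ i, (T i (p i) : ℝ) = 0) :
    Movable T c.1 := by
  obtain ⟨⟨x, hx, hxp⟩, -⟩ := hc
  have hnear : ∀ y ∈ c.1, (∀ i, target T c.1 y i = 0) → y = x := by
    intro y hy h0
    by_contra hne
    obtain ⟨i, hi⟩ := pos_of_ne_nearest hx hy hne
    have h1 := h0 i
    rw [target_of_pos T _ hi] at h1
    have h2 := hA i _ _ (hxp i ▸ rank_lt_of_ne hx hy hne hi) le_rfl
    rw [h1] at h2
    exact absurd (T i (p i)).2.1 (not_le.2 h2)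
  refine ⟨fun i r r' h h' => hA i r r' h ?_, fun y hy z hz hy0 hz0 => ?_, fun h i => ?_⟩
  · rw [cnt_erase_add hx.1, hxp i] at h'
    split_ifs at h' <;> omega
  · rw [hnear y hy hy0, hnear z hz hz0]
  · obtain rfl := hx.unique (isNearest_center h)
    rw [cnt_erase_add hx.1, hxp i]
    simpa using hC h i

/-- The level `v` separates the target of the nearest point from all others. A strict inequality of
radii at both ends of a linear motion holds throughout. -/
theorem conf_mem_nearSet {T : Fin n → ℕ → Set.Icc (0 : ℝ) κ} {p : Fin n → ℕ} {v : ℝ} (hv : 0 ≤ v)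
    (hB : ∀ i r, r < p i → v < T i r) (hB' : ∀ i, (T i (p i) : ℝ) ≤ v)
    {c : UConf (Star n κ) J} (hc : c ∈ nearSet n κ J p)
    (H : Movable T c.1) (t : I) : H.conf t ∈ nearSet n κ J p := by
  obtain ⟨⟨x, hx, hxp⟩, hp⟩ := hc
  refine ⟨⟨move T t c.1 x, ⟨Finset.mem_image_of_mem _ hx.1, ?_⟩, fun i => ?_⟩, hp⟩
  · intro w hw hne
    obtain ⟨y, hy, rfl⟩ := Finset.mem_image.1 hw
    have hyx : y ≠ x := fun h => hne (by rw [h])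
    obtain ⟨i, hi⟩ := pos_of_ne_nearest hx hy hyx
    rw [rad_move, rad_move, sum_target_of_pos hi]
    have h1 : ∑ i, target T c.1 x i ≤ v := by
      by_cases hpos : ∃ j, 0 < x.1 j
      · obtain ⟨j, hj⟩ := hpos
        rw [sum_target_of_pos hj, rank_nearest hx hj, hxp]
        exact hB' j
      · push Not at hpos
        refine le_trans (le_of_eq (Finset.sum_eq_zero fun j _ => ?_)) hv
        exact target_of_eq_zero T _ (le_antisymm (hpos j) (x.nonneg j))
    have h2 := hB i _ (hxp i ▸ rank_lt_of_ne hx hy hyx hi)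
    have h3 := hx.2 y hy hyx
    rcases eq_or_lt_of_le t.2.1 with ht | ht
    · rw [← ht]
      linarith
    · have := mul_lt_mul_of_pos_left (h1.trans_lt h2) ht
      have := mul_le_mul_of_nonneg_left h3.le (sub_nonneg.2 t.2.2)
      linarith
  · have he : (H.conf t).1.erase (move T t c.1 x) = (c.1.erase x).image (move T t c.1) := by
      ext w
      simp only [Movable.conf, Finset.mem_erase, Finset.mem_image]
      constructor
      · rintro ⟨hne, y, hy, rfl⟩
        exact ⟨y, ⟨fun h => hne (by rw [h]), hy⟩, rfl⟩
      · rintro ⟨y, ⟨hne, hy⟩, rfl⟩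
        exact ⟨fun h => hne (H.injOn t hy hx.1 h), y, hy, rfl⟩
    rw [he, cnt_image_move t ((H.injOn t).mono (by simp)), hxp i]
    intro y hy hi
    rw [Finset.mem_erase] at hy
    rw [target_of_pos T _ hi]
    exact hv.trans_lt (hB i _ (hxp i ▸ rank_lt_of_ne hx hy.2 hy.1 hi))

variable {Y : Type*} [TopologicalSpace Y] {j : Y → UConf (Star n κ) J}

/-- The final configuration depends only on `T` and `q`, so the motion is a contraction. The
embedding `j` is the identity for the configuration space and the inclusion for the spine. -/
theorem isSimplyConnected_of_subset_legSet (hj : Topology.IsEmbedding j) {S : Set Y}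
    (hne : S.Nonempty) {T : Fin n → ℕ → Set.Icc (0 : ℝ) κ} {q : Fin n → ℕ}
    (hA : ∀ i r r', r < r' → r' < q i → (T i r' : ℝ) < T i r)
    (hB : ∀ i r, r < q i → 0 < (T i r : ℝ)) (hS : ∀ y ∈ S, j y ∈ legSet n κ J q)
    (hstay : ∀ y ∈ S, ∀ (H : Movable T (j y).1) (t : I), ∃ y' ∈ S, j y' = H.conf t) :
    IsSimplyConnected S := by
  have hmov : ∀ y ∈ S, Movable T (j y).1 := fun y hy => movable_of_mem_legSet hA hB (hS y hy)
  refine isSimplyConnected_of_motion hj hne T hmov (fun y hy t => ?_)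
    ((Finset.univ.sigma fun i => Finset.range (q i)).image fun a => pt a.1 (T a.1 a.2 : ℝ))
    (fun y hy z hz => ?_) ?_
  · obtain ⟨y', hy', h⟩ := hstay y hy (hmov y hy) t
    exact ⟨y', hy', congrArg Subtype.val h⟩
  · have hzc : z ≠ center n κ := fun h => center_notMem_of_mem_legSet (hS y hy) (h ▸ hz)
    obtain ⟨i, hi⟩ : ∃ i, 0 < z.1 i := by
      by_contra hcon
      push Not at hcon
      exact hzc (Star.eq_center fun i => not_lt.2 (hcon i))
    refine Finset.mem_image.2 ⟨⟨i, rank (j y).1 (z.1 i) i⟩, ?_, ?_⟩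
    · simpa using (hS y hy).1 i ▸ rank_lt_cnt hz hi
    · refine Star.ext fun l => ?_
      rw [move_one_apply]
      by_cases hl : l = i
      · subst hl
        rw [pt_same _ (T _ _).2.1 (T _ _).2.2, target_of_pos T _ hi]
      · rw [pt_ne hl, target_of_eq_zero T _ (Star.eq_zero_of_pos hi hl)]
  · refine Finset.card_image_le.trans ?_
    obtain ⟨y, hy⟩ := hne
    rw [Finset.card_sigma]
    simp [(hS y hy).2]

theorem isSimplyConnected_of_subset_nearSet (hj : Topology.IsEmbedding j) {S : Set Y}
    (hne : S.Nonempty) {T : Fin n → ℕ → Set.Icc (0 : ℝ) κ} {p : Fin n → ℕ}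
    (hA : ∀ i r r', r < r' → r' ≤ p i → (T i r' : ℝ) < T i r)
    (h0 : ∀ i, (T i (p i) : ℝ) = 0) (hS : ∀ y ∈ S, j y ∈ nearSet n κ J p)
    (hstay : ∀ y ∈ S, ∀ (H : Movable T (j y).1) (t : I), ∃ y' ∈ S, j y' = H.conf t) :
    IsSimplyConnected S := by
  have hmov : ∀ y ∈ S, Movable T (j y).1 := fun y hy =>
    movable_of_mem_nearSet hA (hS y hy) fun _ => h0
  refine isSimplyConnected_of_motion hj hne T hmov (fun y hy t => ?_)
    (insert (center n κ)
      ((Finset.univ.sigma fun i => Finset.range (p i)).image fun a => pt a.1 (T a.1 a.2 : ℝ)))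
    (fun y hy z hz => ?_) ?_
  · obtain ⟨y', hy', h⟩ := hstay y hy (hmov y hy) t
    exact ⟨y', hy', congrArg Subtype.val h⟩
  · obtain ⟨⟨x, hx, hxp⟩, -⟩ := hS y hy
    rw [Finset.mem_insert]
    by_cases hzx : z = x
    · left
      subst hzx
      refine Star.ext fun l => ?_
      rw [move_one_apply, center_apply]
      by_cases hl : 0 < z.1 l
      · rw [target_of_pos T _ hl, rank_nearest hx hl, hxp, h0]
      · exact if_neg hl
    · right
      obtain ⟨i, hi⟩ := pos_of_ne_nearest hx hz hzx
      refine Finset.mem_image.2 ⟨⟨i, rank (j y).1 (z.1 i) i⟩, ?_, ?_⟩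
      · simpa using hxp i ▸ rank_lt_of_ne hx hz hzx hi
      · refine Star.ext fun l => ?_
        rw [move_one_apply]
        by_cases hl : l = i
        · subst hl
          rw [pt_same _ (T _ _).2.1 (T _ _).2.2, target_of_pos T _ hi]
        · rw [pt_ne hl, target_of_eq_zero T _ (Star.eq_zero_of_pos hi hl)]
  · refine (Finset.card_insert_le _ _).trans ?_
    obtain ⟨y, hy⟩ := hne
    rw [← (hS y hy).2]
    refine Nat.succ_le_succ (Finset.card_image_le.trans ?_)
    rw [Finset.card_sigma]
    simp

end Stay


/-! ### Standard configurations -/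

section Standard

open scoped Classical unitInterval

variable {n : ℕ} {κ : ℝ≥0} {K : ℕ}

/-- `1` on the governing leg and `-1` on the others. -/
noncomputable def sgn (m i : Fin n) : ℝ := if i = m then 1 else -1

theorem sgn_self (m : Fin n) : sgn m m = 1 := if_pos rfl

theorem sgn_ne {m i : Fin n} (h : i ≠ m) : sgn m i = -1 := if_neg h

theorem abs_sgn_mul {m i : Fin n} {t : ℝ} (h0 : 0 ≤ t) : -t ≤ sgn m i * t ∧ sgn m i * t ≤ t := by
  unfold sgn
  split_ifs <;> constructor <;> linarith

/-- The labels of the points of a standard configuration. -/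
abbrev Slot (p : Fin n → ℕ) : Type := Option (Σ i, Fin (p i))

/-- The points of a standard configuration: the nearest point lies on the leg `m` at distance `t`
from the centre; the others on the leg `m` are at distances `1 + t, …, p m + t`, and those on
another leg `i` at distances `1 - t, …, p i - t`. -/
noncomputable def slotPt (κ : ℝ≥0) (p : Fin n → ℕ) (m : Fin n) (t : ℝ) : Slot p → Star n κ
  | none => pt m t
  | some ⟨i, j⟩ => pt i (j + 1 + sgn m i * t)

/-- Admissible parameters of standard configurations with `K + 1` points. -/
structure Adm (K : ℕ) (p : Fin n → ℕ) (m : Fin n) (t : ℝ) : Prop where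
  sum : ∑ i, p i = K
  nonneg : 0 ≤ t
  le_half : t ≤ 1 / 2
  two : t = 0 ∨ ∃ i, i ≠ m ∧ p i ≠ 0

variable {p : Fin n → ℕ} {m : Fin n} {t : ℝ}

theorem Adm.le_sum (h : Adm K p m t) (i : Fin n) : p i ≤ K := by
  rw [← h.sum]
  exact Finset.single_le_sum (fun _ _ => Nat.zero_le _) (Finset.mem_univ i)

/-- Here `K ≤ κ` provides the room on the legs. On the governing leg the outermost point is at `p m
+ t`; if `t > 0`, the second arm uses up a point, so `p m ≤ K - 1`. -/
theorem Adm.add_le (h : Adm K p m t) (hκ : (K : ℝ≥0) ≤ κ) (i : Fin n) :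
    (p i : ℝ) + sgn m i * t ≤ κ := by
  have hK : (K : ℝ) ≤ κ := by exact_mod_cast hκ
  have h1 : (p i : ℝ) ≤ K := by exact_mod_cast h.le_sum i
  have h2 := h.le_half
  have h3 := h.nonneg
  by_cases him : i = m
  · subst him
    rw [sgn_self]
    rcases h.two with h0 | ⟨i', hi', h0⟩
    · rw [h0]
      linarith
    · have : p i + p i' ≤ K := by
        rw [← h.sum, ← Finset.sum_pair hi'.symm]
        exact Finset.sum_le_sum_of_subset (Finset.subset_univ _)
      have h4 : p i + 1 ≤ K := by omega
      have h5 : (p i : ℝ) + 1 ≤ K := by exact_mod_cast h4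
      linarith
  · rw [sgn_ne him]
    linarith

theorem Adm.le (h : Adm K p m t) (hκ : (K : ℝ≥0) ≤ κ) : t ≤ κ := by
  have h1 := h.add_le hκ m
  rw [sgn_self] at h1
  have : (0 : ℝ) ≤ p m := Nat.cast_nonneg _
  linarith

theorem Adm.slot_pos (h : Adm K p m t) (i : Fin n) (j : ℕ) : 0 < (j : ℝ) + 1 + sgn m i * t := by
  have h1 := (abs_sgn_mul (m := m) (i := i) h.nonneg).1
  have h2 := h.le_half
  have : (0 : ℝ) ≤ j := Nat.cast_nonneg _
  linarith

theorem Adm.slot_le (h : Adm K p m t) (hκ : (K : ℝ≥0) ≤ κ) (i : Fin n) {j : ℕ} (hj : j < p i) :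
    (j : ℝ) + 1 + sgn m i * t ≤ κ := by
  have h1 := h.add_le hκ i
  have : (j : ℝ) + 1 ≤ p i := by exact_mod_cast hj
  linarith

theorem Adm.slotPt_same (h : Adm K p m t) (hκ : (K : ℝ≥0) ≤ κ) {i : Fin n} (j : Fin (p i)) :
    (slotPt κ p m t (some ⟨i, j⟩)).1 i = j + 1 + sgn m i * t :=
  pt_same i (h.slot_pos i j).le (h.slot_le hκ i j.2)

theorem slotPt_ne {i l : Fin n} (hl : l ≠ i) (j : Fin (p i)) :
    (slotPt κ p m t (some ⟨i, j⟩)).1 l = 0 := pt_ne hl _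

theorem Adm.slotPt_none (h : Adm K p m t) (hκ : (K : ℝ≥0) ≤ κ) :
    (slotPt κ p m t none).1 m = t := pt_same m h.nonneg (h.le hκ)

theorem slotPt_none_ne {l : Fin n} (hl : l ≠ m) : (slotPt κ p m t none).1 l = 0 := pt_ne hl _

theorem Adm.rad_none (h : Adm K p m t) (hκ : (K : ℝ≥0) ≤ κ) : rad (slotPt κ p m t none) = t :=
  rad_pt m h.nonneg (h.le hκ)

theorem Adm.rad_some (h : Adm K p m t) (hκ : (K : ℝ≥0) ≤ κ) {i : Fin n} (j : Fin (p i)) :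
    rad (slotPt κ p m t (some ⟨i, j⟩)) = j + 1 + sgn m i * t :=
  rad_pt i (h.slot_pos i j).le (h.slot_le hκ i j.2)

theorem Adm.slotPt_injective (h : Adm K p m t) (hκ : (K : ℝ≥0) ≤ κ) :
    Function.Injective (slotPt κ p m t) := by
  have key : ∀ (i : Fin n) (j : Fin (p i)),
      slotPt κ p m t none ≠ slotPt κ p m t (some ⟨i, j⟩) := by
    intro i j he
    have h1 := h.slotPt_same hκ j
    rw [← he] at h1
    have h2 := h.slot_pos i j
    by_cases him : i = m
    · subst him
      rw [h.slotPt_none hκ, sgn_self] at h1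
      have : (0 : ℝ) ≤ j := Nat.cast_nonneg _
      linarith
    · rw [slotPt_none_ne him] at h1
      linarith
  rintro (_ | ⟨i, j⟩) (_ | ⟨i', j'⟩) he
  · rfl
  · exact absurd he (key _ _)
  · exact absurd he.symm (key _ _)
  · have hi : i = i' := by
      by_contra hne
      have h1 := h.slotPt_same hκ j
      rw [he, slotPt_ne hne] at h1
      exact (h.slot_pos i j).ne h1
    subst hi
    have h1 := h.slotPt_same hκ j
    rw [he, h.slotPt_same hκ j'] at h1
    have h2 : (j' : ℝ) = j := by linarith
    have h3 : j' = j := Fin.ext (by exact_mod_cast h2)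
    rw [h3]

theorem card_slot (p : Fin n → ℕ) : Fintype.card (Slot p) = ∑ i, p i + 1 := by
  simp [Fintype.card_option, Fintype.card_sigma]

/-- The standard configuration. -/
noncomputable def Adm.conf (h : Adm K p m t) (hκ : (K : ℝ≥0) ≤ κ) : UConf (Star n κ) (K + 1) :=
  ⟨Finset.univ.map ⟨slotPt κ p m t, h.slotPt_injective hκ⟩, by
    rw [Finset.card_map, Finset.card_univ, card_slot, h.sum]⟩

theorem Adm.mem_conf (h : Adm K p m t) (hκ : (K : ℝ≥0) ≤ κ) {z : Star n κ} :
    z ∈ (h.conf hκ).1 ↔ ∃ s, slotPt κ p m t s = z := by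
  simp [Adm.conf]

/-- A configuration whose points are all in a standard configuration is equal to it. -/
theorem Adm.eq_conf (h : Adm K p m t) (hκ : (K : ℝ≥0) ≤ κ) {c : UConf (Star n κ) (K + 1)}
    (hc : ∀ z ∈ c.1, ∃ s, slotPt κ p m t s = z) : c = h.conf hκ := by
  refine Subtype.ext (Finset.eq_of_subset_of_card_le (fun z hz => ?_) ?_)
  · exact (h.mem_conf hκ).2 (hc z hz)
  · rw [c.2, (h.conf hκ).2]

theorem Adm.card_filter_conf (h : Adm K p m t) (hκ : (K : ℝ≥0) ≤ κ) (P : Star n κ → Prop)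
    [DecidablePred P] : ((h.conf hκ).1.filter P).card =
      (Finset.univ.filter fun s => P (slotPt κ p m t s)).card := by
  simp only [Adm.conf, Finset.filter_map, Finset.card_map]
  rfl

/-- The count common to the ranks and the leg numbers of standard configurations: the slots `r, …, p
i - 1` of one leg. -/
theorem card_filter_slot (i : Fin n) (P : Slot p → Prop) [DecidablePred P] (r : ℕ) (h0 : ¬ P none)
    (h : ∀ l (j : Fin (p l)), P (some ⟨l, j⟩) ↔ l = i ∧ r ≤ j) :
    (Finset.univ.filter P).card = p i - r := by
  have : Finset.univ.filter P = (Finset.univ.filter fun j : Fin (p i) => r ≤ (j : ℕ)).image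
      fun j => (some ⟨i, j⟩ : Slot p) := by
    ext s
    rcases s with _ | ⟨l, j⟩
    · simp [h0]
    · simp only [Finset.mem_filter, Finset.mem_univ, true_and, Finset.mem_image, h,
        Option.some.injEq]
      constructor
      · rintro ⟨rfl, hj⟩
        exact ⟨j, hj, rfl⟩
      · rintro ⟨j', hj', he⟩
        cases he
        exact ⟨rfl, hj'⟩
  rw [this, Finset.card_image_of_injective]
  · rw [← Finset.card_map Fin.valEmbedding, ← Nat.card_Ico]
    congr 1
    ext j
    simp only [Finset.mem_map, Finset.mem_filter, Finset.mem_univ, true_and, Finset.mem_Ico]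
    exact ⟨fun ⟨j', h1, h2⟩ => h2 ▸ ⟨h1, j'.2⟩, fun h1 => ⟨⟨j, h1.2⟩, h1.1, rfl⟩⟩
  · intro j j' he
    simpa using he

theorem Adm.rank_some (h : Adm K p m t) (hκ : (K : ℝ≥0) ≤ κ) {i : Fin n} (j : Fin (p i)) :
    rank (h.conf hκ).1 ((slotPt κ p m t (some ⟨i, j⟩)).1 i) i = p i - (j + 1) := by
  unfold rank
  rw [h.card_filter_conf hκ]
  refine card_filter_slot i _ _ ?_ fun l j' => ?_
  · rw [h.slotPt_same hκ, not_lt]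
    by_cases him : i = m
    · subst him
      rw [h.slotPt_none hκ, sgn_self]
      have : (0 : ℝ) ≤ j := Nat.cast_nonneg _
      linarith
    · rw [slotPt_none_ne him]
      exact (h.slot_pos i j).le
  · by_cases hl : i = l
    · subst hl
      rw [h.slotPt_same hκ, h.slotPt_same hκ, add_lt_add_iff_right, add_lt_add_iff_right,
        Nat.cast_lt]
      simp
    · rw [h.slotPt_same hκ, slotPt_ne hl]
      simp [(h.slot_pos i j).le, Ne.symm hl]

theorem Adm.rank_none (h : Adm K p m t) (hκ : (K : ℝ≥0) ≤ κ) :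
    rank (h.conf hκ).1 ((slotPt κ p m t none).1 m) m = p m := by
  unfold rank
  rw [h.card_filter_conf hκ]
  refine card_filter_slot (r := 0) m _ (lt_irrefl _) fun l j' => ?_
  rw [h.slotPt_none hκ]
  by_cases hl : m = l
  · subst hl
    rw [h.slotPt_same hκ, sgn_self]
    have : (0 : ℝ) ≤ j' := Nat.cast_nonneg _
    simp
    linarith
  · rw [slotPt_ne hl]
    simp [h.nonneg, Ne.symm hl]

theorem Adm.none_mem (h : Adm K p m t) (hκ : (K : ℝ≥0) ≤ κ) :
    slotPt κ p m t none ∈ (h.conf hκ).1 := (h.mem_conf hκ).2 ⟨_, rfl⟩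

theorem Adm.cnt_erase (h : Adm K p m t) (hκ : (K : ℝ≥0) ≤ κ) (i : Fin n) :
    cnt ((h.conf hκ).1.erase (slotPt κ p m t none)) i = p i := by
  have := h.card_filter_conf hκ fun z => z ≠ slotPt κ p m t none ∧ 0 < z.1 i
  unfold cnt
  rw [← Finset.filter_ne', Finset.filter_filter, this]
  refine card_filter_slot (r := 0) i
    (fun s => slotPt κ p m t s ≠ slotPt κ p m t none ∧ 0 < (slotPt κ p m t s).1 i)
    (fun h' => h'.1 rfl) fun l j => ?_
  have h1 : slotPt κ p m t (some ⟨l, j⟩) ≠ slotPt κ p m t none := fun he => by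
    simpa using h.slotPt_injective hκ he
  by_cases hl : i = l
  · subst hl
    rw [h.slotPt_same hκ]
    simp [h1, h.slot_pos i j]
  · rw [slotPt_ne hl]
    simp [Ne.symm hl]

/-- Every slot other than `none` has radius at least `1 - t`, which exceeds `t` for `t < 1 / 2`. -/
theorem Adm.conf_mem_nearSet (h : Adm K p m t) (hκ : (K : ℝ≥0) ≤ κ) (ht : t < 1 / 2) :
    h.conf hκ ∈ nearSet n κ (K + 1) p := by
  refine ⟨⟨_, ⟨h.none_mem hκ, ?_⟩, h.cnt_erase hκ⟩, by rw [h.sum]⟩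
  intro y hy hne
  obtain ⟨_ | ⟨i, j⟩, rfl⟩ := (h.mem_conf hκ).1 hy
  · exact absurd rfl hne
  · rw [h.rad_none hκ, h.rad_some hκ]
    have h1 := (abs_sgn_mul (m := m) (i := i) h.nonneg).1
    have : (0 : ℝ) ≤ j := Nat.cast_nonneg _
    linarith

theorem Adm.conf_mem_legSet (h : Adm K p m t) (hκ : (K : ℝ≥0) ≤ κ) (ht : 0 < t) :
    h.conf hκ ∈ legSet n κ (K + 1) (p + Pi.single m 1) := by
  refine ⟨fun i => ?_, by rw [sum_add_single, h.sum]⟩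
  rw [cnt_erase_add (h.none_mem hκ), h.cnt_erase hκ]
  by_cases hi : i = m
  · subst hi
    rw [h.slotPt_none hκ]
    simp [ht]
  · rw [slotPt_none_ne hi]
    simp [hi]

theorem Adm.center_mem_iff (h : Adm K p m t) (hκ : (K : ℝ≥0) ≤ κ) :
    center n κ ∈ (h.conf hκ).1 ↔ t = 0 := by
  constructor
  · intro hc
    by_contra hne
    exact center_notMem_of_mem_legSet (h.conf_mem_legSet hκ (lt_of_le_of_ne h.nonneg (Ne.symm
        hne))) hc
  · rintro rfl
    exact (h.mem_conf hκ).2 ⟨none, pt_zero m⟩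

/-- Motions to standard targets carry standard configurations to standard configurations. -/
theorem Adm.conf_move {s s₁ : ℝ} (h : Adm K p m s) (hκ : (K : ℝ≥0) ≤ κ)
    {T : Fin n → ℕ → Set.Icc (0 : ℝ) κ}
    (hT : ∀ i r, r < p i → (T i r : ℝ) = p i - r + sgn m i * s₁) (hTm : (T m (p m) : ℝ) = s₁)
    (h0 : s = 0 → s₁ = 0) (H : Movable T (h.conf hκ).1) (t : I)
    (h' : Adm K p m ((1 - t) * s + t * s₁)) : H.conf t = h'.conf hκ := by
  refine h'.eq_conf hκ fun z hz => ?_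
  obtain ⟨y, hy, rfl⟩ := Finset.mem_image.1 hz
  obtain ⟨a, rfl⟩ := (h.mem_conf hκ).1 hy
  refine ⟨a, Star.ext fun l => ?_⟩
  rw [move_apply]
  rcases a with _ | ⟨i, j⟩
  · by_cases hl : l = m
    · subst hl
      rw [h'.slotPt_none hκ]
      -- A point at the centre stays there whatever `T` is, so `s = 0` requires `s₁ = 0`.
      rcases eq_or_lt_of_le h.nonneg with hs | hs
      · rw [target_of_eq_zero T _ (by rw [h.slotPt_none hκ, ← hs]), h.slotPt_none hκ, h0 hs.symm]
      · rw [target_of_pos T _ (by rw [h.slotPt_none hκ]; exact hs), h.rank_none hκ, hTm,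
          h.slotPt_none hκ]
    · rw [slotPt_none_ne hl, target_of_eq_zero T _ (slotPt_none_ne hl), slotPt_none_ne hl]
      ring
  · by_cases hl : l = i
    · subst hl
      have hj : p l - (j + 1) < p l := by have := j.2; omega
      rw [target_of_pos T _ (by rw [h.slotPt_same hκ]; exact h.slot_pos l j), h.rank_some hκ,
        hT l _ hj, h.slotPt_same hκ, h'.slotPt_same hκ, Nat.cast_sub j.2]
      push_cast
      ring
    · rw [slotPt_ne hl, target_of_eq_zero T _ (slotPt_ne hl j), slotPt_ne hl]
      ring

end Standard


/-! ### The graph cover of the configuration space -/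

section ConfCover

open scoped Classical unitInterval

variable {n : ℕ} {κ : ℝ≥0} {J : ℕ}

/-- Equally spaced targets, `κ / J` apart; the first `g i` of them on the `i`-th leg are positive.
-/
noncomputable def linTarget (κ : ℝ≥0) (J : ℕ) (g : Fin n → ℝ) (i : Fin n) (r : ℕ) :
    Set.Icc (0 : ℝ) κ :=
  Set.projIcc (0 : ℝ) (κ : ℝ) κ.coe_nonneg ((g i - r) * ((κ : ℝ) / J))

theorem linTarget_apply {g : Fin n → ℝ} {i : Fin n} {r : ℕ} (h0 : (r : ℝ) ≤ g i)
    (h1 : g i ≤ J) : (linTarget κ J g i r : ℝ) = (g i - r) * ((κ : ℝ) / J) := by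
  have hr : (0 : ℝ) ≤ r := Nat.cast_nonneg _
  have hJ : (0 : ℝ) ≤ J := Nat.cast_nonneg _
  have hk : (0 : ℝ) ≤ (κ : ℝ) / J := div_nonneg κ.coe_nonneg hJ
  have hmem : (g i - r) * ((κ : ℝ) / J) ∈ Set.Icc (0 : ℝ) κ := by
    refine ⟨mul_nonneg (by linarith) hk, ?_⟩
    calc (g i - r) * ((κ : ℝ) / J) ≤ J * ((κ : ℝ) / J) :=
          mul_le_mul_of_nonneg_right (by linarith) hk
      _ ≤ κ := by
        rcases eq_or_lt_of_le hJ with h | h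
        · rw [← h]
          simp
        · rw [mul_div_cancel₀ _ h.ne']
  rw [linTarget, Set.projIcc_of_mem κ.coe_nonneg hmem]

theorem linTarget_eq_zero {g : Fin n → ℝ} {i : Fin n} {r : ℕ} (h : g i ≤ r) :
    (linTarget κ J g i r : ℝ) = 0 := by
  rw [linTarget, Set.projIcc_of_le_left]
  exact mul_nonpos_of_nonpos_of_nonneg (by linarith)
    (div_nonneg κ.coe_nonneg (Nat.cast_nonneg _))

theorem linTarget_lt (hκ : 0 < κ) {g : Fin n → ℝ} {i : Fin n} {r r' : ℕ} (h : r < r')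
    (h0 : (r' : ℝ) ≤ g i) (h1 : g i ≤ J) :
    (linTarget κ J g i r' : ℝ) < linTarget κ J g i r := by
  have hr : (r : ℝ) < r' := by exact_mod_cast h
  have hJ : (0 : ℝ) < J := by
    have : (0 : ℝ) ≤ r := Nat.cast_nonneg _
    linarith
  rw [linTarget_apply h0 h1, linTarget_apply (hr.le.trans h0) h1]
  exact mul_lt_mul_of_pos_right (by linarith) (div_pos (by exact_mod_cast hκ) hJ)

theorem linTarget_pos (hκ : 0 < κ) {g : Fin n → ℝ} {i : Fin n} {r : ℕ}
    (h0 : (r : ℝ) < g i) (h1 : g i ≤ J) : 0 < (linTarget κ J g i r : ℝ) := by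
  have hr : (0 : ℝ) ≤ r := Nat.cast_nonneg _
  rw [linTarget_apply h0.le h1]
  exact mul_pos (by linarith) (div_pos (by exact_mod_cast hκ) (by linarith))

theorem le_of_mem_legSet {c : UConf (Star n κ) J} {q : Fin n → ℕ} (hc : c ∈ legSet n κ J q)
    (i : Fin n) : q i ≤ J :=
  hc.2 ▸ Finset.single_le_sum (fun _ _ => Nat.zero_le _) (Finset.mem_univ i)

theorem le_of_mem_nearSet {c : UConf (Star n κ) J} {p : Fin n → ℕ} (hc : c ∈ nearSet n κ J p)
    (i : Fin n) : p i ≤ J := by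
  have h1 : p i ≤ ∑ i, p i := Finset.single_le_sum (fun _ _ => Nat.zero_le _) (Finset.mem_univ i)
  have := hc.2
  omega

theorem isSimplyConnected_legSet (hκ : 0 < κ) {q : Fin n → ℕ} (hne : (legSet n κ J q).Nonempty) :
    IsSimplyConnected (legSet n κ J q) := by
  have hle : ∀ i, (q i : ℝ) ≤ J := fun i => by exact_mod_cast le_of_mem_legSet hne.some_mem i
  have hB : ∀ i r, r < q i → 0 < (linTarget κ J (fun i => (q i : ℝ)) i r : ℝ) := fun i r h =>
    linTarget_pos hκ (by exact_mod_cast h) (hle i)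
  refine isSimplyConnected_of_subset_legSet (j := id) Topology.IsEmbedding.id hne
    (T := linTarget κ J fun i => (q i : ℝ)) (q := q) (fun i r r' h h' => ?_) hB
    (fun _ hy => hy) fun y hy H t => ⟨H.conf t, conf_mem_legSet hB hy H t, rfl⟩
  exact linTarget_lt hκ h (by exact_mod_cast h'.le) (hle i)

/-- The nearest point moves to the centre and the others on leg `i` to the distances `κ / J, …, p i
* (κ / J)`. -/
theorem isSimplyConnected_nearSet (hκ : 0 < κ) {p : Fin n → ℕ}
    (hne : (nearSet n κ J p).Nonempty) : IsSimplyConnected (nearSet n κ J p) := by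
  have hle : ∀ i, (p i : ℝ) ≤ J := fun i => by exact_mod_cast le_of_mem_nearSet hne.some_mem i
  have h0 : ∀ i, (linTarget κ J (fun i => (p i : ℝ)) i (p i) : ℝ) = 0 := fun i =>
    linTarget_eq_zero le_rfl
  have hB : ∀ i r, r < p i → 0 < (linTarget κ J (fun i => (p i : ℝ)) i r : ℝ) := fun i r h =>
    linTarget_pos hκ (by exact_mod_cast h) (hle i)
  refine isSimplyConnected_of_subset_nearSet (j := id) Topology.IsEmbedding.id hne
    (T := linTarget κ J fun i => (p i : ℝ)) (p := p) (fun i r r' h h' => ?_) h0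
    (fun _ hy => hy) fun y hy H t => ⟨H.conf t, ?_, rfl⟩
  · exact linTarget_lt hκ h (by exact_mod_cast h') (hle i)
  · exact conf_mem_nearSet le_rfl hB (fun i => (h0 i).le) hy H t

theorem isPathConnected_nearSet_inter_legSet (hκ : 0 < κ) {p q : Fin n → ℕ}
    (hne : (nearSet n κ J p ∩ legSet n κ J q).Nonempty) :
    IsPathConnected (nearSet n κ J p ∩ legSet n κ J q) := by
  obtain ⟨m, rfl⟩ := exists_add_single hne.some_mem.1 hne.some_mem.2
  have hle : ∀ i, (((p + Pi.single m 1 : Fin n → ℕ) i : ℕ) : ℝ) ≤ J := fun i => by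
    exact_mod_cast le_of_mem_legSet hne.some_mem.2 i
  have hJ : (0 : ℝ) < J := by
    have := hne.some_mem.1.2
    exact_mod_cast (by omega : 0 < J)
  have hk : (0 : ℝ) < (κ : ℝ) / J := div_pos (by exact_mod_cast hκ) hJ
  -- The half step sends the nearest point to distance `κ / (2 J)` on leg `m`: off the centre, yet
  -- closer than every other target. The level `v` is this distance.
  set g : Fin n → ℝ := fun i => p i + if i = m then 1 / 2 else 0 with hg
  have hgm : g m = p m + 1 / 2 := by simp [hg]
  have hgi : ∀ i, i ≠ m → g i = p i := fun i hi => by simp [hg, hi]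
  have hgJ : ∀ i, g i ≤ J := by
    intro i
    have := hle i
    by_cases hi : i = m
    · subst hi
      rw [hgm]
      simp at this
      linarith
    · rw [hgi i hi]
      simpa [hi] using this
  have hgr : ∀ i r, r < (p + Pi.single m 1 : Fin n → ℕ) i → (r : ℝ) < g i := by
    intro i r h
    by_cases hi : i = m
    · subst hi
      rw [hgm]
      have : r ≤ p i := by simpa [Nat.lt_succ_iff] using h
      have : (r : ℝ) ≤ p i := by exact_mod_cast this
      linarith
    · rw [hgi i hi]
      simp [hi] at h
      exact_mod_cast h
  have hB : ∀ i r, r < (p + Pi.single m 1 : Fin n → ℕ) i → 0 < (linTarget κ J g i r : ℝ) :=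
    fun i r h => linTarget_pos hκ (hgr i r h) (hgJ i)
  have hpg : ∀ i, (p i : ℝ) ≤ g i := fun i => by
    by_cases hi : i = m
    · subst hi
      rw [hgm]
      linarith
    · rw [hgi i hi]
  have := isSimplyConnected_of_subset_legSet (j := id) Topology.IsEmbedding.id hne
    (T := linTarget κ J g) (fun i r r' h h' => linTarget_lt hκ h (hgr i r' h').le (hgJ i)) hB
    (fun _ hy => hy.2) fun y hy H t => ⟨H.conf t, ⟨conf_mem_nearSet (v := 1 / 2 * ((κ : ℝ) / J))
      (by positivity) (fun i r h => ?_) (fun i => ?_) hy.1 H t, conf_mem_legSet hB hy.2 H t⟩, rfl⟩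
  · exact this.isPathConnected
  · have h1 : (r : ℝ) + 1 ≤ p i := by exact_mod_cast h
    rw [linTarget_apply (by linarith [hpg i]) (hgJ i)]
    exact mul_lt_mul_of_pos_right (by linarith [hpg i]) hk
  · rw [linTarget_apply (hpg i) (hgJ i)]
    refine mul_le_mul_of_nonneg_right ?_ hk.le
    by_cases hi : i = m
    · subst hi
      rw [hgm]
      linarith
    · rw [hgi i hi]
      norm_num

theorem adm_zero {K : ℕ} {p : Fin n → ℕ} (hp : ∑ i, p i = K) (m : Fin n) : Adm K p m 0 :=
  ⟨hp, le_rfl, by norm_num, Or.inl rfl⟩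

theorem adm_quarter {K : ℕ} {p : Fin n → ℕ} (hp : ∑ i, p i = K) {m : Fin n}
    (h : ∃ i, i ≠ m ∧ p i ≠ 0) : Adm K p m (1 / 4) :=
  ⟨hp, by norm_num, by norm_num, Or.inr h⟩

/-- A vector with at least two nonzero entries is the sum of a unit vector and a vector with a
nonzero entry elsewhere. -/
theorem exists_eq_add_single {q : Fin n → ℕ} {i j : Fin n} (hij : i ≠ j) (hi : q i ≠ 0)
    (hj : q j ≠ 0) : ∃ p : Fin n → ℕ, q = p + Pi.single i 1 ∧ p j ≠ 0 := by
  refine ⟨q - Pi.single i 1, ?_, by simp [hij.symm, hj]⟩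
  refine (tsub_add_cancel_of_le ?_).symm
  intro l
  by_cases hl : l = i
  · subst hl
    simp
    omega
  · simp [hl]

/-- The leg sets and the nearest point sets form a graph cover of the configuration space. -/
theorem isGraphCover_conf {K : ℕ} (hK : (K : ℝ≥0) ≤ κ) (hκ : 0 < κ) (a : Fin n) :
    IsGraphCover a K (nearSet n κ (K + 1)) (legSet n κ (K + 1)) := by
  have hmeet : ∀ p m, ∑ i, p i = K → (∃ i, i ≠ m ∧ p i ≠ 0) →
      (nearSet n κ (K + 1) p ∩ legSet n κ (K + 1) (p + Pi.single m 1)).Nonempty := by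
    intro p m hp h
    have ha := adm_quarter hp h
    exact ⟨ha.conf hK, ha.conf_mem_nearSet hK (by norm_num), ha.conf_mem_legSet hK (by norm_num)⟩
  refine ⟨isOpen_nearSet, isOpen_legSet, fun x => ?_, fun p ⟨c, hc⟩ => ?_, fun x p p' =>
      nearSet_unique,
    fun x q q' => legSet_unique, fun x p q => exists_add_single, fun p hp => ?_,
    fun q hq => isSimplyConnected_legSet hκ hq,
    fun p q hne => isPathConnected_nearSet_inter_legSet hκ hne, hmeet, fun q hq => ?_⟩
  · by_cases h : center n κ ∈ x.1
    · exact Or.inl ⟨_, mem_nearSet_of_center_mem h⟩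
    · exact Or.inr ⟨_, mem_legSet_of_center_notMem h⟩
  · have := hc.2
    omega
  · have ha := adm_zero hp a
    exact isSimplyConnected_nearSet hκ ⟨ha.conf hK, ha.conf_mem_nearSet hK (by norm_num)⟩
  · obtain ⟨c, hc⟩ := hq
    obtain ⟨i, -, hi⟩ : ∃ i ∈ Finset.univ, q i ≠ 0 := by
      by_contra hcon
      push Not at hcon
      have := hc.2
      rw [Finset.sum_eq_zero hcon] at this
      omega
    by_cases h2 : ∃ j, i ≠ j ∧ q j ≠ 0
    · obtain ⟨j, hij, hj⟩ := h2
      obtain ⟨p, rfl, hpj⟩ := exists_eq_add_single hij hi hj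
      have hs := hc.2
      rw [sum_add_single] at hs
      exact ⟨p, hmeet p i (by omega) ⟨j, hij.symm, hpj⟩⟩
    -- All points lie on the leg `i`. The overlap contains no standard configuration, but on a
    -- single leg some point is always strictly nearest.
    · push Not at h2
      have hleg : ∀ y ∈ c.1, 0 < y.1 i := by
        intro y hy
        have hyc : y ≠ center n κ := fun h => center_notMem_of_mem_legSet hc (h ▸ hy)
        obtain ⟨l, hl⟩ : ∃ l, 0 < y.1 l := by
          by_contra hcon
          push Not at hcon
          exact hyc (Star.eq_center fun i => not_lt.2 (hcon i))
        by_cases hli : i = l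
        · rwa [hli]
        · have h3 := hc.1 l
          rw [h2 l hli] at h3
          have : y ∈ c.1.filter fun y => 0 < y.1 l := Finset.mem_filter.2 ⟨hy, hl⟩
          rw [Finset.card_eq_zero.1 h3] at this
          simp at this
      have hne : c.1.Nonempty := Finset.card_pos.1 (by rw [c.2]; omega)
      obtain ⟨x, hx, hmin⟩ := c.1.exists_min_image rad hne
      have hxn : IsNearest c.1 x := by
        refine ⟨hx, fun y hy hyx => lt_of_le_of_ne (hmin y hy) fun he => hyx ?_⟩
        rw [rad_of_pos (hleg x hx), rad_of_pos (hleg y hy)] at he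
        exact (Star.ext_of_pos (hleg x hx) he).symm
      refine ⟨fun l => cnt (c.1.erase x) l, c, ⟨⟨x, hxn, fun _ => rfl⟩, ?_⟩, hc⟩
      rw [sum_cnt, Finset.filter_true_of_mem, Finset.card_erase_of_mem hx, c.2]
      · rfl
      rintro y hy rfl
      exact center_notMem_of_mem_legSet hc (Finset.mem_of_mem_erase hy)

end ConfCover


/-! ### Regular configurations are the standard configurations -/

section Regular

open scoped Classical

variable {n : ℕ} {κ : ℝ≥0} {K : ℕ}

theorem abs_sub_add_abs_sub_eq_iff {a b c : ℝ} :
    |a - b| + |b - c| = |a - c| ↔ min a c ≤ b ∧ b ≤ max a c := by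
  rcases le_total a c with hac | hac
  · rw [min_eq_left hac, max_eq_right hac, abs_of_nonpos (sub_nonpos.2 hac)]
    constructor
    · intro h
      have h1 := le_abs_self (a - b)
      have h2 := neg_le_abs (a - b)
      have h3 := le_abs_self (b - c)
      have h4 := neg_le_abs (b - c)
      constructor <;> linarith
    · rintro ⟨h1, h2⟩
      rw [abs_of_nonpos (by linarith), abs_of_nonpos (by linarith)]
      ring
  · rw [min_eq_right hac, max_eq_left hac, abs_of_nonneg (sub_nonneg.2 hac)]
    constructor
    · intro h
      have h1 := le_abs_self (a - b)
      have h2 := neg_le_abs (a - b)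
      have h3 := le_abs_self (b - c)
      have h4 := neg_le_abs (b - c)
      constructor <;> linarith
    · rintro ⟨h1, h2⟩
      rw [abs_of_nonneg (by linarith), abs_of_nonneg (by linarith)]
      ring

/-- In the ℓ¹ metric, equality in the triangle inequality means equality in each coordinate. -/
theorem Star.mem_seg {x y z : Star n κ} :
    z ∈ seg x y ↔ ∀ l, min (x.1 l) (y.1 l) ≤ z.1 l ∧ z.1 l ≤ max (x.1 l) (y.1 l) := by
  rw [seg, Set.mem_ofPred_eq, Star.dist_eq, Star.dist_eq, Star.dist_eq, ← Finset.sum_add_distrib,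
    eq_comm, Finset.sum_eq_sum_iff_of_le fun l _ => abs_sub_le _ _ _]
  simp only [Finset.mem_univ, true_implies]
  exact forall_congr' fun l => eq_comm.trans abs_sub_add_abs_sub_eq_iff

theorem mem_arm {c : Set (Star n κ)} {i : Fin n} {z : Star n κ} :
    z ∈ arm c i ↔ z ∈ c ∧ ∀ j, j ≠ i → z.1 j = 0 := by
  rw [arm, Set.mem_inter_iff, mem_seg_leaf]

/-- The distance to the centre is attained at a nearest point. -/
theorem infDist_center {S : Set (Star n κ)} {x : Star n κ} (hx : x ∈ S)
    (h : ∀ y ∈ S, rad x ≤ rad y) : Metric.infDist (center n κ) S = rad x := by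
  refine le_antisymm ?_ ((Metric.le_infDist ⟨x, hx⟩).2 fun y hy => ?_)
  · rw [← dist_center]
    exact Metric.infDist_le_dist_of_mem hx
  · rw [dist_center]
    exact h y hy

theorem mul_sgn_le {m i : Fin n} {t : ℝ} (h0 : 0 ≤ t) (h1 : t ≤ 1 / 2) : t ≤ 1 + sgn m i * t := by
  have := (abs_sgn_mul (m := m) (i := i) h0).1
  linarith

/-- `z` is isometric, so betweenness of image points is betweenness of integers, and an interval of
integers has one element more than its length. -/
theorem IsUnitChain.of_image {X : Type*} [MetricSpace X] {z : ℤ → X} {a b : ℤ} {A : Set X}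
    (hA : A = z '' Set.Icc a b)
    (h : ∀ l ∈ Set.Icc a b, ∀ l' ∈ Set.Icc a b, dist (z l) (z l') = |(l : ℝ) - l'|) :
    IsUnitChain A := by
  have hinj : Set.InjOn z (Set.Icc a b) := by
    intro l hl l' hl' he
    have h1 := h l hl l' hl'
    rw [he, dist_self, eq_comm, abs_eq_zero, sub_eq_zero] at h1
    exact_mod_cast h1
  refine ⟨hA ▸ (Set.finite_Icc a b).image z, ?_⟩
  rw [hA]
  rintro _ ⟨l, hl, rfl⟩ _ ⟨l', hl', rfl⟩
  have hsub : (Finset.uIcc l l' : Set ℤ) ⊆ Set.Icc a b := by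
    rw [Finset.coe_uIcc]
    exact Set.uIcc_subset_Icc hl hl'
  have heq : z '' Set.Icc a b ∩ seg (z l) (z l') = z '' (Finset.uIcc l l' : Set ℤ) := by
    ext w
    constructor
    · rintro ⟨⟨j, hj, rfl⟩, hw⟩
      rw [seg, Set.mem_ofPred_eq, h l hl j hj, h j hj l' hl', h l hl l' hl',
        abs_sub_add_abs_sub_eq_iff] at hw
      refine ⟨j, ?_, rfl⟩
      rw [Finset.coe_uIcc, Set.uIcc, Set.mem_Icc]
      exact_mod_cast hw
    · rintro ⟨j, hj, rfl⟩
      refine ⟨⟨j, hsub hj, rfl⟩, ?_⟩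
      rw [seg, Set.mem_ofPred_eq, h l hl j (hsub hj), h j (hsub hj) l' hl', h l hl l' hl',
        abs_sub_add_abs_sub_eq_iff]
      rw [Finset.coe_uIcc, Set.uIcc, Set.mem_Icc] at hj
      exact_mod_cast hj
  rw [heq, (hinj.mono hsub).ncard_image, Set.ncard_coe_finset, Int.card_uIcc,
    h l hl l' hl', Nat.cast_add, Nat.cast_one, Nat.cast_natAbs, add_comm]
  push_cast
  rw [abs_sub_comm]

variable {p : Fin n → ℕ} {m : Fin n} {t : ℝ}

theorem Adm.le_rad (h : Adm K p m t) (hκ : (K : ℝ≥0) ≤ κ) (s : Slot p) :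
    t ≤ rad (slotPt κ p m t s) := by
  rcases s with _ | ⟨i, j⟩
  · rw [h.rad_none hκ]
  · rw [h.rad_some hκ]
    have := mul_sgn_le (m := m) (i := i) h.nonneg h.le_half
    have : (0 : ℝ) ≤ j := Nat.cast_nonneg _
    linarith

theorem Adm.mem_arm_some (h : Adm K p m t) (hκ : (K : ℝ≥0) ≤ κ) {i l : Fin n} {j : Fin (p l)} :
    slotPt κ p m t (some ⟨l, j⟩) ∈ arm (h.conf hκ).pts i ↔ l = i := by
  rw [mem_arm]
  constructor
  · intro h1
    by_contra hne
    have h2 := h1.2 l hne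
    rw [h.slotPt_same hκ] at h2
    exact (h.slot_pos l j).ne' h2
  · rintro rfl
    exact ⟨(h.mem_conf hκ).2 ⟨_, rfl⟩, fun j' hj' => slotPt_ne hj' j⟩

theorem Adm.none_mem_arm (h : Adm K p m t) (hκ : (K : ℝ≥0) ≤ κ) {i : Fin n} (hi : i = m ∨ t = 0) :
    slotPt κ p m t none ∈ arm (h.conf hκ).pts i := by
  refine mem_arm.2 ⟨h.none_mem hκ, fun j hj => ?_⟩
  by_cases hjm : j = m
  · rcases hi with rfl | rfl
    · exact absurd hjm hj
    · rw [hjm, h.slotPt_none hκ]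
  · exact slotPt_none_ne hjm

theorem Adm.height_eq (h : Adm K p m t) (hκ : (K : ℝ≥0) ≤ κ) :
    Metric.infDist (center n κ) (h.conf hκ).pts = t := by
  rw [infDist_center (S := (h.conf hκ).pts) (h.none_mem hκ), h.rad_none hκ]
  intro y hy
  obtain ⟨s, rfl⟩ := (h.mem_conf hκ).1 hy
  rw [h.rad_none hκ]
  exact h.le_rad hκ s

/-- Unfold the two legs to a line through the centre. The arms become the points `l + t` with `l` an
integer from `-p i` to `p m`: on leg `m` for `l ≥ 0`, and on leg `i` at distance `-l - t` for `l <
0`. -/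
theorem Adm.isUnitChain (h : Adm K p m t) (hκ : (K : ℝ≥0) ≤ κ) (i : Fin n) :
    IsUnitChain (arm (h.conf hκ).pts m ∪ arm (h.conf hκ).pts i) := by
  have hmκ := h.add_le hκ m
  rw [sgn_self] at hmκ
  have hpos : ∀ l : ℤ, 0 ≤ l → (0 : ℝ) ≤ (l : ℝ) + t := fun l hl => by
    have : (0 : ℝ) ≤ l := by exact_mod_cast hl
    linarith [h.nonneg]
  have hle : ∀ l : ℤ, l ≤ p m → (l : ℝ) + t ≤ κ := fun l hl => by
    have : (l : ℝ) ≤ p m := by exact_mod_cast hl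
    linarith
  by_cases hi : i = m
  · subst hi
    rw [Set.union_self]
    refine IsUnitChain.of_image (z := fun l : ℤ => pt i (l + t)) (a := 0) (b := p i) ?_ ?_
    · ext z
      constructor
      · intro hz
        obtain ⟨_ | ⟨l, j⟩, rfl⟩ := (h.mem_conf hκ).1 (mem_arm.1 hz).1
        · exact ⟨0, by simp, by simp [slotPt]⟩
        · obtain rfl := (h.mem_arm_some hκ).1 hz
          refine ⟨j + 1, ⟨by positivity, by exact_mod_cast j.2⟩, ?_⟩
          simp [slotPt, sgn_self]
      · rintro ⟨l, ⟨h0, h1⟩, rfl⟩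
        rcases eq_or_lt_of_le h0 with rfl | hl
        · simpa [slotPt] using h.none_mem_arm hκ (Or.inl rfl)
        · obtain ⟨j, rfl⟩ : ∃ j : ℕ, l = j + 1 := ⟨(l - 1).toNat, by omega⟩
          have := (h.mem_arm_some hκ (l := i) (j := ⟨j, by omega⟩)).2 rfl
          simpa [slotPt, sgn_self] using this
    · rintro l ⟨h0, h1⟩ l' ⟨h0', h1'⟩
      rw [dist_pt_same i (hpos l h0) (hle l h1) (hpos l' h0') (hle l' h1')]
      congr 1
      ring
  · have hiκ := h.add_le hκ i
    rw [sgn_ne hi] at hiκ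
    have hpos' : ∀ l : ℤ, ¬ 0 ≤ l → (0 : ℝ) < -(l : ℝ) - t := fun l hl => by
      have : (l : ℝ) ≤ -1 := by exact_mod_cast (by omega : l ≤ -1)
      linarith [h.le_half]
    have hle' : ∀ l : ℤ, -(p i : ℤ) ≤ l → -(l : ℝ) - t ≤ κ := fun l hl => by
      have : -(p i : ℝ) ≤ l := by exact_mod_cast hl
      linarith
    refine IsUnitChain.of_image
      (z := fun l : ℤ => if 0 ≤ l then pt m (l + t) else pt i (-l - t)) (a := -p i) (b := p m) ?_ ?_
    · ext z
      constructor
      · intro hz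
        have hzc : z ∈ (h.conf hκ).1 := by
          rcases hz with hz | hz
          · exact (mem_arm.1 hz).1
          · exact (mem_arm.1 hz).1
        obtain ⟨_ | ⟨l, j⟩, rfl⟩ := (h.mem_conf hκ).1 hzc
        · exact ⟨0, by simp, by simp [slotPt]⟩
        · rcases hz with hz | hz
          · obtain rfl := (h.mem_arm_some hκ).1 hz
            refine ⟨j + 1, ⟨by omega, by have := j.2; omega⟩, ?_⟩
            simp only
            rw [if_pos (by positivity)]
            simp [slotPt, sgn_self]
          · obtain rfl := (h.mem_arm_some hκ).1 hz
            refine ⟨-(j + 1), ⟨by have := j.2; omega, by omega⟩, ?_⟩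
            simp only
            rw [if_neg (by omega)]
            simp only [slotPt, sgn_ne hi]
            congr 1
            push_cast
            ring
      · rintro ⟨l, ⟨h0, h1⟩, rfl⟩
        simp only
        split_ifs with hl
        · left
          rcases eq_or_lt_of_le hl with rfl | hl
          · simpa [slotPt] using h.none_mem_arm hκ (Or.inl rfl)
          · obtain ⟨j, rfl⟩ : ∃ j : ℕ, l = j + 1 := ⟨(l - 1).toNat, by omega⟩
            have := (h.mem_arm_some hκ (l := m) (j := ⟨j, by omega⟩)).2 rfl
            simpa [slotPt, sgn_self] using this
        · right
          obtain ⟨j, rfl⟩ : ∃ j : ℕ, l = -(j + 1) := ⟨(-l - 1).toNat, by omega⟩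
          have := (h.mem_arm_some hκ (l := i) (j := ⟨j, by omega⟩)).2 rfl
          simp only [slotPt, sgn_ne hi] at this
          convert this using 2
          push_cast
          ring
    · rintro l ⟨h0, h1⟩ l' ⟨h0', h1'⟩
      split_ifs with hl hl' hl'
      · rw [dist_pt_same m (hpos l hl) (hle l h1) (hpos l' hl') (hle l' h1')]
        congr 1
        ring
      · rw [dist_pt_ne (Ne.symm hi) (hpos l hl) (hle l h1) (hpos' l' hl').le (hle' l' h0')]
        rw [abs_of_nonneg]
        · ring
        · have := hpos l hl
          have := hpos' l' hl'
          linarith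
      · rw [dist_pt_ne hi (hpos' l hl).le (hle' l h0) (hpos l' hl') (hle l' h1')]
        rw [abs_of_nonpos]
        · ring
        · have := hpos l' hl'
          have := hpos' l hl
          linarith
      · rw [dist_pt_same i (hpos' l hl).le (hle' l h0) (hpos' l' hl').le (hle' l' h0'),
          abs_sub_comm]
        congr 1
        ring

theorem Adm.isRegular (h : Adm K p m t) (hκ : (K : ℝ≥0) ≤ κ) [Nontrivial (Fin n)] :
    IsRegular (h.conf hκ).pts := by
  have hm := h.none_mem_arm hκ (Or.inl (rfl : m = m))
  refine ⟨⟨m, ⟨_, hm⟩, ?_, h.isUnitChain hκ⟩, ?_⟩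
  · rw [h.height_eq hκ, infDist_center hm, h.rad_none hκ]
    intro y hy
    obtain ⟨s, rfl⟩ := (h.mem_conf hκ).1 (mem_arm.1 hy).1
    rw [h.rad_none hκ]
    exact h.le_rad hκ s
  · rcases h.two with h0 | ⟨i, hi, hpi⟩
    · obtain ⟨i, hi⟩ := exists_ne m
      exact ⟨i, m, hi, ⟨_, h.none_mem_arm hκ (Or.inr h0)⟩, ⟨_, hm⟩⟩
    · exact ⟨i, m, hi, ⟨_, (h.mem_arm_some hκ (j := ⟨0, Nat.pos_of_ne_zero hpi⟩)).2 rfl⟩, ⟨_, hm⟩⟩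

end Regular


/-! ### From regular to standard configurations -/

section Standardize

open scoped Classical

variable {n : ℕ} {κ : ℝ≥0} {K : ℕ}

/-- The trace on two arms of the segment from the nearest point of a governing arm. -/
theorem arm_union_arm_inter_seg {c : Finset (Star n κ)} {m i : Fin n} {x y : Star n κ}
    (hx : x ∈ c) (hxm : ∀ l, l ≠ m → x.1 l = 0) (hmin : ∀ z ∈ c, x.1 m ≤ rad z)
    (hy : y ∈ c) (hyi : 0 < y.1 i) :
    (arm (c : Set (Star n κ)) m ∪ arm (c : Set (Star n κ)) i) ∩ seg x y =
      ((insert x ((c.erase x).filter fun z => 0 < z.1 i ∧ z.1 i ≤ y.1 i) :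
        Finset (Star n κ)) : Set (Star n κ)) := by
  have hyl : ∀ l, l ≠ i → y.1 l = 0 := fun l hl => Star.eq_zero_of_pos hyi hl
  have hxy : x.1 i ≤ y.1 i := by
    by_cases him : i = m
    · have := hmin y hy
      rwa [rad_of_pos hyi, ← him] at this
    · rw [hxm i him]
      exact hyi.le
  ext z
  rw [Set.mem_inter_iff, Star.mem_seg, Finset.coe_insert, Set.mem_insert_iff, Finset.mem_coe,
    Finset.mem_filter, Finset.mem_erase, Set.mem_union, mem_arm, mem_arm]
  constructor
  · rintro ⟨harm, hseg⟩
    by_cases hzx : z = x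
    · exact Or.inl hzx
    · have hz : z ∈ c := harm.elim (fun h => h.1) fun h => h.1
      have hzy : z.1 i ≤ y.1 i := (hseg i).2.trans_eq (max_eq_right hxy)
      refine Or.inr ⟨⟨hzx, hz⟩, ?_, hzy⟩
      by_contra h0
      have hzi : z.1 i = 0 := le_antisymm (not_lt.1 h0) (z.nonneg i)
      have hzm : ∀ l, l ≠ m → z.1 l = 0 := by
        intro l hl
        rcases harm with h | h
        · exact h.2 l hl
        · by_cases hli : l = i
          · rw [hli, hzi]
          · exact h.2 l hli
      have hle : x.1 m ≤ z.1 m := by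
        rw [← rad_eq hzm]
        exact hmin z hz
      refine hzx (Star.ext fun l => ?_)
      by_cases hl : l = m
      · subst hl
        refine le_antisymm ?_ hle
        by_cases hil : i = l
        · rw [← hil, hzi]
          exact x.nonneg i
        · refine (hseg l).2.trans_eq (max_eq_left ?_)
          rw [hyl l (Ne.symm hil)]
          exact x.nonneg l
      · rw [hzm l hl, hxm l hl]
  · rintro (rfl | ⟨⟨-, hz⟩, hzi, hzy⟩)
    · exact ⟨Or.inl ⟨hx, hxm⟩, fun l => ⟨min_le_left _ _, le_max_left _ _⟩⟩
    · refine ⟨Or.inr ⟨hz, fun l hl => Star.eq_zero_of_pos hzi hl⟩, fun l => ?_⟩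
      by_cases hl : l = i
      · subst hl
        refine ⟨(min_le_left _ _).trans ?_, hzy.trans (le_max_right _ _)⟩
        by_cases hlm : l = m
        · have := hmin z hz
          rwa [rad_of_pos hzi, ← hlm] at this
        · rw [hxm l hlm]
          exact hzi.le
      · rw [Star.eq_zero_of_pos hzi hl, hyl l hl]
        exact ⟨min_le_right _ _, le_max_right _ _⟩

/-- In a regular configuration, positions are determined by counting. -/
theorem eq_card_add_sgn {c : Finset (Star n κ)} {m i : Fin n} {x y : Star n κ}
    (hx : x ∈ c) (hxm : ∀ l, l ≠ m → x.1 l = 0) (hmin : ∀ z ∈ c, x.1 m ≤ rad z)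
    (hch : IsUnitChain (arm (c : Set (Star n κ)) m ∪ arm (c : Set (Star n κ)) i))
    (hy : y ∈ c) (hyi : 0 < y.1 i) :
    y.1 i = ((c.erase x).filter fun z => 0 < z.1 i ∧ z.1 i ≤ y.1 i).card + sgn m i * x.1 m := by
  have h1 := hch.2 x (Or.inl (mem_arm.2 ⟨hx, hxm⟩)) y
    (Or.inr (mem_arm.2 ⟨hy, fun l hl => Star.eq_zero_of_pos hyi hl⟩))
  rw [arm_union_arm_inter_seg hx hxm hmin hy hyi, Set.ncard_coe_finset,
    Finset.card_insert_of_notMem (by simp)] at h1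
  have hd : dist x y = y.1 i - sgn m i * x.1 m := by
    rw [Star.eq_pt hxm, Star.eq_pt_of_pos hyi]
    by_cases him : i = m
    · subst him
      have := hmin y hy
      rw [rad_of_pos hyi] at this
      rw [dist_pt_same i (x.nonneg i) (x.le i) (y.nonneg i) (y.le i), sgn_self,
        abs_of_nonpos (by linarith), pt_same i (x.nonneg i) (x.le i),
        pt_same i (y.nonneg i) (y.le i)]
      ring
    · rw [dist_pt_ne (Ne.symm him) (x.nonneg m) (x.le m) (y.nonneg i) (y.le i), sgn_ne him,
        pt_same m (x.nonneg m) (x.le m), pt_same i (y.nonneg i) (y.le i)]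
      ring
  rw [hd] at h1
  push_cast at h1
  linarith

/-- Every regular configuration is a standard configuration. -/
theorem exists_adm_of_isRegular (hκ : (K : ℝ≥0) ≤ κ) {c : UConf (Star n κ) (K + 1)}
    (hc : IsRegular c.pts) : ∃ p m t, ∃ h : Adm K p m t, c = h.conf hκ := by
  obtain ⟨⟨m, hne, hd, hch⟩, harms⟩ := hc
  have hS : (c.1.filter fun z => ∀ l, l ≠ m → z.1 l = 0).Nonempty := by
    obtain ⟨z, hz⟩ := hne
    exact ⟨z, Finset.mem_filter.2 (mem_arm.1 hz)⟩
  obtain ⟨x, hxS, hxmin⟩ := Finset.exists_min_image _ rad hS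
  obtain ⟨hx, hxm⟩ := Finset.mem_filter.1 hxS
  have hrad : rad x = x.1 m := rad_eq hxm
  have hmin : ∀ z ∈ c.1, x.1 m ≤ rad z := by
    intro z hz
    rw [infDist_center (S := arm c.pts m) (x := x) (mem_arm.2 ⟨hx, hxm⟩) fun y hy =>
      hxmin y (Finset.mem_filter.2 (mem_arm.1 hy)), hrad] at hd
    rw [hd, ← dist_center]
    exact Metric.infDist_le_dist_of_mem hz
  have hkey : ∀ i, ∀ y ∈ c.1, 0 < y.1 i → _ := fun i y hy hyi =>
    eq_card_add_sgn hx hxm hmin (hch i) hy hyi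
  have hcen : ∀ y ∈ c.1, y ≠ x → ∃ i, 0 < y.1 i := by
    intro y hy hyx
    by_contra hcon
    push Not at hcon
    have hyc : y = center n κ := Star.eq_center fun i => not_lt.2 (hcon i)
    have h1 := hmin y hy
    rw [hyc, rad_center] at h1
    refine hyx (hyc.trans (Star.ext fun l => ?_))
    by_cases hl : l = m
    · rw [hl, le_antisymm h1 (x.nonneg m), center_apply]
    · rw [hxm l hl, center_apply]
  have hsum : ∑ i, cnt (c.1.erase x) i = K := by
    rw [sum_cnt, Finset.filter_true_of_mem, Finset.card_erase_of_mem hx, c.2]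
    · rfl
    · rintro y hy rfl
      obtain ⟨i, hi⟩ := hcen _ (Finset.mem_of_mem_erase hy) (Finset.ne_of_mem_erase hy)
      simp at hi
  -- If the nearest point `x` is off the centre, the chain condition puts the innermost point of a
  -- second arm at distance `1 - x m`. It is no nearer than `x`, so `x m ≤ 1 / 2`.
  have htwo : x.1 m = 0 ∨ (∃ i, i ≠ m ∧ cnt (c.1.erase x) i ≠ 0) ∧ x.1 m ≤ 1 / 2 := by
    rcases eq_or_lt_of_le (x.nonneg m) with h0 | h0
    · exact Or.inl h0.symm
    · right
      obtain ⟨i, him, w, hw⟩ : ∃ i, i ≠ m ∧ (arm c.pts i).Nonempty := by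
        obtain ⟨i, j, hij, hi, hj⟩ := harms
        by_cases him : i = m
        · exact ⟨j, fun h => hij (him.trans h.symm), hj⟩
        · exact ⟨i, him, hi⟩
      obtain ⟨hwc, hwi⟩ := mem_arm.1 hw
      have hwpos : 0 < w.1 i := by
        rw [← rad_eq hwi]
        exact h0.trans_le (hmin w hwc)
      have hne : ∀ z : Star n κ, 0 < z.1 i → z ≠ x := by
        rintro z hz rfl
        exact hz.ne' (hxm i him)
      refine ⟨⟨i, him, Finset.card_ne_zero_of_mem
        (Finset.mem_filter.2 ⟨Finset.mem_erase.2 ⟨hne w hwpos, hwc⟩, hwpos⟩)⟩, ?_⟩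
      obtain ⟨y, hy, hymin⟩ := Finset.exists_min_image (c.1.filter fun z => 0 < z.1 i)
        (fun z => z.1 i) ⟨w, Finset.mem_filter.2 ⟨hwc, hwpos⟩⟩
      obtain ⟨hyc, hyi⟩ := Finset.mem_filter.1 hy
      have h1 := hkey i y hyc hyi
      have h2 : ((c.1.erase x).filter fun z => 0 < z.1 i ∧ z.1 i ≤ y.1 i) = {y} := by
        ext z
        simp only [Finset.mem_filter, Finset.mem_erase, Finset.mem_singleton]
        constructor
        · rintro ⟨⟨-, hz⟩, hzi, hzy⟩
          exact Star.ext_of_pos hzi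
            (le_antisymm hzy (hymin z (Finset.mem_filter.2 ⟨hz, hzi⟩)))
        · rintro rfl
          exact ⟨⟨hne z hyi, hyc⟩, hyi, le_rfl⟩
      have h3 := hmin y hyc
      rw [rad_of_pos hyi] at h3
      rw [h2, sgn_ne him] at h1
      simp at h1
      linarith
  have hadm : Adm K (cnt (c.1.erase x)) m (x.1 m) :=
    ⟨hsum, x.nonneg m, htwo.elim (fun h => by rw [h]; norm_num) fun h => h.2,
      htwo.imp id fun h => h.1⟩
  refine ⟨_, _, _, hadm, hadm.eq_conf hκ fun y hy => ?_⟩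
  by_cases hyx : y = x
  · exact ⟨none, by rw [hyx]; exact (Star.eq_pt hxm).symm⟩
  · obtain ⟨i, hi⟩ := hcen y hy hyx
    have h1 := hkey i y hy hi
    set S := (c.1.erase x).filter fun z => 0 < z.1 i ∧ z.1 i ≤ y.1 i with hSdef
    have hpos : 0 < S.card := Finset.card_pos.2
      ⟨y, Finset.mem_filter.2 ⟨Finset.mem_erase.2 ⟨hyx, hy⟩, hi, le_rfl⟩⟩
    have hle : S.card ≤ cnt (c.1.erase x) i := by
      refine Finset.card_le_card fun z hz => ?_
      obtain ⟨hz1, hz2⟩ := Finset.mem_filter.1 hz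
      exact Finset.mem_filter.2 ⟨hz1, hz2.1⟩
    -- `S` counts `y` itself, while slots are numbered from 0.
    refine ⟨some ⟨i, ⟨S.card - 1, by omega⟩⟩, ?_⟩
    refine Eq.trans ?_ (Star.eq_pt_of_pos hi).symm
    rw [slotPt, h1]
    simp only [Nat.cast_pred hpos]
    congr 1
    ring

end Standardize


/-! ### The graph cover of the spine -/

section SpineCover

open scoped Classical unitInterval

variable {n : ℕ} {κ : ℝ≥0} {K : ℕ} {p : Fin n → ℕ} {m : Fin n} {s t : ℝ}

/-- The standard configuration as a point of the spine. -/
noncomputable def Adm.spine [Nontrivial (Fin n)] (h : Adm K p m t) (hκ : (K : ℝ≥0) ≤ κ) :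
    Spine n κ (K + 1) := ⟨h.conf hκ, h.isRegular hκ⟩

theorem exists_eq_spine [Nontrivial (Fin n)] (hκ : (K : ℝ≥0) ≤ κ) (c : Spine n κ (K + 1)) :
    ∃ p m t, ∃ h : Adm K p m t, c = h.spine hκ := by
  obtain ⟨p, m, t, h, hc⟩ := exists_adm_of_isRegular hκ c.2
  exact ⟨p, m, t, h, Subtype.ext hc⟩

/-- At `t = 1 / 2` the first point of a second leg is also at distance `1 / 2`, so there is no
strictly nearest point. -/
theorem Adm.conf_notMem_nearSet (h : Adm K p m (1 / 2)) (hκ : (K : ℝ≥0) ≤ κ) (p' : Fin n → ℕ) :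
    h.conf hκ ∉ nearSet n κ (K + 1) p' := by
  rintro ⟨⟨x, hx, -⟩, -⟩
  obtain ⟨i, hi, hpi⟩ := h.two.resolve_left (by norm_num)
  have h1 := h.rad_none hκ
  have h2 := h.rad_some hκ (i := i) ⟨0, Nat.pos_of_ne_zero hpi⟩
  have hle := fun s => h.le_rad hκ s
  set y := slotPt κ p m (1 / 2) (some ⟨i, ⟨0, Nat.pos_of_ne_zero hpi⟩⟩) with hy
  have hne : slotPt κ p m (1 / 2) none ≠ y := fun he => by
    simpa [hy] using h.slotPt_injective hκ he
  have hyc : y ∈ (h.conf hκ).1 := (h.mem_conf hκ).2 ⟨_, rfl⟩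
  obtain ⟨s, hs⟩ := (h.mem_conf hκ).1 hx.1
  have h3 := hle s
  rw [hs] at h3
  rw [sgn_ne hi] at h2
  norm_num at h2
  by_cases hxn : slotPt κ p m (1 / 2) none = x
  · have := hx.2 y hyc fun h => hne (hxn.trans h.symm)
    rw [← hxn, h1, h2] at this
    norm_num at this
  · have := hx.2 _ (h.none_mem hκ) hxn
    rw [h1] at this
    linarith

theorem Adm.of_mem_nearSet (h : Adm K p m t) (hκ : (K : ℝ≥0) ≤ κ) {p' : Fin n → ℕ}
    (hp : h.conf hκ ∈ nearSet n κ (K + 1) p') : p = p' ∧ t < 1 / 2 := by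
  have ht : t < 1 / 2 := by
    refine lt_of_le_of_ne h.le_half ?_
    rintro rfl
    exact h.conf_notMem_nearSet hκ p' hp
  exact ⟨nearSet_unique (h.conf_mem_nearSet hκ ht) hp, ht⟩

theorem Adm.of_mem_legSet (h : Adm K p m t) (hκ : (K : ℝ≥0) ≤ κ) {q : Fin n → ℕ}
    (hq : h.conf hκ ∈ legSet n κ (K + 1) q) : q = p + Pi.single m 1 ∧ 0 < t := by
  have ht : 0 < t := by
    refine lt_of_le_of_ne h.nonneg fun h0 => center_notMem_of_mem_legSet hq ?_
    exact (h.center_mem_iff hκ).2 h0.symm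
  exact ⟨legSet_unique hq (h.conf_mem_legSet hκ ht), ht⟩

theorem Adm.motion {s₁ : ℝ} (h : Adm K p m s) (h₁ : Adm K p m s₁) (h0 : s = 0 → s₁ = 0) (τ : I) :
    Adm K p m ((1 - τ) * s + τ * s₁) where
  sum := h.sum
  nonneg := add_nonneg (mul_nonneg (sub_nonneg.2 τ.2.2) h.nonneg) (mul_nonneg τ.2.1 h₁.nonneg)
  le_half := by
    have h1 := mul_le_mul_of_nonneg_left h.le_half (sub_nonneg.2 τ.2.2)
    have h2 := mul_le_mul_of_nonneg_left h₁.le_half τ.2.1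
    linarith
  two := h.two.imp (fun hs => by rw [hs, h0 hs]; ring) id

/-- Targets at unit distance from each other, the one of rank `0` at `g i`. -/
noncomputable def unitTarget (κ : ℝ≥0) (g : Fin n → ℝ) (i : Fin n) (r : ℕ) : Set.Icc (0 : ℝ) κ :=
  Set.projIcc (0 : ℝ) (κ : ℝ) κ.coe_nonneg (g i - r)

theorem unitTarget_apply {g : Fin n → ℝ} {i : Fin n} {r : ℕ} (h0 : (r : ℝ) ≤ g i)
    (h1 : g i ≤ κ) : (unitTarget κ g i r : ℝ) = g i - r := by
  have hr : (0 : ℝ) ≤ r := Nat.cast_nonneg _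
  rw [unitTarget, Set.projIcc_of_mem κ.coe_nonneg ⟨by linarith, by linarith⟩]

theorem unitTarget_lt {g : Fin n → ℝ} {i : Fin n} {r r' : ℕ} (h : r < r') (h0 : (r' : ℝ) ≤ g i)
    (h1 : g i ≤ κ) : (unitTarget κ g i r' : ℝ) < unitTarget κ g i r := by
  have hr : (r : ℝ) < r' := by exact_mod_cast h
  rw [unitTarget_apply h0 h1, unitTarget_apply (hr.le.trans h0) h1]
  linarith

variable [Nontrivial (Fin n)]

/-- These sets are the open stars of the vertices with `t = 1 / 2`. The motion raises `t` to `1 /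
2`; the final position of rank `r` is `q i - 1 / 2 - r`. -/
theorem isSimplyConnected_spine_legSet (hκ : (K : ℝ≥0) ≤ κ) {q : Fin n → ℕ}
    (hne : (Spine.incl n κ (K + 1) ⁻¹' legSet n κ (K + 1) q).Nonempty) :
    IsSimplyConnected (Spine.incl n κ (K + 1) ⁻¹' legSet n κ (K + 1) q) := by
  have hform : ∀ y ∈ Spine.incl n κ (K + 1) ⁻¹' legSet n κ (K + 1) q,
      ∃ p m t, ∃ h : Adm K p m t, y = h.spine hκ ∧ q = p + Pi.single m 1 ∧ 0 < t := by
    intro y hy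
    obtain ⟨p, m, t, h, rfl⟩ := exists_eq_spine hκ y
    exact ⟨p, m, t, h, rfl, h.of_mem_legSet hκ hy⟩
  have hhalf : ∀ {p : Fin n → ℕ} {m : Fin n} {t : ℝ}, Adm K p m t → 0 < t → Adm K p m (1 / 2) :=
    fun h ht => ⟨h.sum, by norm_num, le_rfl, Or.inr (h.two.resolve_left ht.ne')⟩
  have hg : ∀ (p : Fin n → ℕ) (m i : Fin n),
      (((p + Pi.single m 1 : Fin n → ℕ) i : ℕ) : ℝ) - 1 / 2 = p i + sgn m i * (1 / 2) := by
    intro p m i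
    by_cases hi : i = m
    · subst hi
      simp [sgn_self]
      ring
    · simp [sgn_ne hi, hi]
      ring
  have hgκ : ∀ i, (q i : ℝ) - 1 / 2 ≤ κ := by
    intro i
    obtain ⟨p, m, t, h, -, rfl, ht⟩ := hform _ hne.some_mem
    rw [hg]
    exact (hhalf h ht).add_le hκ i
  have hr : ∀ i r, r < q i → (r : ℝ) ≤ (q i : ℝ) - 1 / 2 := by
    intro i r h
    have : (r : ℝ) + 1 ≤ q i := by exact_mod_cast h
    linarith
  refine isSimplyConnected_of_subset_legSet (j := Spine.incl n κ (K + 1))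
    Topology.IsEmbedding.subtypeVal hne (T := unitTarget κ fun i => (q i : ℝ) - 1 / 2)
    (fun i r r' h h' => unitTarget_lt h (hr i r' h') (hgκ i)) (fun i r h => ?_) (fun y hy => hy)
    fun y hy H τ => ?_
  · rw [unitTarget_apply (hr i r h) (hgκ i)]
    have : (r : ℝ) + 1 ≤ q i := by exact_mod_cast h
    linarith
  · obtain ⟨p, m, t, h, rfl, rfl, ht⟩ := hform y hy
    have h' := h.motion (hhalf h ht) (fun h0 => absurd h0 ht.ne') τ
    have he : H.conf τ = h'.conf hκ := by
      refine h.conf_move hκ (s₁ := 1 / 2) (fun i r hri => ?_) ?_ (fun h0 => absurd h0 ht.ne') H τ h'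
      · rw [unitTarget_apply (hr i r (hri.trans_le (by simp))) (hgκ i), hg]
        ring
      · rw [unitTarget_apply (hr m _ (by simp)) (hgκ m), hg, sgn_self]
        ring
    refine ⟨h'.spine hκ, ?_, he.symm⟩
    refine h'.conf_mem_legSet hκ ?_
    rcases eq_or_lt_of_le τ.2.1 with h0 | h0
    · rw [← h0]
      simpa using ht
    · have h1 := mul_nonneg (sub_nonneg.2 τ.2.2) ht.le
      have : (0 : ℝ) < τ := h0
      linarith

/-- These sets are the open stars of the vertices with `t = 0`, and the motion lowers `t` to 0. -/
theorem isSimplyConnected_spine_nearSet (hκ : (K : ℝ≥0) ≤ κ) {p : Fin n → ℕ}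
    (hp : ∑ i, p i = K) :
    IsSimplyConnected (Spine.incl n κ (K + 1) ⁻¹' nearSet n κ (K + 1) p) := by
  have hne : (Spine.incl n κ (K + 1) ⁻¹' nearSet n κ (K + 1) p).Nonempty := by
    have h := adm_zero hp (Classical.arbitrary (Fin n))
    exact ⟨h.spine hκ, h.conf_mem_nearSet hκ (by norm_num)⟩
  have hgκ : ∀ i, (p i : ℝ) ≤ κ := fun i => by
    have h := (adm_zero hp i).le_sum i
    have h1 : (K : ℝ) ≤ κ := by exact_mod_cast hκ
    have h2 : (p i : ℝ) ≤ K := by exact_mod_cast h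
    linarith
  refine isSimplyConnected_of_subset_nearSet (j := Spine.incl n κ (K + 1))
    Topology.IsEmbedding.subtypeVal hne (T := unitTarget κ fun i => (p i : ℝ))
    (fun i r r' h h' => unitTarget_lt h (by exact_mod_cast h') (hgκ i)) (fun i => ?_)
    (fun y hy => hy) fun y hy H τ => ?_
  · rw [unitTarget_apply le_rfl (hgκ i), sub_self]
  · obtain ⟨p', m, t, h, rfl⟩ := exists_eq_spine hκ y
    obtain ⟨rfl, ht⟩ := h.of_mem_nearSet hκ hy
    have h' := h.motion (adm_zero hp m) (fun _ => rfl) τ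
    have he : H.conf τ = h'.conf hκ := by
      refine h.conf_move hκ (s₁ := 0) (fun i r hri => ?_) ?_ (fun _ => rfl) H τ h'
      · rw [unitTarget_apply (by exact_mod_cast hri.le) (hgκ i)]
        ring
      · rw [unitTarget_apply le_rfl (hgκ m), sub_self]
    refine ⟨h'.spine hκ, ?_, he.symm⟩
    refine h'.conf_mem_nearSet hκ ?_
    have := mul_nonneg τ.2.1 h.nonneg
    linarith

/-- Since `p` and `q` determine `m`, the overlap is one open edge `0 < t < 1 / 2`. It contracts to
its midpoint `t = 1 / 4`. -/
theorem isPathConnected_spine_inter (hκ : (K : ℝ≥0) ≤ κ) {p q : Fin n → ℕ}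
    (hne : (Spine.incl n κ (K + 1) ⁻¹' nearSet n κ (K + 1) p ∩
      Spine.incl n κ (K + 1) ⁻¹' legSet n κ (K + 1) q).Nonempty) :
    IsPathConnected (Spine.incl n κ (K + 1) ⁻¹' nearSet n κ (K + 1) p ∩
      Spine.incl n κ (K + 1) ⁻¹' legSet n κ (K + 1) q) := by
  obtain ⟨m, rfl, h₁⟩ : ∃ m, q = p + Pi.single m 1 ∧ Adm K p m (1 / 4) := by
    obtain ⟨y, hy1, hy2⟩ := hne
    obtain ⟨p', m, t, h, rfl⟩ := exists_eq_spine hκ y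
    obtain ⟨rfl, -⟩ := h.of_mem_nearSet hκ hy1
    obtain ⟨hq, ht⟩ := h.of_mem_legSet hκ hy2
    exact ⟨m, hq, adm_quarter h.sum (h.two.resolve_left ht.ne')⟩
  have hgκ := h₁.add_le hκ
  have hr : ∀ i r, r < (p + Pi.single m 1 : Fin n → ℕ) i →
      (r : ℝ) < (p i : ℝ) + sgn m i * (1 / 4) := by
    intro i r h
    by_cases hi : i = m
    · subst hi
      have : r ≤ p i := by simpa [Nat.lt_succ_iff] using h
      have : (r : ℝ) ≤ p i := by exact_mod_cast this
      rw [sgn_self]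
      linarith
    · have : r < p i := by simpa [hi] using h
      have : (r : ℝ) + 1 ≤ p i := by exact_mod_cast this
      rw [sgn_ne hi]
      linarith
  refine (isSimplyConnected_of_subset_legSet (j := Spine.incl n κ (K + 1))
    Topology.IsEmbedding.subtypeVal hne
    (T := unitTarget κ fun i => (p i : ℝ) + sgn m i * (1 / 4))
    (fun i r r' h h' => unitTarget_lt h (hr i r' h').le (hgκ i)) (fun i r h => ?_)
    (fun y hy => hy.2) fun y hy H τ => ?_).isPathConnected
  · rw [unitTarget_apply (hr i r h).le (hgκ i)]
    have := hr i r h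
    linarith
  · obtain ⟨p', m', t, h, rfl⟩ := exists_eq_spine hκ y
    obtain ⟨rfl, ht⟩ := h.of_mem_nearSet hκ hy.1
    obtain ⟨hq, ht0⟩ := h.of_mem_legSet hκ hy.2
    obtain rfl := add_single_injective hq
    have h' := h.motion h₁ (fun h0 => absurd h0 ht0.ne') τ
    have he : H.conf τ = h'.conf hκ := by
      refine h.conf_move hκ (s₁ := 1 / 4) (fun i r hri => ?_) ?_
        (fun h0 => absurd h0 ht0.ne') H τ h'
      · rw [unitTarget_apply (hr i r (hri.trans_le (by simp))).le (hgκ i)]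
        ring
      · rw [unitTarget_apply (hr m _ (by simp)).le (hgκ m), sgn_self]
        ring
    have hτ1 : (0 : ℝ) ≤ τ := τ.2.1
    have hτ2 : (τ : ℝ) ≤ 1 := τ.2.2
    refine ⟨h'.spine hκ, ⟨h'.conf_mem_nearSet hκ ?_, h'.conf_mem_legSet hκ ?_⟩, he.symm⟩
    · nlinarith
    · nlinarith

/-- The traces of the leg sets and the nearest point sets form a graph cover of the spine. -/
theorem isGraphCover_spine (hκ : (K : ℝ≥0) ≤ κ) (a : Fin n) :
    IsGraphCover a K (fun p => Spine.incl n κ (K + 1) ⁻¹' nearSet n κ (K + 1) p)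
      (fun q => Spine.incl n κ (K + 1) ⁻¹' legSet n κ (K + 1) q) := by
  have hmeet : ∀ (p : Fin n → ℕ) m, ∑ i, p i = K → (∃ i, i ≠ m ∧ p i ≠ 0) →
      (Spine.incl n κ (K + 1) ⁻¹' nearSet n κ (K + 1) p ∩
        Spine.incl n κ (K + 1) ⁻¹' legSet n κ (K + 1) (p + Pi.single m 1)).Nonempty := by
    intro p m hp h
    have ha := adm_quarter hp h
    exact ⟨ha.spine hκ, ha.conf_mem_nearSet hκ (by norm_num), ha.conf_mem_legSet hκ (by norm_num)⟩
  refine ⟨fun p => (isOpen_nearSet p).preimage (Spine.incl n κ (K + 1)).continuous,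
    fun q => (isOpen_legSet q).preimage (Spine.incl n κ (K + 1)).continuous, fun x => ?_,
    fun p ⟨c, hc⟩ => ?_, fun x p p' => nearSet_unique, fun x q q' => legSet_unique,
    fun x p q => exists_add_single, fun p hp => isSimplyConnected_spine_nearSet hκ hp,
    fun q hq => isSimplyConnected_spine_legSet hκ hq,
    fun p q hne => isPathConnected_spine_inter hκ hne, hmeet, fun q hq => ?_⟩
  · by_cases h : center n κ ∈ x.1.1
    · exact Or.inl ⟨_, mem_nearSet_of_center_mem h⟩
    · exact Or.inr ⟨_, mem_legSet_of_center_notMem h⟩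
  · have := hc.2
    omega
  · obtain ⟨y, hy⟩ := hq
    obtain ⟨p, m, t, h, rfl⟩ := exists_eq_spine hκ y
    obtain ⟨rfl, ht⟩ := h.of_mem_legSet hκ hy
    exact ⟨p, hmeet p m h.sum (h.two.resolve_left ht.ne')⟩

end SpineCover


/-! ### Coordinates on the spine -/

section Coordinates

open scoped Classical

variable {n : ℕ} {κ : ℝ≥0} {K : ℕ} {p p' : Fin n → ℕ} {m m' : Fin n} {t t' : ℝ}

/-- At `t = 0` the positions are integers and the leg `m` is no longer visible. -/
theorem Adm.mem_conf_zero (h : Adm K p m 0) (hκ : (K : ℝ≥0) ≤ κ) {z : Star n κ} :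
    z ∈ (h.conf hκ).1 ↔ ∃ i, ∃ j : ℕ, j ≤ p i ∧ z = pt i (j : ℝ) := by
  rw [h.mem_conf hκ]
  constructor
  · rintro ⟨_ | ⟨i, j⟩, rfl⟩
    · exact ⟨m, 0, Nat.zero_le _, by simp [slotPt]⟩
    · exact ⟨i, j + 1, j.2, by simp [slotPt]⟩
  · rintro ⟨i, j, hj, rfl⟩
    rcases j with _ | j
    · exact ⟨none, by simp [slotPt, pt_zero]⟩
    · exact ⟨some ⟨i, ⟨j, hj⟩⟩, by simp [slotPt]⟩

/-- At `t = 1 / 2` the positions are half-integers and only the sum `p + e_m` is visible. -/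
theorem Adm.mem_conf_half (h : Adm K p m (1 / 2)) (hκ : (K : ℝ≥0) ≤ κ) {z : Star n κ} :
    z ∈ (h.conf hκ).1 ↔
      ∃ i, ∃ j : ℕ, j < (p + Pi.single m 1 : Fin n → ℕ) i ∧ z = pt i ((j : ℝ) + 1 / 2) := by
  rw [h.mem_conf hκ]
  constructor
  · rintro ⟨_ | ⟨i, j⟩, rfl⟩
    · exact ⟨m, 0, by simp, by simp [slotPt]⟩
    · by_cases hi : i = m
      · subst hi
        refine ⟨i, j + 1, by simp, ?_⟩
        simp [slotPt, sgn_self]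
      · refine ⟨i, j, by simp [hi], ?_⟩
        rw [slotPt, sgn_ne hi]
        congr 1
        ring
  · rintro ⟨i, j, hj, rfl⟩
    by_cases hi : i = m
    · subst hi
      rcases j with _ | j
      · exact ⟨none, by simp [slotPt]⟩
      · refine ⟨some ⟨i, ⟨j, by simpa using hj⟩⟩, ?_⟩
        simp [slotPt, sgn_self]
    · refine ⟨some ⟨i, ⟨j, by simpa [hi] using hj⟩⟩, ?_⟩
      rw [slotPt, sgn_ne hi]
      congr 1
      ring

theorem Adm.height_unique (h : Adm K p m t) (h' : Adm K p' m' t') (hκ : (K : ℝ≥0) ≤ κ)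
    (he : h.conf hκ = h'.conf hκ) : t = t' := by
  rw [← h.height_eq hκ, he, h'.height_eq hκ]

/-- The parameters of a standard configuration are unique up to evident exceptions. -/
theorem Adm.conf_eq_iff (h : Adm K p m t) (h' : Adm K p' m' t') (hκ : (K : ℝ≥0) ≤ κ) :
    h.conf hκ = h'.conf hκ ↔ t = t' ∧ (t < 1 / 2 → p = p') ∧
      (0 < t → p + Pi.single m 1 = p' + Pi.single m' 1) := by
  constructor
  · intro he
    obtain rfl := h.height_unique h' hκ he
    refine ⟨rfl, fun ht => ?_, fun ht => ?_⟩
    · exact (h.of_mem_nearSet hκ (he ▸ h'.conf_mem_nearSet hκ ht)).1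
    · exact (h'.of_mem_legSet hκ (he ▸ h.conf_mem_legSet hκ ht)).1
  · rintro ⟨rfl, h1, h2⟩
    rcases eq_or_lt_of_le h.nonneg with h0 | h0
    · subst h0
      obtain rfl := h1 (by norm_num)
      refine Subtype.ext (Finset.ext fun z => ?_)
      rw [h.mem_conf_zero hκ, h'.mem_conf_zero hκ]
    · rcases eq_or_lt_of_le h.le_half with h3 | h3
      · subst h3
        refine Subtype.ext (Finset.ext fun z => ?_)
        rw [h.mem_conf_half hκ, h'.mem_conf_half hκ, h2 h0]
      · obtain rfl := h1 h3
        obtain rfl := add_single_injective (h2 h0)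
        rfl

/-- Two ordered configurations have the same image under a finite union of closed conditions, one
for each permutation. It makes compact parameter arcs closed in the spine. -/
instance {X : Type*} [TopologicalSpace X] [T2Space X] {J : ℕ} : T2Space (UConf X J) := by
  rw [t2Space_iff_of_isOpenQuotientMap UConf.isOpenQuotientMap_proj]
  have : {q : {x : Fin J → X // Function.Injective x} × {x : Fin J → X // Function.Injective x} |
      UConf.proj X J q.1 = UConf.proj X J q.2} =
      ⋃ σ : Equiv.Perm (Fin J), {q | q.2.1 = q.1.1 ∘ σ} := by
    ext ⟨x, y⟩
    simp only [Set.mem_ofPred_eq, Set.mem_iUnion]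
    constructor
    · intro h
      have hxy : ∀ l, ∃ l', x.1 l' = y.1 l := fun l => UConf.mem_proj.1 (h ▸ UConf.mem_proj.2 ⟨l,
          rfl⟩)
      choose σ hσ using hxy
      have hinj : Function.Injective σ := fun l l' he => y.2 (by rw [← hσ, ← hσ, he])
      exact ⟨Equiv.ofBijective σ (Finite.injective_iff_bijective.1 hinj),
        funext fun l => (hσ l).symm⟩
    · rintro ⟨σ, h⟩
      refine Subtype.ext (Finset.ext fun z => ?_)
      rw [UConf.mem_proj, UConf.mem_proj, h]
      exact ⟨fun ⟨l, hl⟩ => ⟨σ.symm l, by simpa using hl⟩, fun ⟨l, hl⟩ => ⟨σ l, hl⟩⟩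
  rw [this]
  refine isClosed_iUnion_of_finite fun σ => isClosed_eq (by fun_prop) ?_
  refine continuous_pi fun l => ?_
  exact (continuous_apply (σ l)).comp (continuous_subtype_val.comp continuous_fst)

theorem continuous_slotPt (p : Fin n → ℕ) (m : Fin n) (s : Slot p) :
    Continuous fun t => slotPt κ p m t s := by
  rcases s with _ | ⟨i, j⟩
  · exact continuous_pt m
  · exact (continuous_pt i).comp (by fun_prop)

theorem continuous_conf (hκ : (K : ℝ≥0) ≤ κ) (p : Fin n → ℕ) (m : Fin n) :
    Continuous fun t : {t // Adm K p m t} => t.2.conf hκ := by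
  by_cases hp : ∑ i, p i = K
  · let e : Fin (K + 1) ≃ Slot p := (Fintype.equivFinOfCardEq (by rw [card_slot, hp])).symm
    have : (fun t : {t // Adm K p m t} => t.2.conf hκ) = fun t => UConf.proj (Star n κ) (K + 1)
        ⟨fun l => slotPt κ p m t.1 (e l), (t.2.slotPt_injective hκ).comp e.injective⟩ := by
      funext t
      refine Subtype.ext (Finset.ext fun z => ?_)
      rw [t.2.mem_conf hκ, UConf.mem_proj]
      exact ⟨fun ⟨s, hs⟩ => ⟨e.symm s, by simpa using hs⟩, fun ⟨l, hl⟩ => ⟨e l, hl⟩⟩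
    rw [this]
    refine UConf.continuous_proj.comp (Continuous.subtype_mk (continuous_pi fun l => ?_) _)
    exact (continuous_slotPt p m (e l)).comp continuous_subtype_val
  · have : IsEmpty {t // Adm K p m t} := ⟨fun t => hp t.2.sum⟩
    exact continuous_of_const fun t => isEmptyElim t

instance (K : ℕ) (p : Fin n → ℕ) (m : Fin n) : CompactSpace {t // Adm K p m t} := by
  suffices IsCompact {t | Adm K p m t} from isCompact_iff_compactSpace.1 this
  by_cases hp : ∑ i, p i = K
  · by_cases h : ∃ i, i ≠ m ∧ p i ≠ 0
    · have : {t | Adm K p m t} = Set.Icc 0 (1 / 2) := by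
        ext t
        exact ⟨fun ht => ⟨ht.nonneg, ht.le_half⟩, fun ht => ⟨hp, ht.1, ht.2, Or.inr h⟩⟩
      rw [this]
      exact isCompact_Icc
    · refine Set.Finite.isCompact ((Set.finite_singleton (0 : ℝ)).subset fun t ht => ?_)
      exact ht.two.resolve_right h
  · have : {t | Adm K p m t} = ∅ := Set.eq_empty_of_forall_notMem fun t ht => hp ht.sum
    rw [this]
    exact isCompact_empty

theorem finite_adm (K : ℕ) : {pm : (Fin n → ℕ) × Fin n | ∃ t, Adm K pm.1 pm.2 t}.Finite := by
  refine ((Set.finite_Iic (fun _ : Fin n => K)).prod (Set.finite_univ (α := Fin n))).subset ?_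
  rintro ⟨p, m⟩ ⟨t, ht⟩
  exact ⟨fun i => ht.le_sum i, trivial⟩

variable [Nontrivial (Fin n)]

/-- The closed path of standard configurations with given combinatorial data. -/
noncomputable def param (hκ : (K : ℝ≥0) ≤ κ) (pm : (Fin n → ℕ) × Fin n)
    (t : {t // Adm K pm.1 pm.2 t}) : Spine n κ (K + 1) := t.2.spine hκ

theorem continuous_param (hκ : (K : ℝ≥0) ≤ κ) (pm : (Fin n → ℕ) × Fin n) :
    Continuous (param hκ pm) := (continuous_conf hκ pm.1 pm.2).subtype_mk _

/-- A union of images of closed sets of parameters is closed. -/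
theorem isClosed_iUnion_param (hκ : (K : ℝ≥0) ≤ κ)
    (C : ∀ pm : (Fin n → ℕ) × Fin n, Set {t // Adm K pm.1 pm.2 t}) (hC : ∀ pm, IsClosed (C pm)) :
    IsClosed {c : Spine n κ (K + 1) | ∃ pm, ∃ t ∈ C pm, param hκ pm t = c} := by
  have : {c : Spine n κ (K + 1) | ∃ pm, ∃ t ∈ C pm, param hκ pm t = c} =
      ⋃ pm ∈ {pm : (Fin n → ℕ) × Fin n | ∃ t, Adm K pm.1 pm.2 t}, param hκ pm '' C pm := by
    ext c
    simp only [Set.mem_ofPred_eq, Set.mem_iUnion, exists_prop]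
    exact ⟨fun ⟨pm, t, ht, he⟩ => ⟨pm, ⟨t.1, t.2⟩, t, ht, he⟩,
      fun ⟨pm, _, t, ht, he⟩ => ⟨pm, t, ht, he⟩⟩
  rw [this]
  exact (finite_adm K).isClosed_biUnion fun pm _ =>
    ((hC pm).isCompact.image (continuous_param hκ pm)).isClosed

end Coordinates

/-! ### Adding a point -/

section AddPoint

open scoped Classical

variable {n : ℕ} {κ : ℝ≥0} {K : ℕ} {p : Fin n → ℕ} {m : Fin n} {t : ℝ}

theorem Adm.add (h : Adm K p m t) (a : Fin n) : Adm (K + 1) (p + Pi.single a 1) m t where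
  sum := by rw [sum_add_single, h.sum]
  nonneg := h.nonneg
  le_half := h.le_half
  two := h.two.imp id fun ⟨i, hi, hp⟩ => ⟨i, hi, by simp [hp]⟩

/-- The point that is added to a standard configuration on the leg `a`. -/
noncomputable def newPt (κ : ℝ≥0) (p : Fin n → ℕ) (m : Fin n) (t : ℝ) (a : Fin n) : Star n κ :=
  pt a (p a + 1 + sgn m a * t)

theorem newPt_mem_seg (a : Fin n) : newPt κ p m t a ∈ seg (center n κ) (leaf κ a) :=
  mem_seg_leaf.2 fun _ hj => pt_ne hj _

/-- The new point takes the next slot at the outer end of leg `a`; the governing leg and `t` are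
unchanged. -/
theorem Adm.pts_add (h : Adm K p m t) (hκ : ((K + 1 : ℕ) : ℝ≥0) ≤ κ) (hκ' : (K : ℝ≥0) ≤ κ)
    (a : Fin n) : ((h.add a).conf hκ).pts = (h.conf hκ').pts ∪ {newPt κ p m t a} := by
  ext z
  change z ∈ ((h.add a).conf hκ).1 ↔ z ∈ (h.conf hκ').1 ∨ z = _
  rw [(h.add a).mem_conf hκ, h.mem_conf hκ']
  constructor
  · rintro ⟨_ | ⟨i, j, hj⟩, rfl⟩
    · exact Or.inl ⟨none, rfl⟩
    · by_cases hji : j < p i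
      · exact Or.inl ⟨some ⟨i, ⟨j, hji⟩⟩, rfl⟩
      · right
        have hia : i = a := by
          by_contra hne
          simp [hne] at hj
          exact hji hj
        subst hia
        have hjp : j = p i := by
          simp at hj
          omega
        subst hjp
        rfl
  · rintro (⟨_ | ⟨i, j⟩, rfl⟩ | rfl)
    · exact ⟨none, rfl⟩
    · exact ⟨some ⟨i, ⟨j, j.2.trans_le (by simp)⟩⟩, rfl⟩
    · exact ⟨some ⟨a, ⟨p a, by simp⟩⟩, rfl⟩

/-- If a point of the leg `a` is added to a standard configuration and the result is a standard
configuration, it has the expected parameters. -/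
theorem Adm.eq_add {p' : Fin n → ℕ} {m' : Fin n} {t' : ℝ} (h : Adm K p m t)
    (h' : Adm (K + 1) p' m' t') (hκ : ((K + 1 : ℕ) : ℝ≥0) ≤ κ) (hκ' : (K : ℝ≥0) ≤ κ) {a : Fin n}
    {x : Star n κ} (hx : ∀ j, j ≠ a → x.1 j = 0) (he : (h'.conf hκ).1 = insert x (h.conf hκ').1) :
    h'.conf hκ = (h.add a).conf hκ := by
  have hxc : x ∉ (h.conf hκ').1 := by
    intro hmem
    rw [Finset.insert_eq_of_mem hmem] at he
    have h1 := (h'.conf hκ).2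
    rw [he, (h.conf hκ').2] at h1
    omega
  have hsub : ∀ z ∈ (h.conf hκ').1, z ∈ (h'.conf hκ).1 := fun z hz => by
    rw [he]
    exact Finset.mem_insert_of_mem hz
  have hcnt : ∀ i, 0 < x.1 a → cnt (h'.conf hκ).1 i =
      cnt (h.conf hκ').1 i + (Pi.single a 1 : Fin n → ℕ) i := by
    intro i hpos
    have h1 : x ∈ (h'.conf hκ).1 := by
      rw [he]
      exact Finset.mem_insert_self _ _
    rw [cnt_erase_add h1 i, he, Finset.erase_insert hxc]
    by_cases hi : i = a
    · subst hi
      simp [hpos]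
    · simp [hx i hi, hi]
  have hnone := hsub _ (h.none_mem hκ')
  have hle : t' ≤ t := by
    obtain ⟨s, hs⟩ := (h'.mem_conf hκ).1 hnone
    have h1 := h'.le_rad hκ s
    rwa [hs, h.rad_none hκ'] at h1
  have hother : ∀ (i : Fin n) (j : Fin (p' i)),
      slotPt κ p' m' t' (some ⟨i, j⟩) = slotPt κ p m t none → 1 - t' ≤ t := by
    intro i j hs
    have h1 := h'.rad_some hκ j
    rw [hs, h.rad_none hκ'] at h1
    have h2 := (abs_sgn_mul (m := m') (i := i) h'.nonneg).1
    have h3 : (0 : ℝ) ≤ j := Nat.cast_nonneg _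
    linarith
  -- If the old nearest slot is not the new one, then `t ≥ 1 - t'` by `hother`. As both parameters
  -- are at most `1 / 2`, they are then both equal to `1 / 2`.
  have htt : t' = t := by
    obtain ⟨_ | ⟨i, j⟩, hs⟩ := (h'.mem_conf hκ).1 hnone
    · have h1 := h'.rad_none hκ
      rw [hs, h.rad_none hκ'] at h1
      exact h1.symm
    · have := hother i j hs
      have := h.le_half
      linarith
  subst htt
  rw [h'.conf_eq_iff (h.add a) hκ]
  have hpos : 0 < t' → 0 < x.1 a := by
    intro h0
    refine lt_of_le_of_ne (x.nonneg a) fun hxa => h0.ne' ?_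
    rw [← h'.center_mem_iff hκ, he]
    have : center n κ = x := Star.ext fun l => by
      by_cases hl : l = a
      · rw [hl, ← hxa, center_apply]
      · rw [hx l hl, center_apply]
    rw [this]
    exact Finset.mem_insert_self _ _
  have hleg : 0 < t' → p' + Pi.single m' 1 = p + Pi.single a 1 + Pi.single m 1 := by
    intro h0
    have h1 := (h'.conf_mem_legSet hκ h0).1
    have h2 := (h.conf_mem_legSet hκ' h0).1
    funext i
    rw [← h1 i, hcnt i (hpos h0), h2 i]
    simp only [Pi.add_apply]
    ring
  refine ⟨rfl, fun ht => ?_, hleg⟩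
  rcases eq_or_lt_of_le h.nonneg with h0 | h0
  · subst h0
    have hc := (h.center_mem_iff hκ').2 rfl
    have hxa : 0 < x.1 a := by
      refine lt_of_le_of_ne (x.nonneg a) fun hxa => hxc ?_
      have : x = center n κ := Star.ext fun l => by
        by_cases hl : l = a
        · rw [hl, ← hxa, center_apply]
        · rw [hx l hl, center_apply]
      rwa [this]
    have h1 := nearSet_unique (h'.conf_mem_nearSet hκ ht)
      (mem_nearSet_of_center_mem (hsub _ hc))
    have h2 := nearSet_unique (h.conf_mem_nearSet hκ' ht) (mem_nearSet_of_center_mem hc)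
    refine h1.trans (funext fun i => ?_)
    rw [hcnt i hxa, Pi.add_apply, congrFun h2 i]
  · obtain rfl : m' = m := by
      obtain ⟨_ | ⟨i, j⟩, hs⟩ := (h'.mem_conf hκ).1 hnone
      · by_contra hne
        have h1 := h'.slotPt_none hκ
        rw [hs, slotPt_none_ne hne] at h1
        exact h0.ne h1
      · have := hother i j hs
        linarith
    exact add_right_cancel (hleg h0)

end AddPoint


/-! ### The map of spines and its topology -/

section AddMap

variable {n : ℕ} {κ : ℝ≥0} {K : ℕ} {p p' : Fin n → ℕ} {m m' : Fin n} {t t' : ℝ}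
  [Nontrivial (Fin n)]

theorem Adm.spine_eq_iff (h : Adm K p m t) (h' : Adm K p' m' t') (hκ : (K : ℝ≥0) ≤ κ) :
    h.spine hκ = h'.spine hκ ↔ t = t' ∧ (t < 1 / 2 → p = p') ∧
      (0 < t → p + Pi.single m 1 = p' + Pi.single m' 1) := by
  rw [← h.conf_eq_iff h' hκ]
  exact Subtype.ext_iff

/-- The identifications between parameters listed in `Adm.conf_eq_iff` survive the addition of
`e_a`, so the result does not depend on the chosen parameters. -/
theorem exists_add (hκ : ((K + 1 : ℕ) : ℝ≥0) ≤ κ) (hκ' : (K : ℝ≥0) ≤ κ) (a : Fin n)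
    (c : Spine n κ (K + 1)) : ∃ c' : Spine n κ (K + 1 + 1), ∀ p m t, ∀ h : Adm K p m t,
      c = h.spine hκ' → c' = (h.add a).spine hκ := by
  obtain ⟨p, m, t, h, rfl⟩ := exists_eq_spine hκ' c
  refine ⟨(h.add a).spine hκ, fun p' m' t' h' he => ?_⟩
  rw [h.spine_eq_iff h' hκ'] at he
  obtain ⟨h1, h2, h3⟩ := he
  rw [(h.add a).spine_eq_iff (h'.add a) hκ]
  refine ⟨h1, fun ht => by rw [h2 ht], fun ht => ?_⟩
  rw [add_right_comm, h3 ht, add_right_comm]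

/-- The map of spines that adds a point on the leg `a`. -/
noncomputable def addPt (hκ : ((K + 1 : ℕ) : ℝ≥0) ≤ κ) (hκ' : (K : ℝ≥0) ≤ κ) (a : Fin n)
    (c : Spine n κ (K + 1)) : Spine n κ (K + 1 + 1) := (exists_add hκ hκ' a c).choose

theorem Adm.addPt_spine (hκ : ((K + 1 : ℕ) : ℝ≥0) ≤ κ) (hκ' : (K : ℝ≥0) ≤ κ) (a : Fin n)
    (h : Adm K p m t) :
    addPt hκ hκ' a (h.spine hκ') = (h.add a).spine hκ :=
  (exists_add hκ hκ' a (h.spine hκ')).choose_spec p m t h rfl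

theorem existsUnique_add (hκ : ((K + 1 : ℕ) : ℝ≥0) ≤ κ) (hκ' : (K : ℝ≥0) ≤ κ) (a : Fin n)
    (c : Spine n κ (K + 1)) :
    ∃! x : Star n κ, x ∈ seg (center n κ) (leaf κ a) ∧
      ∃ c' : Spine n κ (K + 1 + 1), c'.pts = c.pts ∪ {x} := by
  classical
  obtain ⟨p, m, t, h, rfl⟩ := exists_eq_spine hκ' c
  refine ⟨newPt κ p m t a, ⟨newPt_mem_seg a, (h.add a).spine hκ, h.pts_add hκ hκ' a⟩, ?_⟩
  rintro x ⟨hx, c', hc'⟩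
  obtain ⟨p', m', t', h', rfl⟩ := exists_eq_spine hκ c'
  have he : (h'.conf hκ).1 = insert x (h.conf hκ').1 := by
    ext z
    have : z ∈ (h'.spine hκ).pts ↔ z ∈ (h.spine hκ').pts ∪ {x} := by rw [hc']
    rw [Finset.mem_insert, or_comm]
    exact this
  have hadd := h.eq_add h' hκ hκ' (mem_seg_leaf.1 hx) he
  have hx' : x ∈ ((h.add a).conf hκ).pts := by
    rw [← hadd]
    change x ∈ (h'.conf hκ).1
    rw [he]
    exact Finset.mem_insert_self _ _
  rw [h.pts_add hκ hκ' a] at hx'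
  rcases hx' with hmem | hx'
  · exfalso
    rw [Finset.insert_eq_of_mem hmem] at he
    have h1 := (h'.conf hκ).2
    rw [he, (h.conf hκ').2] at h1
    omega
  · exact hx'

theorem exists_pts_addPt (hκ : ((K + 1 : ℕ) : ℝ≥0) ≤ κ) (hκ' : (K : ℝ≥0) ≤ κ) (a : Fin n)
    (c : Spine n κ (K + 1)) :
    ∃ x ∈ seg (center n κ) (leaf κ a), (addPt hκ hκ' a c).pts = c.pts ∪ {x} := by
  obtain ⟨p, m, t, h, rfl⟩ := exists_eq_spine hκ' c
  refine ⟨newPt κ p m t a, newPt_mem_seg a, ?_⟩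
  rw [h.addPt_spine]
  exact h.pts_add hκ hκ' a

/-- In parameters the map keeps `m` and `t` and shifts `p`. The spine is a finite union of compact
parameter arcs, so it suffices to see closed preimages on each of them. -/
theorem continuous_addPt (hκ : ((K + 1 : ℕ) : ℝ≥0) ≤ κ) (hκ' : (K : ℝ≥0) ≤ κ) (a : Fin n) :
    Continuous (addPt hκ hκ' a : Spine n κ (K + 1) → _) := by
  rw [continuous_iff_isClosed]
  intro C hC
  have hcont : ∀ pm : (Fin n → ℕ) × Fin n, Continuous fun t : {t // Adm K pm.1 pm.2 t} =>
      param hκ (pm.1 + Pi.single a 1, pm.2) ⟨t.1, t.2.add a⟩ := fun pm =>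
    (continuous_param hκ (pm.1 + Pi.single a 1, pm.2)).comp
      (continuous_subtype_val.subtype_mk fun t => t.2.add a)
  convert isClosed_iUnion_param hκ' _ fun pm => hC.preimage (hcont pm) using 1
  ext c
  constructor
  · intro hc
    obtain ⟨p, m, t, h, rfl⟩ := exists_eq_spine hκ' c
    refine ⟨(p, m), ⟨t, h⟩, ?_, rfl⟩
    rw [Set.mem_preimage, h.addPt_spine] at hc
    exact hc
  · rintro ⟨⟨p, m⟩, ⟨t, h⟩, ht, rfl⟩
    change addPt hκ hκ' a (h.spine hκ') ∈ C
    rw [h.addPt_spine]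
    exact ht

theorem compactSpace_spine (hκ' : (K : ℝ≥0) ≤ κ) : CompactSpace (Spine n κ (K + 1)) := by
  have : (Set.univ : Set (Spine n κ (K + 1))) =
      ⋃ pm ∈ {pm : (Fin n → ℕ) × Fin n | ∃ t, Adm K pm.1 pm.2 t}, Set.range (param hκ' pm) := by
    refine (Set.eq_univ_of_forall fun c => ?_).symm
    obtain ⟨p, m, t, h, rfl⟩ := exists_eq_spine hκ' c
    exact Set.mem_biUnion (x := (p, m)) ⟨t, h⟩ ⟨⟨t, h⟩, rfl⟩
  refine ⟨?_⟩
  rw [this]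
  exact (finite_adm K).isCompact_biUnion fun pm _ => isCompact_range (continuous_param hκ' pm)

theorem injective_addPt (hκ : ((K + 1 : ℕ) : ℝ≥0) ≤ κ) (hκ' : (K : ℝ≥0) ≤ κ) (a : Fin n) :
    Function.Injective (addPt hκ hκ' a : Spine n κ (K + 1) → _) := by
  intro c c' he
  obtain ⟨p, m, t, h, rfl⟩ := exists_eq_spine hκ' c
  obtain ⟨p', m', t', h', rfl⟩ := exists_eq_spine hκ' c'
  rw [h.addPt_spine, h'.addPt_spine, (h.add a).spine_eq_iff (h'.add a) hκ] at he
  obtain ⟨h1, h2, h3⟩ := he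
  rw [h.spine_eq_iff h' hκ']
  refine ⟨h1, fun ht => add_right_cancel (h2 ht), fun ht => ?_⟩
  have h4 := h3 ht
  rw [add_right_comm, add_right_comm p'] at h4
  exact add_right_cancel h4

theorem isEmbedding_addPt (hκ : ((K + 1 : ℕ) : ℝ≥0) ≤ κ) (hκ' : (K : ℝ≥0) ≤ κ) (a : Fin n) :
    Topology.IsEmbedding (addPt hκ hκ' a : Spine n κ (K + 1) → _) := by
  have := compactSpace_spine (n := n) hκ'
  exact ((continuous_addPt hκ hκ' a).isClosedEmbedding (injective_addPt hκ hκ' a)).isEmbedding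

theorem Adm.height_spine (hκ' : (K : ℝ≥0) ≤ κ) (h : Adm K p m t) : (h.spine hκ').height = t :=
    h.height_eq hκ'

theorem height_addPt (hκ : ((K + 1 : ℕ) : ℝ≥0) ≤ κ) (hκ' : (K : ℝ≥0) ≤ κ) (a : Fin n)
    (c : Spine n κ (K + 1)) : (addPt hκ hκ' a c).height = c.height := by
  obtain ⟨p, m, t, h, rfl⟩ := exists_eq_spine hκ' c
  rw [h.addPt_spine, Adm.height_spine, Adm.height_spine]

end AddMap

/-! ### Hausdorff distances and edges -/

section HausdorffDist

variable {n : ℕ} {κ : ℝ≥0} {J : ℕ}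

theorem Spine.nonempty_pts (c : Spine n κ J) : c.pts.Nonempty := by
  obtain ⟨i, -, -, ⟨z, hz⟩, -⟩ := c.2.2
  exact ⟨z, (mem_arm.1 hz).1⟩

theorem Spine.hausdorffEDist_ne_top (c c' : Spine n κ J) :
    Metric.hausdorffEDist c.pts c'.pts ≠ ⊤ :=
  Metric.hausdorffEDist_ne_top_of_nonempty_of_bounded c.nonempty_pts c'.nonempty_pts
    (c.1.1.finite_toSet).isBounded (c'.1.1.finite_toSet).isBounded

theorem Spine.hdist_comm (c c' : Spine n κ J) : c.hdist c' = c'.hdist c :=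
  Metric.hausdorffDist_comm

theorem Spine.hdist_triangle (c c' c'' : Spine n κ J) :
    c.hdist c'' ≤ c.hdist c' + c'.hdist c'' :=
  Metric.hausdorffDist_triangle (c.hausdorffEDist_ne_top c')

theorem Spine.height_le (c c' : Spine n κ J) : c.height ≤ c'.height + c'.hdist c :=
  Metric.infDist_le_infDist_add_hausdorffDist (c'.hausdorffEDist_ne_top c)

theorem Spine.edge_comm (c c' : Spine n κ J) : Spine.edge c c' = Spine.edge c' c := by
  ext d
  simp only [Spine.edge, Set.mem_ofPred_eq, add_comm]

theorem Spine.exists_dist_lt {c c' : Spine n κ J} {r : ℝ} (h : c.hdist c' < r) {x : Star n κ}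
    (hx : x ∈ c.1.1) : ∃ y ∈ c'.1.1, dist x y < r :=
  Metric.exists_dist_lt_of_hausdorffDist_lt (s := c.pts) (t := c'.pts) hx h
    (c.hausdorffEDist_ne_top c')

/-- If close points of two configurations are equal, close configurations are equal. -/
theorem Spine.eq_of_hdist_lt {c c' : Spine n κ J} (h : c.hdist c' < 1)
    (hd : ∀ x ∈ c.1.1, ∀ y ∈ c'.1.1, dist x y < 1 → x = y) : c = c' := by
  refine Subtype.ext (Subtype.ext (Finset.eq_of_subset_of_card_le (fun x hx => ?_) ?_))
  · obtain ⟨y, hy, hxy⟩ := Spine.exists_dist_lt h hx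
    rwa [hd x hx y hy hxy]
  · rw [c.1.2, c'.1.2]

end HausdorffDist

/-! ### Vertices, adjacency and edges in terms of the parameters -/

section Edges

variable {n : ℕ} {κ : ℝ≥0} {K : ℕ} {p p' : Fin n → ℕ} {m m' : Fin n} {t t' : ℝ}
theorem Adm.dist_slotPt (hκ : (K : ℝ≥0) ≤ κ) (h : Adm K p m t) (h' : Adm K p m t') (s : Slot p) :
    dist (slotPt κ p m t s) (slotPt κ p m t' s) = |t - t'| := by
  rcases s with _ | ⟨i, j⟩
  · exact dist_pt_same m h.nonneg (h.le hκ) h'.nonneg (h'.le hκ)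
  · rw [slotPt, slotPt, dist_pt_same i (h.slot_pos i j).le (h.slot_le hκ i j.2)
      (h'.slot_pos i j).le (h'.slot_le hκ i j.2)]
    unfold sgn
    split_ifs
    · congr 1
      ring
    · rw [abs_sub_comm]
      congr 1
      ring

theorem Adm.half_le (hκ : (K : ℝ≥0) ≤ κ) (h : Adm K p m (1 / 2)) {i : Fin n} {j : ℕ}
    (hj : j < (p + Pi.single m 1 : Fin n → ℕ) i) : (j : ℝ) + 1 / 2 ≤ κ := by
  have h1 := h.add_le hκ i
  by_cases hi : i = m
  · subst hi
    have h2 : j ≤ p i := by simpa [Nat.lt_succ_iff] using hj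
    have h3 : (j : ℝ) ≤ p i := by exact_mod_cast h2
    rw [sgn_self] at h1
    linarith
  · have h2 : j < p i := by simpa [hi] using hj
    have h3 : (j : ℝ) + 1 ≤ p i := by exact_mod_cast h2
    rw [sgn_ne hi] at h1
    linarith

theorem half_nonneg (j : ℕ) : (0 : ℝ) ≤ (j : ℝ) + 1 / 2 := by positivity

theorem natCast_eq_of_abs_lt {i j : ℕ} (h : |(i : ℝ) - j| < 1) : i = j := by
  rw [abs_lt] at h
  have h1 : (i : ℝ) < j + 1 := by linarith
  have h2 : (j : ℝ) < i + 1 := by linarith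
  have h3 : i < j + 1 := by exact_mod_cast h1
  have h4 : j < i + 1 := by exact_mod_cast h2
  omega

theorem Adm.zero (h : Adm K p m t) : Adm K p m 0 := adm_zero h.sum m

theorem Adm.half (h : Adm K p m t) (ht : 0 < t) : Adm K p m (1 / 2) :=
  ⟨h.sum, by norm_num, le_rfl, Or.inr (h.two.resolve_left ht.ne')⟩

theorem Adm.mid (h : Adm K p m (1 / 2)) (h0 : 0 ≤ t) (h1 : t ≤ 1 / 2) : Adm K p m t :=
  ⟨h.sum, h0, h1, Or.inr (h.two.resolve_left (by norm_num))⟩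

variable [Nontrivial (Fin n)]

/-- Corresponding slots are at distance `|t - t'|`, which bounds the distance from above. It is
bounded from below because the height is 1-Lipschitz. -/
theorem Adm.hdist_spine (hκ : (K : ℝ≥0) ≤ κ) (h : Adm K p m t) (h' : Adm K p m t') :
    (h.spine hκ).hdist (h'.spine hκ) = |t - t'| := by
  refine le_antisymm ?_ ?_
  · refine Metric.hausdorffDist_le_of_mem_dist (abs_nonneg _) (fun x hx => ?_) fun x hx => ?_
    · obtain ⟨s, rfl⟩ := (h.mem_conf hκ).1 hx
      exact ⟨_, (h'.mem_conf hκ).2 ⟨s, rfl⟩, (h.dist_slotPt hκ h' s).le⟩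
    · obtain ⟨s, rfl⟩ := (h'.mem_conf hκ).1 hx
      refine ⟨_, (h.mem_conf hκ).2 ⟨s, rfl⟩, ?_⟩
      rw [h'.dist_slotPt hκ h s, abs_sub_comm]
  · have h1 := Spine.height_le (h.spine hκ) (h'.spine hκ)
    have h2 := Spine.height_le (h'.spine hκ) (h.spine hκ)
    rw [h.height_spine, h'.height_spine, Spine.hdist_comm] at h1
    rw [h.height_spine, h'.height_spine] at h2
    rw [abs_le]
    constructor <;> linarith

/-- Integral positions that are closer than 1 coincide. -/
theorem Adm.spine_zero_eq (hκ : (K : ℝ≥0) ≤ κ) (h : Adm K p m 0) (h' : Adm K p' m' 0)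
    (hd : (h.spine hκ).hdist (h'.spine hκ) < 1) : h.spine hκ = h'.spine hκ := by
  refine Spine.eq_of_hdist_lt hd fun x hx y hy hxy => ?_
  have key : ∀ {p : Fin n → ℕ} {m : Fin n}, Adm K p m 0 → ∀ {i : Fin n} {j : ℕ}, j ≤ p i →
      (j : ℝ) ≤ κ := fun h i j hj => by
    have h1 : (K : ℝ) ≤ κ := by exact_mod_cast hκ
    have h2 : (j : ℝ) ≤ K := by exact_mod_cast hj.trans (h.le_sum i)
    linarith
  obtain ⟨i, j, hj, rfl⟩ := (h.mem_conf_zero hκ).1 hx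
  obtain ⟨i', j', hj', rfl⟩ := (h'.mem_conf_zero hκ).1 hy
  by_cases hi : i = i'
  · subst hi
    rw [dist_pt_same i (Nat.cast_nonneg _) (key h hj) (Nat.cast_nonneg _) (key h' hj')] at hxy
    rw [natCast_eq_of_abs_lt hxy]
  · rw [dist_pt_ne hi (Nat.cast_nonneg _) (key h hj) (Nat.cast_nonneg _) (key h' hj')] at hxy
    have : j + j' < 1 := by exact_mod_cast hxy
    obtain ⟨rfl, rfl⟩ : j = 0 ∧ j' = 0 := by omega
    simp [pt_zero]

/-- Half-integral positions differ by integers on one leg and are at least `1 / 2 + 1 / 2` apart on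
different legs. -/
theorem Adm.spine_half_eq (hκ : (K : ℝ≥0) ≤ κ) (h : Adm K p m (1 / 2)) (h' : Adm K p' m' (1 / 2))
    (hd : (h.spine hκ).hdist (h'.spine hκ) < 1) : h.spine hκ = h'.spine hκ := by
  refine Spine.eq_of_hdist_lt hd fun x hx y hy hxy => ?_
  obtain ⟨i, j, hj, rfl⟩ := (h.mem_conf_half hκ).1 hx
  obtain ⟨i', j', hj', rfl⟩ := (h'.mem_conf_half hκ).1 hy
  have hjκ := h.half_le hκ hj
  have hjκ' := h'.half_le hκ hj'
  by_cases hi : i = i'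
  · subst hi
    rw [dist_pt_same i (half_nonneg j) hjκ (half_nonneg j') hjκ', add_sub_add_right_eq_sub] at hxy
    rw [natCast_eq_of_abs_lt hxy]
  · rw [dist_pt_ne hi (half_nonneg j) hjκ (half_nonneg j') hjκ'] at hxy
    have h1 : (0 : ℝ) ≤ j := Nat.cast_nonneg _
    have h2 : (0 : ℝ) ≤ j' := Nat.cast_nonneg _
    linarith

/-- The points of an edge are the standard configurations with the same combinatorial data. -/
theorem Adm.edge_eq (hκ : (K : ℝ≥0) ≤ κ) (h : Adm K p m (1 / 2)) :
    Spine.edge (h.zero.spine hκ) (h.spine hκ) =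
      {c | ∃ t, ∃ h' : Adm K p m t, c = h'.spine hκ} := by
  ext c
  constructor
  · intro hc
    obtain ⟨p', m', t, h', rfl⟩ := exists_eq_spine hκ c
    have h0 := h'.nonneg
    have h1 := h'.le_half
    refine ⟨t, h.mid h0 h1, ?_⟩
    have he : (h'.spine hκ).hdist (h.zero.spine hκ) + (h'.spine hκ).hdist (h.spine hκ) = 1 / 2 := hc
    -- By the heights, the distances to the ends are at least `t` and `1 / 2 - t`; their sum is `1 /
    -- 2`, so both are equalities. The ends of the edge that carries `c` are then within `2 t` and
    -- `1 - 2 t` of the given ends, and a distance below 1 forces vertices of one kind to be equal.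
    have h2 := Spine.height_le (h'.spine hκ) (h.zero.spine hκ)
    have h3 := Spine.height_le (h.spine hκ) (h'.spine hκ)
    rw [h'.height_spine, h.zero.height_spine, Spine.hdist_comm] at h2
    rw [h'.height_spine, h.height_spine] at h3
    rw [h'.spine_eq_iff (h.mid h0 h1)]
    refine ⟨rfl, fun ht => ?_, fun ht => ?_⟩
    · have h4 := h'.zero.hdist_spine hκ h'
      rw [zero_sub, abs_neg, abs_of_nonneg h0] at h4
      have h5 := Spine.hdist_triangle (h'.zero.spine hκ) (h'.spine hκ) (h.zero.spine hκ)
      have h6 := h'.zero.spine_zero_eq hκ h.zero (by linarith)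
      exact ((h'.zero.spine_eq_iff h.zero hκ).1 h6).2.1 (by norm_num)
    · have h4 := (h'.half ht).hdist_spine hκ h'
      rw [abs_of_nonneg (by linarith)] at h4
      have h5 := Spine.hdist_triangle ((h'.half ht).spine hκ) (h'.spine hκ) (h.spine hκ)
      have h6 := (h'.half ht).spine_half_eq hκ h (by linarith)
      exact (((h'.half ht).spine_eq_iff h hκ).1 h6).2.2 (by norm_num)
  · rintro ⟨t, h', rfl⟩
    change (h'.spine hκ).hdist (h.zero.spine hκ) + (h'.spine hκ).hdist (h.spine hκ) = 1 / 2
    rw [h'.hdist_spine hκ h.zero, h'.hdist_spine hκ h, sub_zero, abs_of_nonneg h'.nonneg,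
      abs_of_nonpos (by linarith [h'.le_half])]
    ring

theorem Adm.adjacent (hκ : (K : ℝ≥0) ≤ κ) (h : Adm K p m (1 / 2)) :
    Spine.Adjacent (h.zero.spine hκ) (h.spine hκ) := by
  refine ⟨Or.inl (h.zero.height_spine hκ), Or.inr (h.height_spine hκ), ?_⟩
  rw [h.zero.hdist_spine hκ h]
  norm_num

/-- A vertex at the centre and an adjacent vertex off the centre have common combinatorial
data. -/
theorem exists_adm_of_hdist (hκ : (K : ℝ≥0) ≤ κ) (h : Adm K p m 0) (h' : Adm K p' m' (1 / 2))
    (hd : (h.spine hκ).hdist (h'.spine hκ) = 1 / 2) :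
    ∃ m₁, ∃ h₁ : Adm K p m₁ (1 / 2), h.spine hκ = h₁.zero.spine hκ ∧
      h'.spine hκ = h₁.spine hκ := by
  have hle : ∀ i, p i ≤ (p' + Pi.single m' 1 : Fin n → ℕ) i := by
    intro i
    by_contra hlt
    push Not at hlt
    have hpos : 1 ≤ p i := by omega
    have hpos' : (1 : ℝ) ≤ p i := by exact_mod_cast hpos
    have hpκ : (p i : ℝ) ≤ κ := by
      have h1 : (K : ℝ) ≤ κ := by exact_mod_cast hκ
      have h2 : (p i : ℝ) ≤ K := by exact_mod_cast h.le_sum i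
      linarith
    -- The outermost point of leg `i`, at distance `p i`, has a partner within `3 / 4`. Points of
    -- other legs are at distance at least `3 / 2`, so the partner is on leg `i`, and its index is
    -- at least `p i - 1`, against `hlt`.
    obtain ⟨y, hy, hxy⟩ := Spine.exists_dist_lt (r := 3 / 4) (by rw [hd]; norm_num)
      ((h.mem_conf_zero hκ).2 ⟨i, p i, le_rfl, rfl⟩)
    obtain ⟨i', j, hj, rfl⟩ := (h'.mem_conf_half hκ).1 hy
    have hj0 : (0 : ℝ) ≤ j := Nat.cast_nonneg _
    by_cases hi : i = i'
    · subst hi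
      rw [dist_pt_same i (by linarith) hpκ (half_nonneg j) (h'.half_le hκ hj), abs_lt] at hxy
      have h1 : (p i : ℝ) < j + 2 := by linarith
      have h2 : p i < j + 2 := by exact_mod_cast h1
      omega
    · rw [dist_pt_ne hi (by linarith) hpκ (half_nonneg j) (h'.half_le hκ hj)] at hxy
      linarith
  -- The vectors are now comparable and their totals differ by one, so they differ by a unit vector
  -- `e_m₁`.
  have hsum : ∑ i, (p' + Pi.single m' 1 : Fin n → ℕ) i = ∑ i, p i + 1 := by
    rw [sum_add_single, h.sum, h'.sum]
  obtain ⟨m₁, hm₁⟩ : ∃ m₁, p m₁ < (p' + Pi.single m' 1 : Fin n → ℕ) m₁ := by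
    by_contra hcon
    push Not at hcon
    have := Finset.sum_le_sum fun i (_ : i ∈ Finset.univ) => hcon i
    omega
  have hle' : ∀ i, (p + Pi.single m₁ 1 : Fin n → ℕ) i ≤ (p' + Pi.single m' 1 : Fin n → ℕ) i := by
    intro i
    by_cases hi : i = m₁
    · subst hi
      simpa using hm₁
    · simpa [hi] using hle i
  have hq : p + Pi.single m₁ 1 = p' + Pi.single m' 1 := by
    funext i
    refine (Finset.sum_eq_sum_iff_of_le fun i _ => hle' i).1 ?_ i (Finset.mem_univ i)
    rw [hsum, sum_add_single]
  have htwo : ∃ i, i ≠ m₁ ∧ p i ≠ 0 := by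
    obtain ⟨l, hl, hpl⟩ := h'.two.resolve_left (by norm_num)
    have hlm : ∃ i, i ≠ m₁ ∧ (p' + Pi.single m' 1 : Fin n → ℕ) i ≠ 0 := by
      by_cases hlm : l = m₁
      · exact ⟨m', fun h => hl (hlm.trans h.symm), by simp⟩
      · exact ⟨l, hlm, by simp [hpl]⟩
    obtain ⟨i, hi, hpi⟩ := hlm
    refine ⟨i, hi, ?_⟩
    rw [← hq] at hpi
    simpa [hi] using hpi
  have h₁ : Adm K p m₁ (1 / 2) := ⟨h.sum, by norm_num, le_rfl, Or.inr htwo⟩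
  refine ⟨m₁, h₁, ?_, ?_⟩
  · rw [h.spine_eq_iff h₁.zero]
    exact ⟨rfl, fun _ => rfl, fun h0 => absurd h0 (lt_irrefl _)⟩
  · rw [h'.spine_eq_iff h₁]
    exact ⟨rfl, fun h0 => absurd h0 (lt_irrefl _), fun _ => hq.symm⟩

theorem Spine.Adjacent.exists_adm (hκ : (K : ℝ≥0) ≤ κ) {c c' : Spine n κ (K + 1)} (h :
    Spine.Adjacent c c') :
    ∃ p m, ∃ h₁ : Adm K p m (1 / 2), (c = h₁.zero.spine hκ ∧ c' = h₁.spine hκ) ∨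
      (c' = h₁.zero.spine hκ ∧ c = h₁.spine hκ) := by
  obtain ⟨hv, hv', hd⟩ := h
  obtain ⟨p, m, t, h, rfl⟩ := exists_eq_spine hκ c
  obtain ⟨p', m', t', h', rfl⟩ := exists_eq_spine hκ c'
  have hself : ∀ c : Spine n κ (K + 1), c.hdist c = 0 := fun c => Metric.hausdorffDist_self_zero
  rw [Spine.IsVertex, h.height_spine] at hv
  rw [Spine.IsVertex, h'.height_spine] at hv'
  rcases hv with rfl | rfl <;> rcases hv' with rfl | rfl
  · rw [h.spine_zero_eq hκ h' (by rw [hd]; norm_num), hself] at hd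
    norm_num at hd
  · obtain ⟨m₁, h₁, h2, h3⟩ := exists_adm_of_hdist hκ h h' hd
    exact ⟨p, m₁, h₁, Or.inl ⟨h2, h3⟩⟩
  · rw [Spine.hdist_comm] at hd
    obtain ⟨m₁, h₁, h2, h3⟩ := exists_adm_of_hdist hκ h' h hd
    exact ⟨p', m₁, h₁, Or.inr ⟨h2, h3⟩⟩
  · rw [h.spine_half_eq hκ h' (by rw [hd]; norm_num), hself] at hd
    norm_num at hd

theorem isSimplicialEmbedding_addPt (hκ : ((K + 1 : ℕ) : ℝ≥0) ≤ κ) (hκ' : (K : ℝ≥0) ≤ κ)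
    (a : Fin n) : IsSimplicialEmbedding (addPt hκ hκ' a : Spine n κ (K + 1) → _) := by
  have key : ∀ {p : Fin n → ℕ} {m : Fin n} (h : Adm K p m (1 / 2)),
      Spine.Adjacent (addPt hκ hκ' a (h.zero.spine hκ')) (addPt hκ hκ' a (h.spine hκ')) ∧
      addPt hκ hκ' a '' Spine.edge (h.zero.spine hκ') (h.spine hκ') =
        Spine.edge (addPt hκ hκ' a (h.zero.spine hκ')) (addPt hκ hκ' a (h.spine hκ')) := by
    intro p m h
    rw [h.addPt_spine, h.zero.addPt_spine, h.edge_eq]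
    refine ⟨(h.add a).adjacent hκ, ?_⟩
    refine Eq.trans ?_ ((h.add a).edge_eq hκ).symm
    ext c
    constructor
    · rintro ⟨_, ⟨t, h', rfl⟩, rfl⟩
      exact ⟨t, h'.add a, h'.addPt_spine hκ hκ' a⟩
    · rintro ⟨t, h', rfl⟩
      exact ⟨_, ⟨t, h.mid h'.nonneg h'.le_half, rfl⟩, Adm.addPt_spine hκ hκ' a _⟩
  refine ⟨isEmbedding_addPt hκ hκ' a, fun c hc => ?_, fun c₀ c₁ h => ?_, height_addPt hκ hκ' a⟩
  · rwa [Spine.IsVertex, height_addPt]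
  · obtain ⟨p, m, h₁, ⟨rfl, rfl⟩ | ⟨rfl, rfl⟩⟩ := h.exists_adm hκ'
    · exact key h₁
    · obtain ⟨⟨h2, h3, h4⟩, h5⟩ := key h₁
      refine ⟨⟨h3, h2, by rw [Spine.hdist_comm, h4]⟩, ?_⟩
      rw [Spine.edge_comm, h5, Spine.edge_comm]

end Edges


/-! ### The homomorphism of braid groups -/

section Main

variable {n : ℕ} {κ : ℝ≥0} {K : ℕ} [Nontrivial (Fin n)]

/-- The continuous map of spines that adds a point on the leg `a`. -/
noncomputable def addMap (hκ : ((K + 1 : ℕ) : ℝ≥0) ≤ κ) (hκ' : (K : ℝ≥0) ≤ κ) (a : Fin n) :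
    C(Spine n κ (K + 1), Spine n κ (K + 1 + 1)) := ⟨addPt hκ hκ' a, continuous_addPt hκ hκ' a⟩

theorem addMap_mem_nearSet (hκ : ((K + 1 : ℕ) : ℝ≥0) ≤ κ) (hκ' : (K : ℝ≥0) ≤ κ) (a : Fin n)
    {c : Spine n κ (K + 1)} {p : Fin n → ℕ} (hc : c.1 ∈ nearSet n κ (K + 1) p) :
    (addMap hκ hκ' a c).1 ∈ nearSet n κ (K + 1 + 1) (p + Pi.single a 1) := by
  obtain ⟨p', m, t, h, rfl⟩ := exists_eq_spine hκ' c
  obtain ⟨rfl, ht⟩ := h.of_mem_nearSet hκ' hc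
  have := (h.add a).conf_mem_nearSet hκ ht
  change (addPt hκ hκ' a (h.spine hκ')).1 ∈ _
  rwa [h.addPt_spine]

theorem addMap_mem_legSet (hκ : ((K + 1 : ℕ) : ℝ≥0) ≤ κ) (hκ' : (K : ℝ≥0) ≤ κ) (a : Fin n)
    {c : Spine n κ (K + 1)} {q : Fin n → ℕ} (hc : c.1 ∈ legSet n κ (K + 1) q) :
    (addMap hκ hκ' a c).1 ∈ legSet n κ (K + 1 + 1) (q + Pi.single a 1) := by
  obtain ⟨p', m, t, h, rfl⟩ := exists_eq_spine hκ' c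
  obtain ⟨rfl, ht⟩ := h.of_mem_legSet hκ' hc
  have := (h.add a).conf_mem_legSet hκ ht
  change (addPt hκ hκ' a (h.spine hκ')).1 ∈ _
  rwa [h.addPt_spine, add_right_comm p']

/-- The centre stays occupied. At such points the cocycles of both labels are 1, as
`IsLabel.natural` needs. -/
theorem addMap_notMem_legSet (hκ : ((K + 1 : ℕ) : ℝ≥0) ≤ κ) (hκ' : (K : ℝ≥0) ≤ κ) (a : Fin n)
    {c : Spine n κ (K + 1)} (hc : ∀ q, c.1 ∉ legSet n κ (K + 1) q) (q : Fin n → ℕ) :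
    (addMap hκ hκ' a c).1 ∉ legSet n κ (K + 1 + 1) q := by
  have h1 : center n κ ∈ c.1.1 := by
    by_contra h
    exact hc _ (mem_legSet_of_center_notMem h)
  intro hq
  refine center_notMem_of_mem_legSet hq ?_
  obtain ⟨x, -, hx⟩ := exists_pts_addPt hκ hκ' a c
  have : center n κ ∈ (addPt hκ hκ' a c).pts := by
    rw [hx]
    exact Or.inl h1
  exact this

/-- The inclusion of the spine induces an isomorphism of fundamental groups. -/
theorem bijective_toBraid (hκ : (K : ℝ≥0) ≤ κ) (a : Fin n)
    {L : ∀ {x y : UConf (Star n κ) (K + 1)}, Path.Homotopic.Quotient x y → FreeGroup (Edges a K)}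
    (hL : IsLabel (nearSet n κ (K + 1)) (legSet n κ (K + 1)) (edgeLabel a K) @L)
    (c : Spine n κ (K + 1)) (h : Function.Bijective (hL.hom c.1)) :
    Function.Bijective c.toBraid := by
  have h1 := (isGraphCover_spine hκ a).bijective_label (hL.comap (Spine.incl n κ (K + 1))) c
  -- The label on the spine is the label of the included path, so bijectivity of both labels passes
  -- to the inclusion.
  have h2 : ((hL.comap (Spine.incl n κ (K + 1))).hom c : _ → _) = hL.hom c.1 ∘ c.toBraid := rfl
  rw [h2] at h1
  exact (Function.Bijective.of_comp_iff' h _).1 h1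

/-- In terms of the labels `φ` is `FreeGroup.map Edges.shift`. Compatibility with the map of spines
is naturality of labels, and the rest is about free groups with an injection of generators. -/
theorem exists_braid_hom (hκ : ((K + 1 : ℕ) : ℝ≥0) ≤ κ) (hκ' : (K : ℝ≥0) ≤ κ) (a : Fin n)
    (c : Spine n κ (K + 1)) :
    Function.Bijective c.toBraid ∧ Function.Bijective (addMap hκ hκ' a c).toBraid ∧
    ∃ φ : BraidGroup n κ (K + 1) c.1 →* BraidGroup n κ (K + 1 + 1) (addMap hκ hκ' a c).1,
      φ.comp c.toBraid = (addMap hκ hκ' a c).toBraid.comp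
        (FundamentalGroup.map (addMap hκ hκ' a) c) ∧
      Function.Injective φ ∧ IsFreeGroup (BraidGroup n κ (K + 1) c.1) ∧
      ∀ (ι : Type) (β : FreeGroupBasis ι (BraidGroup n κ (K + 1) c.1)),
        ∃ (ι' : Type)
          (β' : FreeGroupBasis ι' (BraidGroup n κ (K + 1 + 1) (addMap hκ hκ' a c).1))
          (g : ι → ι'), Function.Injective g ∧ ∀ i, φ (β i) = β' (g i) := by
  have hpos : 0 < κ := lt_of_lt_of_le (by positivity) hκ
  have HU := isGraphCover_conf hκ' hpos a
  have HU' := isGraphCover_conf hκ hpos a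
  obtain ⟨L, hL⟩ := HU.exists_isLabel (edgeLabel a K)
  obtain ⟨L', hL'⟩ := HU'.exists_isLabel (edgeLabel a (K + 1))
  have hb := HU.bijective_label hL c.1
  have hb' := HU'.bijective_label hL' (addMap hκ hκ' a c).1
  let e := MulEquiv.ofBijective _ hb
  let e' := MulEquiv.ofBijective _ hb'
  refine ⟨bijective_toBraid hκ' a hL c hb, bijective_toBraid hκ a hL' _ hb',
    e'.symm.toMonoidHom.comp ((FreeGroup.map Edges.shift).comp e.toMonoidHom), ?_, ?_, ?_, ?_⟩
  · refine MonoidHom.ext fun γ => ?_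
    refine (MulEquiv.symm_apply_eq e').2 ?_
    refine (IsLabel.natural (isGraphCover_spine hκ' a) (hL.comap (Spine.incl n κ (K + 1)))
      (hL'.comap (Spine.incl n κ (K + 1 + 1))) (addMap hκ hκ' a) (FreeGroup.map Edges.shift)
      (Pi.single a 1) (fun p m => map_edgeLabel a K p m) (fun x p hx => addMap_mem_nearSet hκ hκ'
          a hx)
      (fun x q hx => addMap_mem_legSet hκ hκ' a hx)
      (fun x hx q => addMap_notMem_legSet hκ hκ' a hx q) γ).symm
  · exact e'.symm.injective.comp ((FreeGroup.map_injective Edges.shift_injective).comp e.injective)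
  · exact IsFreeGroup.ofMulEquiv e.symm
  · intro ι β
    obtain ⟨ι', β', g, hg, h⟩ :=
      exists_freeGroupBasis_extending (Edges.shift_injective (a := a) (K := K)) (β.map e)
    refine ⟨ι', β'.map e'.symm, g, hg, fun i => ?_⟩
    change e'.symm (FreeGroup.map Edges.shift (e (β i))) = e'.symm (β' (g i))
    rw [← h]
    rfl

end Main

end StarBraid

theorem corollary3p3 (n k : ℕ) (κ : ℝ≥0) (hκ : (k : ℝ≥0) ≤ κ) (a : Fin n) :
    -- adding a point on the leg `[v₀, vₐ]` that keeps the configuration regular: unique choice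
    (∀ c : StarBraid.Spine n κ k,
      ∃! x : StarBraid.Star n κ, x ∈ StarBraid.seg (StarBraid.center n κ) (StarBraid.leaf κ a) ∧
        ∃ c' : StarBraid.Spine n κ (k + 1), c'.pts = c.pts ∪ {x}) ∧
    -- the resulting map is a simplicial embedding
    ∃ f : C(StarBraid.Spine n κ k, StarBraid.Spine n κ (k + 1)),
      (∀ c, ∃ x ∈ StarBraid.seg (StarBraid.center n κ) (StarBraid.leaf κ a),
        (f c).pts = c.pts ∪ {x}) ∧
      StarBraid.IsSimplicialEmbedding f ∧
      -- for every base point `c`, the spines compute the braid groups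
      ∀ c : StarBraid.Spine n κ k,
        Function.Bijective c.toBraid ∧
        Function.Bijective (f c).toBraid ∧
        -- the homomorphism of braid groups induced by the embedding
        ∃ φ : StarBraid.BraidGroup n κ k c.1 →* StarBraid.BraidGroup n κ (k + 1) (f c).1,
          φ.comp c.toBraid = (f c).toBraid.comp (FundamentalGroup.map f c) ∧
          Function.Injective φ ∧
          -- free bases: there is one, and each one is mapped injectively into a free basis
          IsFreeGroup (StarBraid.BraidGroup n κ k c.1) ∧
          ∀ (ι : Type) (β : FreeGroupBasis ι (StarBraid.BraidGroup n κ k c.1)),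
            ∃ (ι' : Type) (β' : FreeGroupBasis ι' (StarBraid.BraidGroup n κ (k + 1) (f c).1))
              (g : ι → ι'), Function.Injective g ∧ ∀ i, φ (β i) = β' (g i) := by
  -- Here the source has `k` points and the target `k + 1`. An empty source leaves nothing to show;
  -- a single regular configuration gives two different legs by its arms, and `k ≥ 1`.
  rcases isEmpty_or_nonempty (StarBraid.Spine n κ k) with hE | ⟨⟨c₀⟩⟩
  · exact ⟨isEmptyElim, ⟨isEmptyElim, continuous_of_const fun c => isEmptyElim c⟩, isEmptyElim,
      ⟨Topology.IsEmbedding.of_subsingleton _, isEmptyElim, isEmptyElim, isEmptyElim⟩, isEmptyElim⟩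
  · have hn : Nontrivial (Fin n) := by
      obtain ⟨i, j, hij, -⟩ := c₀.2.2
      exact ⟨i, j, hij⟩
    obtain ⟨K, rfl⟩ : ∃ K, k = K + 1 := by
      obtain ⟨z, hz⟩ := c₀.nonempty_pts
      have : 0 < c₀.1.1.card := Finset.card_pos.2 ⟨z, hz⟩
      rw [c₀.1.2] at this
      exact ⟨k - 1, by omega⟩
    have hκ' : (K : ℝ≥0) ≤ κ := le_trans (by exact_mod_cast Nat.le_succ K) hκ
    exact ⟨StarBraid.existsUnique_add hκ hκ' a, StarBraid.addMap hκ hκ' a,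
      StarBraid.exists_pts_addPt hκ hκ' a, StarBraid.isSimplicialEmbedding_addPt hκ hκ' a,
      StarBraid.exists_braid_hom hκ hκ' a⟩
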